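/- Let $0<\delta<\tfrac16$. For real $X,Y>0$, let $E(X;Y)$ denote the number of integers $n$ with $X/2<n\le X$, $4\nmid n$ and $n\not\equiv 7\pmod 8$ that have no representation $n=x_1^2+x_2^2+x_3^2$ with $x_1,x_2,x_3$ positive integers and $x_3\le Y$. Then there are real numbers $C$ and $X_0$, depending only on $\delta$, such that for all real $X\ge X_0$ and all real $Y$ with $$(\log X)(\log\log X)^2\le Y\le(\log X)^{1+\delta}$$ one has $$E(X;Y)\le C\,X\,Y^{-1}(\log X)(\log\log X)^2.$$ -/

import Mathlib

namespace Microsquares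

/-- The integer `n` has a representation `n = x₁² + x₂² + x₃²` in positive integers with
`x₃ ≤ Y`. -/
def IsRep (n : ℤ) (Y : ℝ) : Prop :=
  ∃ x₁ x₂ x₃ : ℕ, 0 < x₁ ∧ 0 < x₂ ∧ 0 < x₃ ∧
    n = (x₁ : ℤ) ^ 2 + (x₂ : ℤ) ^ 2 + (x₃ : ℤ) ^ 2 ∧ (x₃ : ℝ) ≤ Y

/-- The integers `n` with `X/2 < n ≤ X`, `4 ∤ n` and `n ≢ 7 (mod 8)` that have no
representation as in `IsRep`. -/
def exceptionalSet (X Y : ℝ) : Set ℤ :=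
  {n : ℤ | X / 2 < (n : ℝ) ∧ (n : ℝ) ≤ X ∧ ¬ (4 : ℤ) ∣ n ∧ ¬ n ≡ 7 [ZMOD 8] ∧ ¬ IsRep n Y}

/-- The exceptional set is finite, so that its `Set.ncard` is the true number of elements. -/
theorem exceptionalSet_finite (X Y : ℝ) : (exceptionalSet X Y).Finite := by
  refine (Set.finite_Icc ⌊X / 2⌋ ⌊X⌋).subset ?_
  rintro n ⟨h1, h2, -⟩
  exact ⟨Int.cast_le.mp ((Int.floor_le (X / 2)).trans h1.le), Int.le_floor.mpr h2⟩

/-- `E(X;Y)`, the number of exceptional integers. -/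
noncomputable def E (X Y : ℝ) : ℕ := (exceptionalSet X Y).ncard

end Microsquares

namespace Microsquares

/-! The circle method is applied in mean square over n. The Fourier coefficients of the square of
`thetaF X` are weighted counts of x² + y² = k, and the short polynomial `gF X M` with M = ⌊Y⌋
supplies the third square. By Poisson summation, near a fraction of denominator q the square of
`thetaF X` looks like the square of a normalised Gauss sum times a simple pole. `modelF` adds these
poles over the fractions with denominator at most Q, each pole being written as a geometric series,
so that the Fourier coefficients of the model are known exactly.

Suppose that n is not a sum x² + y² + t² with x, y integers and 1 ≤ t ≤ M. Then the coefficient of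
`thetaF² * gF` at n vanishes, and the coefficient of `(thetaF² - modelF) * gF` is minus the
predicted main term, which is essentially M times a singular series truncated at Q
(`integral_error_mul_ex`). Bessel's inequality therefore bounds the number of such n by a mean
square, divided by the square of a lower bound for the main term (`exists_card_mul_sq_le`).

The mean square is estimated in `exists_integral_norm_sq_le`. On the minor arcs the pointwise bound
for `thetaF` depends only on q and the distance to a/q, so |gF|² may be averaged over all a modulo
q, and only the pairs with s² ≡ t² modulo q survive. The diagonal s = t costs X M log X; the other
pairs cost X (M log M)² / Q by a divisor estimate, since q > Q.

For the main term, let W = Q!, which every q ≤ Q divides. The complete singular series modulo W is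
the density of solutions modulo W, and Hensel lifting with Mertens' theorem bounds it below by a
constant over log Q (`exists_le_ternaryCount_factorial`). The part with denominators above Q is
small for most n by orthogonality modulo W. The factor (log X)/Y in the result comes from the
diagonal and (log log X)² from the square of the loss 1/log Q. With Q = ⌊Y^(1/3)⌋ the remaining
errors are no larger; the upper bound on Y keeps W below a small power of X. -/

/-! ### Mertens-type estimates for primes. -/

-- The sum of log p · ⌊N/p⌋ equals the sum over k ≤ N of ∑_{p ∣ k} log p, hence is at most ∑ log k.
-- Removing the floors costs θ(N) ≤ N log 4.
open Finset in
lemma sum_log_div_primesLE_le {N : ℕ} (hN : 1 ≤ N) :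
    ∑ p ∈ Nat.primesLE N, Real.log p / p ≤ Real.log N + Real.log 4 := by
  have hN0 : (0 : ℝ) < N := by exact_mod_cast hN
  have h1 : ∑ p ∈ Nat.primesLE N, Real.log p * ((N / p : ℕ) : ℝ) ≤ N * Real.log N := by
    calc ∑ p ∈ Nat.primesLE N, Real.log p * ((N / p : ℕ) : ℝ)
        = ∑ p ∈ Nat.primesLE N, ∑ k ∈ Ioc 0 N, if p ∣ k then Real.log p else 0 := by
          refine sum_congr rfl fun p _ => ?_
          rw [← sum_filter, sum_const, Nat.Ioc_filter_dvd_card_eq_div, nsmul_eq_mul, mul_comm]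
      _ = ∑ k ∈ Ioc 0 N, ∑ p ∈ Nat.primesLE N, if p ∣ k then Real.log p else 0 := sum_comm
      _ ≤ ∑ k ∈ Ioc 0 N, Real.log N := by
          refine sum_le_sum fun k hk => ?_
          rw [mem_Ioc] at hk
          rw [← sum_filter]
          have hsub : (Nat.primesLE N).filter (· ∣ k) ⊆ k.primeFactors := by
            intro p hp
            rw [mem_filter, Nat.mem_primesLE] at hp
            exact Nat.mem_primeFactors.2 ⟨hp.1.2, hp.2, by omega⟩
          have hk0 : (0 : ℝ) < k := by exact_mod_cast hk.1
          calc _ ≤ ∑ p ∈ k.primeFactors, Real.log p :=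
                sum_le_sum_of_subset_of_nonneg hsub fun p _ _ => Real.log_natCast_nonneg p
            _ = Real.log ((∏ p ∈ k.primeFactors, p : ℕ) : ℝ) := by
                rw [Nat.cast_prod, Real.log_prod]
                intro p hp
                exact_mod_cast (Nat.prime_of_mem_primeFactors hp).ne_zero
            _ ≤ Real.log k := by
                refine Real.log_le_log ?_ ?_
                · exact_mod_cast prod_pos fun p hp => (Nat.prime_of_mem_primeFactors hp).pos
                · exact_mod_cast Nat.le_of_dvd hk.1 (Nat.prod_primeFactors_dvd k)
            _ ≤ Real.log N := Real.log_le_log hk0 (by exact_mod_cast hk.2)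
      _ = N * Real.log N := by simp
  have h2 : N * ∑ p ∈ Nat.primesLE N, Real.log p / p ≤
      ∑ p ∈ Nat.primesLE N, Real.log p * ((N / p : ℕ) : ℝ) + ∑ p ∈ Nat.primesLE N, Real.log p := by
    rw [mul_sum, ← sum_add_distrib]
    refine sum_le_sum fun p hp => ?_
    have hp0 : (0 : ℝ) < p := by exact_mod_cast (Nat.prime_of_mem_primesLE hp).pos
    have : (N : ℝ) / p ≤ (N / p : ℕ) + 1 := by
      rw [← Nat.floor_div_eq_div (K := ℝ)]
      exact (Nat.lt_floor_add_one _).le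
    calc N * (Real.log p / p) = Real.log p * (N / p) := by ring
      _ ≤ Real.log p * ((N / p : ℕ) + 1) :=
          mul_le_mul_of_nonneg_left this (Real.log_natCast_nonneg p)
      _ = _ := by ring
  have h3 : ∑ p ∈ Nat.primesLE N, Real.log p ≤ Real.log 4 * N := by
    rw [← Chebyshev.theta_eq_sum_primesLE_log]
    exact Chebyshev.theta_le_log4_mul_x hN0.le
  have : N * ∑ p ∈ Nat.primesLE N, Real.log p / p ≤ N * (Real.log N + Real.log 4) := by linarith
  exact le_of_mul_le_mul_left this hN0

-- Partial summation, arranged as an induction. In the difference ∑ 1/p - A(n)/log n, where A(n) = ∑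
-- (log p)/p, a new prime n + 1 cancels against itself, so only the change of the weight 1/log n
-- contributes. The constant in `key` makes n = 2 an equality.
open Finset in
lemma sum_inv_primesLE_le {N : ℕ} (hN : 2 ≤ N) :
    ∑ p ∈ Nat.primesLE N, 1 / (p : ℝ) ≤
      Real.log (Real.log N) + (3 - Real.log (Real.log 2)) := by
  have key : ∀ n : ℕ, 2 ≤ n → ∑ p ∈ Nat.primesLE n, 1 / (p : ℝ) -
      (∑ p ∈ Nat.primesLE n, Real.log p / p) / Real.log n ≤
      Real.log (Real.log n) - Real.log 4 / Real.log n + (2 - Real.log (Real.log 2)) := by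
    intro n hn
    induction n, hn using Nat.le_induction with
    | base =>
      have h2 : Nat.primesLE 2 = {2} := by decide
      have h4 : Real.log 4 = 2 * Real.log 2 := by
        rw [show (4 : ℝ) = 2 ^ 2 by norm_num, Real.log_pow]; norm_num
      have := Real.log_pos one_lt_two
      rw [h2, h4]
      simp only [sum_singleton]
      push_cast
      field_simp
      linarith
    | succ n hn ih =>
      have hl : 0 < Real.log n := Real.log_pos (by exact_mod_cast hn)
      have hll : Real.log n < Real.log (n + 1 : ℕ) :=
        Real.log_lt_log (by positivity) (by push_cast; linarith)
      have hl' : 0 < Real.log (n + 1 : ℕ) := hl.trans hll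
      set a := Real.log n
      set b := Real.log (n + 1 : ℕ)
      have hA := sum_log_div_primesLE_le (N := n) (by omega)
      have hU : ∑ p ∈ Nat.primesLE (n + 1), 1 / (p : ℝ) -
          (∑ p ∈ Nat.primesLE (n + 1), Real.log p / p) / b =
          ∑ p ∈ Nat.primesLE n, 1 / (p : ℝ) - (∑ p ∈ Nat.primesLE n, Real.log p / p) / b := by
        rw [Nat.primesLE_succ]
        split_ifs with h
        · rw [sum_insert (Nat.notMem_primesLE n), sum_insert (Nat.notMem_primesLE n)]
          have : ((n + 1 : ℕ) : ℝ) ≠ 0 := by positivity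
          change _ - (b / _ + _) / b = _
          field_simp
          ring
        · rfl
      rw [hU]
      set A := ∑ p ∈ Nat.primesLE n, Real.log p / p
      have hlog : 1 - a / b ≤ Real.log b - Real.log a := by
        have := Real.one_sub_inv_le_log_of_pos (x := b / a) (by positivity)
        rwa [inv_div, Real.log_div hl'.ne' hl.ne'] at this
      have hinv : 0 ≤ 1 / a - 1 / b := by
        rw [sub_nonneg]; exact one_div_le_one_div_of_le hl hll.le
      have h5 := mul_le_mul_of_nonneg_right hA hinv
      have e1 : (a + Real.log 4) * (1 / a - 1 / b) = 1 - a / b + (Real.log 4 / a - Real.log 4 / b) := by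
        field_simp
      have e2 : A * (1 / a - 1 / b) = A / a - A / b := by ring
      rw [e1, e2] at h5
      linarith
  have hl : 0 < Real.log N := Real.log_pos (by exact_mod_cast hN)
  have h1 := key N hN
  have h2 : (∑ p ∈ Nat.primesLE N, Real.log p / p) / Real.log N ≤ 1 + Real.log 4 / Real.log N := by
    rw [div_le_iff₀ hl, add_mul, div_mul_cancel₀ _ hl.ne', one_mul]
    exact sum_log_div_primesLE_le (by omega)
  linarith

open Finset in
/-- The lower bound in Mertens' third theorem, up to a constant. -/
theorem exists_le_prod_one_sub_inv_prime :
    ∃ c : ℝ, 0 < c ∧ ∀ N : ℕ, 2 ≤ N →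
      c / Real.log N ≤ ∏ p ∈ Nat.primesLE N, (1 - 1 / (p : ℝ)) := by
  refine ⟨Real.exp (-(4 - Real.log (Real.log 2))), Real.exp_pos _, fun N hN => ?_⟩
  have hl : 0 < Real.log N := Real.log_pos (by exact_mod_cast hN)
  -- The exponent is -1/(p - 1), and 1 + 1/(p - 1) is the inverse of 1 - 1/p; splitting 1/(p - 1)
  -- isolates 1/p and leaves a telescoping majorant.
  have h1 : ∀ p ∈ Nat.primesLE N,
      Real.exp (-(1 / (p : ℝ) + 1 / ((p : ℝ) * (p - 1)))) ≤ 1 - 1 / (p : ℝ) := by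
    intro p hp
    have hp2 : (2 : ℝ) ≤ p := by exact_mod_cast Nat.two_le_of_mem_primesLE hp
    have h3 := Real.add_one_le_exp (1 / (p : ℝ) + 1 / ((p : ℝ) * (p - 1)))
    rw [Real.exp_neg]
    refine inv_le_of_inv_le₀ ?_ ?_
    · rw [sub_pos, div_lt_one (by linarith)]; linarith
    · refine le_trans (le_of_eq ?_) h3
      have : (p : ℝ) - 1 ≠ 0 := by linarith
      field_simp
      ring
  have h2 : ∑ p ∈ Nat.primesLE N, 1 / ((p : ℝ) * (p - 1)) ≤ 1 := by
    have hsub : Nat.primesLE N ⊆ Ico 2 (N + 1) := by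
      intro p hp
      rw [mem_Ico]
      exact ⟨Nat.two_le_of_mem_primesLE hp, Nat.lt_succ_of_le (Nat.le_of_mem_primesLE hp)⟩
    have htel : ∀ n : ℕ, 2 ≤ n →
        ∑ k ∈ Ico 2 n, 1 / ((k : ℝ) * (k - 1)) = 1 - 1 / ((n : ℝ) - 1) := by
      intro n hn
      induction n, hn using Nat.le_induction with
      | base => norm_num
      | succ n hn ih =>
        have hn2 : (2 : ℝ) ≤ n := by exact_mod_cast hn
        rw [sum_Ico_succ_top hn, ih]
        have : (n : ℝ) - 1 ≠ 0 := by linarith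
        have : (n : ℝ) ≠ 0 := by linarith
        push_cast
        rw [add_sub_cancel_right]
        field_simp
        ring
    calc _ ≤ ∑ k ∈ Ico 2 (N + 1), 1 / ((k : ℝ) * (k - 1)) := by
          refine sum_le_sum_of_subset_of_nonneg hsub fun k hk _ => ?_
          have : (2 : ℝ) ≤ k := by exact_mod_cast (mem_Ico.1 hk).1
          have : 0 ≤ (k : ℝ) - 1 := by linarith
          positivity
      _ = 1 - 1 / (((N + 1 : ℕ) : ℝ) - 1) := htel _ (by omega)
      _ ≤ 1 := by
          rw [sub_le_self_iff]; push_cast; rw [add_sub_cancel_right]; positivity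
  calc Real.exp (-(4 - Real.log (Real.log 2))) / Real.log N
      = Real.exp (-(Real.log (Real.log N) + (4 - Real.log (Real.log 2)))) := by
        rw [neg_add, Real.exp_add, Real.exp_neg (Real.log _), Real.exp_log hl]; ring
    _ ≤ Real.exp (∑ p ∈ Nat.primesLE N, -(1 / (p : ℝ) + 1 / ((p : ℝ) * (p - 1)))) := by
        refine Real.exp_le_exp.2 ?_
        rw [sum_neg_distrib, sum_add_distrib]
        have := sum_inv_primesLE_le hN
        linarith
    _ = ∏ p ∈ Nat.primesLE N, Real.exp (-(1 / (p : ℝ) + 1 / ((p : ℝ) * (p - 1)))) :=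
        Real.exp_sum _ _
    _ ≤ _ := prod_le_prod (fun p _ => (Real.exp_pos _).le) h1

/-! ### Solutions of the ternary congruence and their lifting. -/

/-- The number of solutions of `x² + y² + z² = n` in residues modulo `m`. -/
noncomputable def ternaryCount (m : ℕ) (n : ℤ) : ℕ :=
  Nat.card {v : Fin 3 → ZMod m // ∑ i, v i ^ 2 = (n : ZMod m)}

lemma ternaryCount_mul_le {a b : ℕ} (ha : 0 < a) (hb : 0 < b) (hab : a.Coprime b) (n : ℤ) :
    ternaryCount a n * ternaryCount b n ≤ ternaryCount (a * b) n := by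
  have : NeZero (a * b) := ⟨(Nat.mul_pos ha hb).ne'⟩
  unfold ternaryCount
  rw [← Nat.card_prod]
  let e := ZMod.chineseRemainder hab
  refine Nat.card_le_card_of_injective
    (fun w => ⟨fun i => e.symm (w.1.1 i, w.2.1 i), ?_⟩) ?_
  · apply e.injective
    simp only [map_sum, map_pow, e.apply_symm_apply, map_intCast]
    ext
    · simpa [Prod.fst_sum] using w.1.2
    · simpa [Prod.snd_sum] using w.2.2
  · rintro ⟨⟨u, hu⟩, ⟨v, hv⟩⟩ ⟨⟨u', hu'⟩, ⟨v', hv'⟩⟩ h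
    have h1 : ∀ i, (u i, v i) = (u' i, v' i) := fun i =>
      e.symm.injective (congrFun (congrArg Subtype.val h) i)
    simp only [Prod.mk.injEq] at h1
    simp only [Prod.mk.injEq, Subtype.mk.injEq]
    exact ⟨funext fun i => (h1 i).1, funext fun i => (h1 i).2⟩

/-- Lifting of solutions modulo `m` to solutions modulo `m * l`: one coordinate of each solution
is determined by extracting a square root, the other two are free. -/
lemma card_mul_sq_le_ternaryCount {m l r : ℕ} (hm : 0 < m) (hl : 0 < l) (hr : r ∣ m) (n : ℤ)
    (S : Finset (Fin 3 → ℕ))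
    (hS : ∀ v ∈ S, ∑ j, (v j : ℤ) ^ 2 ≡ n [ZMOD m])
    (hinj : ∀ v ∈ S, ∀ v' ∈ S, (∀ j, (v j : ℤ) ≡ v' j [ZMOD r]) → v = v')
    (c : (Fin 3 → ℕ) → Fin 3)
    (hroot : ∀ v ∈ S, ∀ t : ℤ, t ≡ (v (c v) : ℤ) ^ 2 [ZMOD m] →
      ∃ x : ℤ, x ^ 2 ≡ t [ZMOD (m * l : ℕ)] ∧ x ≡ v (c v) [ZMOD r]) :
    S.card * l ^ 2 ≤ ternaryCount (m * l) n := by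
  classical
  have : NeZero (m * l) := ⟨(Nat.mul_pos hm hl).ne'⟩
  let u : (Fin 3 → ℕ) → (Fin 3 → Fin l) → Fin 3 → ℤ := fun v w j => v j + m * (w j : ℕ)
  have hex : ∀ (v : S) (w : Fin 3 → Fin l), ∃ x : ℤ,
      x ^ 2 ≡ n - ∑ j ∈ Finset.univ.erase (c v), u v w j ^ 2 [ZMOD (m * l : ℕ)] ∧
        x ≡ v.1 (c v) [ZMOD r] := by
    intro v w
    refine hroot v v.2 _ ?_
    have h1 : ∀ j, u v w j ≡ v.1 j [ZMOD m] := fun j => by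
      refine (Int.modEq_iff_dvd.2 ⟨-(w j : ℕ), ?_⟩)
      simp only [u]; ring
    have h2 : ∑ j ∈ Finset.univ.erase (c v), u v w j ^ 2 ≡
        ∑ j ∈ Finset.univ.erase (c v), (v.1 j : ℤ) ^ 2 [ZMOD m] := by
      rw [← ZMod.intCast_eq_intCast_iff]
      push_cast
      refine Finset.sum_congr rfl fun j _ => ?_
      have := (ZMod.intCast_eq_intCast_iff _ _ _).2 (h1 j)
      push_cast at this
      rw [this]
    have h3 := hS v v.2
    rw [← Finset.add_sum_erase _ _ (Finset.mem_univ (c v.1))] at h3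
    have h4 := (h3.symm.sub h2)
    rwa [add_sub_cancel_right] at h4
  choose x hx hxr using hex
  let s : S → (Fin 3 → Fin l) → Fin 3 → ℤ := fun v w => Function.update (u v w) (c v) (x v w)
  have hs : ∀ v w, ∑ j, ((s v w j : ℤ) : ZMod (m * l)) ^ 2 = (n : ZMod (m * l)) := by
    intro v w
    rw [← Finset.add_sum_erase _ _ (Finset.mem_univ (c v.1))]
    have h1 := (ZMod.intCast_eq_intCast_iff _ _ _).2 (hx v w)
    push_cast at h1
    have h2 : ∑ j ∈ Finset.univ.erase (c v.1), ((s v w j : ℤ) : ZMod (m * l)) ^ 2 =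
        ∑ j ∈ Finset.univ.erase (c v.1), ((u v w j : ℤ) : ZMod (m * l)) ^ 2 := by
      refine Finset.sum_congr rfl fun j hj => ?_
      simp only [s]
      rw [Function.update_of_ne (Finset.ne_of_mem_erase hj)]
    rw [h2]
    simp only [s, Function.update_self]
    rw [h1]
    ring
  have hsr : ∀ v w j, s v w j ≡ v.1 j [ZMOD r] := by
    intro v w j
    by_cases hj : j = c v
    · subst hj
      simpa only [s, Function.update_self] using hxr v w
    · simp only [s]
      rw [Function.update_of_ne hj]
      refine Int.modEq_iff_dvd.2 (Dvd.dvd.trans (Int.natCast_dvd_natCast.2 hr) ⟨-(w j : ℕ), ?_⟩)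
      simp only [u]; ring
  -- The entry `w (c v)` leaves no trace in the lifted solution, since that coordinate is
  -- overwritten by the root. Recording it separately makes `Φ` injective and later cancels one of
  -- the three factors l.
  let Φ : S × (Fin 3 → Fin l) →
      {v : Fin 3 → ZMod (m * l) // ∑ i, v i ^ 2 = (n : ZMod (m * l))} × Fin l :=
    fun q => (⟨fun j => (s q.1 q.2 j : ZMod (m * l)), hs q.1 q.2⟩, q.2 (c q.1))
  have hΦ : Function.Injective Φ := by
    rintro ⟨v, w⟩ ⟨v', w'⟩ h
    simp only [Φ, Prod.mk.injEq, Subtype.mk.injEq] at h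
    obtain ⟨h1, h2⟩ := h
    have h3 : ∀ j, s v w j ≡ s v' w' j [ZMOD (m * l : ℕ)] := fun j =>
      (ZMod.intCast_eq_intCast_iff _ _ _).1 (congrFun h1 j)
    have hrml : (r : ℤ) ∣ (m * l : ℕ) := Int.natCast_dvd_natCast.2 (hr.mul_right l)
    have h4 : v = v' := Subtype.ext (hinj v v.2 v' v'.2 fun j =>
      ((hsr v w j).symm.trans ((h3 j).of_dvd hrml)).trans (hsr v' w' j))
    subst h4
    have h5 : w = w' := by
      funext j
      by_cases hj : j = c v
      · rw [hj]; exact h2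
      · have h6 := h3 j
        simp only [s] at h6
        rw [Function.update_of_ne hj, Function.update_of_ne hj] at h6
        have h7 := Int.modEq_iff_dvd.1 h6
        have h8 : ((m : ℤ) * l) ∣ m * (((w' j : ℕ) : ℤ) - (w j : ℕ)) := by
          have : u v w' j - u v w j = m * (((w' j : ℕ) : ℤ) - (w j : ℕ)) := by
            simp only [u]; ring
          rw [← this]; exact_mod_cast h7
        have h9 := Int.dvd_of_mul_dvd_mul_left (by exact_mod_cast hm.ne') h8
        have h10 := (Int.modEq_iff_dvd.2 h9)
        rw [Int.natCast_modEq_iff] at h10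
        exact Fin.ext (Nat.ModEq.eq_of_lt_of_lt h10 (w j).2 (w' j).2)
    rw [h5]
  have hcard := Nat.card_le_card_of_injective Φ hΦ
  rw [Nat.card_prod, Nat.card_prod, Nat.card_eq_fintype_card (α := Fin l), Fintype.card_fin,
    Nat.card_eq_fintype_card (α := Fin 3 → Fin l), Fintype.card_fun, Fintype.card_fin,
    Fintype.card_fin, Nat.card_eq_fintype_card (α := S), Fintype.card_coe] at hcard
  refine Nat.le_of_mul_le_mul_right ?_ hl
  calc S.card * l ^ 2 * l = S.card * l ^ 3 := by ring
    _ ≤ _ := hcard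

/-- Hensel's lemma by Newton steps: y is corrected by (y² - t)/(2y), with `a` an inverse of 2y
modulo p. -/
lemma exists_sq_modEq_prime_pow {p : ℕ} (hp : p.Prime) (hp2 : p ≠ 2) {x t : ℤ}
    (hx : ¬ (p : ℤ) ∣ x) (h : t ≡ x ^ 2 [ZMOD p]) (k : ℕ) :
    ∃ y : ℤ, y ^ 2 ≡ t [ZMOD (p * p ^ k : ℕ)] ∧ y ≡ x [ZMOD p] := by
  have hpi : Prime (p : ℤ) := Nat.prime_iff_prime_int.1 hp
  induction k with
  | zero => exact ⟨x, by simpa using h.symm, rfl⟩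
  | succ k ih =>
    obtain ⟨y, hy, hyx⟩ := ih
    obtain ⟨s, hs⟩ := Int.modEq_iff_dvd.1 hy.symm
    have hcop : IsCoprime (2 * y) (p : ℤ) := by
      rw [isCoprime_comm, Prime.coprime_iff_not_dvd hpi]
      intro hd
      rcases hpi.dvd_or_dvd hd with h2 | h2
      · have : p ∣ 2 := by exact_mod_cast h2
        exact hp2 ((Nat.prime_dvd_prime_iff_eq hp Nat.prime_two).1 this)
      · exact hx (hyx.dvd_iff.1 h2)
    obtain ⟨a, b, hab⟩ := hcop
    refine ⟨y - p * p ^ k * (a * s), ?_, ?_⟩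
    · refine (Int.modEq_iff_dvd.2 ⟨s * b + p ^ k * (a * s) ^ 2, ?_⟩).symm
      push_cast at hs ⊢
      have : (y : ℤ) ^ 2 = t + p * p ^ k * s := by linarith
      have hb : s * (a * (2 * y)) = s - s * b * p := by linear_combination s * hab
      linear_combination this - (p : ℤ) * p ^ k * hb
    · refine Int.ModEq.trans (Int.modEq_iff_dvd.2 ⟨p ^ k * (a * s), ?_⟩) hyx
      ring

/-- If y² = t + 8·2^k·s, replacing y by y + 4·2^k·s changes the error to 8·2^k·s(1 + y) plus a
multiple of 16·4^k, and 1 + y is even. -/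
lemma exists_sq_modEq_two_pow {x t : ℤ} (hx : Odd x) (h : t ≡ x ^ 2 [ZMOD 8]) (k : ℕ) :
    ∃ y : ℤ, y ^ 2 ≡ t [ZMOD (8 * 2 ^ k : ℕ)] := by
  suffices ∃ y : ℤ, Odd y ∧ y ^ 2 ≡ t [ZMOD (8 * 2 ^ k : ℕ)] from
    this.imp fun _ h => h.2
  induction k with
  | zero => exact ⟨x, hx, by simpa using h.symm⟩
  | succ k ih =>
    obtain ⟨y, hy, hyt⟩ := ih
    obtain ⟨s, hs⟩ := Int.modEq_iff_dvd.1 hyt.symm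
    obtain ⟨j, hj⟩ := hy
    refine ⟨y + 4 * 2 ^ k * s, ?_, ?_⟩
    · refine ⟨j + 2 * 2 ^ k * s, ?_⟩
      rw [hj]; ring
    · refine (Int.modEq_iff_dvd.2 ⟨s * (j + 1) + 2 ^ k * s ^ 2, ?_⟩).symm
      push_cast at hs ⊢
      have : (y : ℤ) ^ 2 = t + 8 * 2 ^ k * s := by linarith
      linear_combination this + 8 * (2 : ℤ) ^ k * s * hj

/-! ### Points on spheres over finite fields. -/

section FiniteField
variable {F : Type*} [Field F] [Fintype F] [DecidableEq F]

local notation "χ" => quadraticChar F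

lemma sum_comp_sq (hF : ringChar F ≠ 2) (h : F → ℤ) :
    ∑ x, h (x ^ 2) = ∑ u, (1 + χ u) * h u := by
  have h1 : ∀ u : F, ((Finset.univ.filter fun x : F => x ^ 2 = u).card : ℤ) = 1 + χ u := by
    intro u
    rw [add_comm, ← quadraticChar_card_sqrts hF u]
    congr 2
    ext; simp
  calc ∑ x, h (x ^ 2) = ∑ u, ∑ x ∈ Finset.univ.filter fun x : F => x ^ 2 = u, h (x ^ 2) :=
        (Finset.sum_fiberwise _ _ _).symm
    _ = ∑ u, (1 + χ u) * h u := by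
        refine Finset.sum_congr rfl fun u _ => ?_
        rw [← h1, ← nsmul_eq_mul, ← Finset.sum_const]
        exact Finset.sum_congr rfl fun x hx => by rw [(Finset.mem_filter.1 hx).2]

lemma sum_quadraticChar_sub (hF : ringChar F ≠ 2) (n : F) : ∑ u, χ (n - u) = 0 := by
  rw [← quadraticChar_sum_zero hF]
  exact Fintype.sum_equiv (Equiv.subLeft n) _ _ fun u => rfl

/-- For s ≠ 0 the substitution u ↦ su turns the sum into the Jacobi sum J(χ, χ) = -χ(-1). -/
lemma sum_quadraticChar_mul_sub (hF : ringChar F ≠ 2) (s : F) :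
    ∑ u, χ u * χ (s - u) =
      -χ (-1) + if s = 0 then (Fintype.card F : ℤ) * χ (-1) else 0 := by
  split_ifs with hs
  · subst hs
    have h1 : ∀ u : F, χ u * χ (0 - u) = χ (-1) * if u = 0 then 0 else 1 := by
      intro u
      rw [zero_sub, ← neg_one_mul u, map_mul]
      split_ifs with h
      · simp [h]
      · have := quadraticChar_sq_one h
        linear_combination χ (-1) * this
    rw [Finset.sum_congr rfl fun u _ => h1 u, ← Finset.mul_sum]
    have : ∑ u : F, (if u = 0 then (0 : ℤ) else 1) = Fintype.card F - 1 := by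
      have h2 : ∀ u : F, (if u = 0 then (0 : ℤ) else 1) = 1 - if u = 0 then 1 else 0 := by
        intro u; split_ifs <;> rfl
      rw [Finset.sum_congr rfl fun u _ => h2 u, Finset.sum_sub_distrib]
      simp
    rw [this]; ring
  · rw [add_zero]
    have hJ := jacobiSum_nontrivial_inv (R := ℤ) (quadraticChar_ne_one hF)
    rw [(quadraticChar_isQuadratic F).inv] at hJ
    rw [← hJ, jacobiSum]
    refine (Fintype.sum_equiv (Equiv.mulLeft₀ s hs) _ _ fun u => ?_).symm
    have h1 : s - s * u = s * (1 - u) := by ring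
    have h2 := quadraticChar_sq_one hs
    change _ = χ (s * u) * χ (s - s * u)
    rw [h1, map_mul, map_mul]
    linear_combination -(χ u * χ (1 - u)) * h2

/-- The number of points on the sphere `x² + y² + z² = n` over a finite field. -/
lemma card_sphere (hF : ringChar F ≠ 2) (n : F) :
    ((Finset.univ.filter fun v : Fin 3 → F => ∑ i, v i ^ 2 = n).card : ℤ) =
      (Fintype.card F : ℤ) ^ 2 + Fintype.card F * χ (-n) := by
  have h0 : ((Finset.univ.filter fun v : Fin 3 → F => ∑ i, v i ^ 2 = n).card : ℤ) =
      ∑ x : F, ∑ y : F, ∑ z : F, if z ^ 2 = n - x ^ 2 - y ^ 2 then 1 else 0 := by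
    rw [Finset.card_filter]
    push_cast
    rw [← Fintype.sum_prod_type', ← Fintype.sum_prod_type']
    refine Fintype.sum_equiv
      ⟨fun v => ((v 0, v 1), v 2), fun q => ![q.1.1, q.1.2, q.2], fun v => ?_, fun q => ?_⟩
      _ _ fun v => ?_
    · ext i; fin_cases i <;> rfl
    · rfl
    · simp only [Fin.sum_univ_three]
      congr 1
      rw [eq_iff_iff]
      constructor <;> intro h <;> linear_combination h
  have h1 : ∀ a : F, (∑ z : F, if z ^ 2 = a then (1 : ℤ) else 0) = 1 + χ a := by
    intro a
    rw [sum_comp_sq hF (fun u => if u = a then (1 : ℤ) else 0)]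
    simp
  have hz := quadraticChar_sum_zero hF
  -- This counts the points of y² + z² = a, the inner sum over z being 1 + χ(a - y²).
  have h2 : ∀ a : F, ∑ y : F, (1 + χ (a - y ^ 2)) =
      Fintype.card F - χ (-1) + if a = 0 then (Fintype.card F : ℤ) * χ (-1) else 0 := by
    intro a
    rw [sum_comp_sq hF (fun u => 1 + χ (a - u))]
    have : ∀ u : F, (1 + χ u) * (1 + χ (a - u)) = 1 + χ u + χ (a - u) + χ u * χ (a - u) := by
      intro u; ring
    rw [Finset.sum_congr rfl fun u _ => this u, Finset.sum_add_distrib, Finset.sum_add_distrib,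
      Finset.sum_add_distrib, hz, sum_quadraticChar_sub hF, sum_quadraticChar_mul_sub hF]
    simp
    ring
  rw [h0]
  simp_rw [h1, h2]
  rw [Finset.sum_add_distrib]
  have h3 : (∑ x : F, if n - x ^ 2 = 0 then (Fintype.card F : ℤ) * χ (-1) else 0) =
      Fintype.card F * χ (-1) * (1 + χ n) := by
    rw [← h1 n, Finset.mul_sum]
    refine Finset.sum_congr rfl fun x _ => ?_
    have : n - x ^ 2 = 0 ↔ x ^ 2 = n := by rw [sub_eq_zero, eq_comm]
    simp only [this]
    split_ifs <;> ring
  rw [h3, ← neg_one_mul n, map_mul]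
  simp
  ring

end FiniteField

/-- Only nonzero solutions can be lifted, because some coordinate must be prime to p. The count is
p² - 1 for n = 0 and p² ± p otherwise; p² - p covers all cases and yields the local factor 1 - 1/p.
-/
lemma sq_sub_le_card_nonzero_sphere {p : ℕ} [Fact p.Prime] (hp2 : p ≠ 2) (n : ZMod p) :
    p ^ 2 - p ≤ (Finset.univ.filter
      fun v : Fin 3 → ZMod p => ∑ i, v i ^ 2 = n ∧ v ≠ 0).card := by
  classical
  have hF : ringChar (ZMod p) ≠ 2 := by rwa [ZMod.ringChar_zmod_n]
  have h := card_sphere hF n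
  rw [ZMod.card] at h
  have hp := (Fact.out : p.Prime).two_le
  have hsplit : (Finset.univ.filter fun v : Fin 3 → ZMod p => ∑ i, v i ^ 2 = n ∧ v ≠ 0) =
      (Finset.univ.filter fun v : Fin 3 → ZMod p => ∑ i, v i ^ 2 = n).erase 0 := by
    ext v; simp [and_comm]
  rw [hsplit]
  by_cases hn : n = 0
  · subst hn
    have h1 := Finset.pred_card_le_card_erase
      (s := Finset.univ.filter fun v : Fin 3 → ZMod p => ∑ i, v i ^ 2 = 0) (a := 0)
    simp at h
    have h2 : (Finset.univ.filter fun v : Fin 3 → ZMod p => ∑ i, v i ^ 2 = 0).card = p ^ 2 := by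
      exact_mod_cast h
    rw [h2] at h1
    omega
  · rw [Finset.erase_eq_of_notMem (by simp [eq_comm, hn])]
    have h3 : -1 ≤ quadraticChar (ZMod p) (-n) := by
      rcases quadraticChar_dichotomy (neg_ne_zero.2 hn) with h | h <;> simp [h]
    rw [tsub_le_iff_right]
    zify
    rw [h]
    nlinarith

lemma sq_sub_mul_le_ternaryCount {p : ℕ} (hp : p.Prime) (hp2 : p ≠ 2) (k : ℕ) (n : ℤ) :
    (p ^ 2 - p) * (p ^ k) ^ 2 ≤ ternaryCount (p * p ^ k) n := by
  classical
  have : Fact p.Prime := ⟨hp⟩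
  let A := Finset.univ.filter fun v : Fin 3 → ZMod p => ∑ i, v i ^ 2 = (n : ZMod p) ∧ v ≠ 0
  let φ : (Fin 3 → ZMod p) → Fin 3 → ℕ := fun v i => (v i).val
  have hφ : Function.Injective φ := fun v w h =>
    funext fun i => ZMod.val_injective p (congrFun h i)
  have hcard : (A.image φ).card = A.card := Finset.card_image_of_injective A hφ
  have hex : ∀ v : Fin 3 → ℕ, ∃ i : Fin 3, v ∈ A.image φ → ¬ (p : ℤ) ∣ v i := by
    intro v
    by_cases hv : v ∈ A.image φ
    · obtain ⟨w, hw, rfl⟩ := Finset.mem_image.1 hv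
      obtain ⟨i, hi⟩ := Function.ne_iff.1 (Finset.mem_filter.1 hw).2.2
      refine ⟨i, fun _ h => hi ?_⟩
      have := (ZMod.intCast_zmod_eq_zero_iff_dvd _ p).2 h
      simpa [φ] using this
    · exact ⟨0, fun h => absurd h hv⟩
  choose c hc using hex
  have h1 := card_mul_sq_le_ternaryCount (m := p) (l := p ^ k) (r := p) hp.pos
    (pow_pos hp.pos k) dvd_rfl n (A.image φ) ?_ ?_ c ?_
  · rw [hcard] at h1
    exact (Nat.mul_le_mul_right _ (sq_sub_le_card_nonzero_sphere hp2 _)).trans h1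
  · intro v hv
    obtain ⟨w, hw, rfl⟩ := Finset.mem_image.1 hv
    rw [← ZMod.intCast_eq_intCast_iff]
    have := (Finset.mem_filter.1 hw).2.1
    simpa [φ] using this
  · intro v hv v' hv' h
    obtain ⟨w, -, rfl⟩ := Finset.mem_image.1 hv
    obtain ⟨w', -, rfl⟩ := Finset.mem_image.1 hv'
    congr 1
    funext j
    have := (ZMod.intCast_eq_intCast_iff _ _ _).2 (h j)
    simpa [φ] using this
  · intro v hv t ht
    exact exists_sq_modEq_prime_pow hp hp2 (hc v hv) ht k

/-- The first square is taken to be 1, so that an odd coordinate is available for 2-adic lifting. -/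
lemma exists_sum_three_sq_mod_eight {n : ℤ} (h4 : ¬ (4 : ℤ) ∣ n) (h7 : ¬ n ≡ 7 [ZMOD 8]) :
    ∃ a b : ℕ, 1 + (a : ℤ) ^ 2 + (b : ℤ) ^ 2 ≡ n [ZMOD 8] := by
  have h : n % 8 = 1 ∨ n % 8 = 2 ∨ n % 8 = 3 ∨ n % 8 = 5 ∨ n % 8 = 6 := by
    unfold Int.ModEq at h7
    omega
  unfold Int.ModEq
  rcases h with h | h | h | h | h
  · exact ⟨0, 0, by rw [h]; rfl⟩
  · exact ⟨1, 0, by rw [h]; rfl⟩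
  · exact ⟨1, 1, by rw [h]; rfl⟩
  · exact ⟨2, 0, by rw [h]; rfl⟩
  · exact ⟨2, 1, by rw [h]; rfl⟩

/-- A single solution modulo 8 lifts to 4^(k-3) solutions modulo 2^k, whence the factor 64 = 4³. For
k < 3 one solution suffices, as 4^k ≤ 64. -/
lemma two_pow_sq_le_ternaryCount {n : ℤ} (h4 : ¬ (4 : ℤ) ∣ n) (h7 : ¬ n ≡ 7 [ZMOD 8]) (k : ℕ) :
    (2 ^ k) ^ 2 ≤ 64 * ternaryCount (2 ^ k) n := by
  obtain ⟨a, b, hab⟩ := exists_sum_three_sq_mod_eight h4 h7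
  rcases Nat.lt_or_ge k 3 with hk | hk
  · have h1 : 0 < ternaryCount (2 ^ k) n := by
      have : Nonempty {v : Fin 3 → ZMod (2 ^ k) // ∑ i, v i ^ 2 = (n : ZMod (2 ^ k))} := by
        refine ⟨⟨![1, a, b], ?_⟩⟩
        have hd : ((2 ^ k : ℕ) : ℤ) ∣ 8 := by
          exact_mod_cast (pow_dvd_pow 2 hk.le : 2 ^ k ∣ 2 ^ 3)
        have := (ZMod.intCast_eq_intCast_iff _ _ _).2 (hab.of_dvd hd)
        push_cast at this
        simp [Fin.sum_univ_three, this]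
      exact Nat.card_pos
    have h2 : (2 ^ k) ^ 2 ≤ (2 ^ 2) ^ 2 :=
      Nat.pow_le_pow_left (Nat.pow_le_pow_right (by norm_num) (by omega)) 2
    omega
  · obtain ⟨j, rfl⟩ := Nat.exists_eq_add_of_le hk
    have h1 := card_mul_sq_le_ternaryCount (m := 8) (l := 2 ^ j) (r := 1) (by norm_num)
      (by positivity) (one_dvd _) n {![1, a, b]} ?_ ?_ (fun _ => 0) ?_
    · rw [Finset.card_singleton] at h1
      rw [pow_add]
      norm_num at h1 ⊢
      nlinarith
    · intro v hv
      rw [Finset.mem_singleton.1 hv]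
      simpa [Fin.sum_univ_three] using hab
    · intro v hv v' hv' _
      rw [Finset.mem_singleton.1 hv, Finset.mem_singleton.1 hv']
    · intro v hv t ht
      rw [Finset.mem_singleton.1 hv] at ht
      obtain ⟨y, hy⟩ := exists_sq_modEq_two_pow (x := 1) odd_one (by simpa using ht) j
      exact ⟨y, hy, by simpa using Int.modEq_one⟩

/-- The local factor bounding the density of `x² + y² + z² = n` at the prime `p` from below. -/
noncomputable def localFactor (p : ℕ) : ℝ := if p = 2 then 1 / 64 else 1 - 1 / p

lemma localFactor_pos {p : ℕ} (hp : p.Prime) : 0 < localFactor p := by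
  unfold localFactor
  split_ifs
  · norm_num
  · have : (1 : ℝ) < p := by exact_mod_cast hp.one_lt
    rw [sub_pos, div_lt_one] <;> linarith

lemma prod_localFactor_le_ternaryCount {n : ℤ} (h4 : ¬ (4 : ℤ) ∣ n) (h7 : ¬ n ≡ 7 [ZMOD 8])
    (W : ℕ) (hW : 0 < W) :
    (W : ℝ) ^ 2 * ∏ p ∈ W.primeFactors, localFactor p ≤ ternaryCount W n := by
  induction W using Nat.recOnPosPrimePosCoprime with
  | zero => omega
  | one =>
    have : Nonempty {v : Fin 3 → ZMod 1 // ∑ i, v i ^ 2 = (n : ZMod 1)} :=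
      ⟨⟨0, Subsingleton.elim _ _⟩⟩
    have h1 : 0 < ternaryCount 1 n := Nat.card_pos
    simpa using Nat.succ_le_of_lt h1
  | prime_pow p k hp hk =>
    rw [Nat.primeFactors_prime_pow hk.ne' hp, Finset.prod_singleton, localFactor]
    split_ifs with h2
    · subst h2
      have := two_pow_sq_le_ternaryCount h4 h7 k
      have h3 : (((2 ^ k : ℕ) : ℝ)) ^ 2 ≤ 64 * ternaryCount (2 ^ k) n := by exact_mod_cast this
      linarith
    · obtain ⟨j, rfl⟩ := Nat.exists_eq_add_of_le' hk
      have h3 := sq_sub_mul_le_ternaryCount hp h2 j n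
      rw [← pow_succ'] at h3
      have hpp : p ≤ p ^ 2 := Nat.le_self_pow two_ne_zero p
      have h5 : (((p ^ 2 - p) * (p ^ j) ^ 2 : ℕ) : ℝ) ≤ ternaryCount (p ^ (j + 1)) n := by
        exact_mod_cast h3
      have hp0 : (p : ℝ) ≠ 0 := by exact_mod_cast hp.ne_zero
      refine le_trans (le_of_eq ?_) h5
      push_cast [Nat.cast_sub hpp]
      field_simp
      ring
  | coprime a b ha hb hab iha ihb =>
    have h1 := iha (by omega)
    have h2 := ihb (by omega)
    have h3 : ((ternaryCount a n * ternaryCount b n : ℕ) : ℝ) ≤ ternaryCount (a * b) n := by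
      exact_mod_cast ternaryCount_mul_le (by omega) (by omega) hab n
    rw [hab.primeFactors_mul, Finset.prod_union hab.disjoint_primeFactors]
    have h5 : 0 ≤ ∏ p ∈ b.primeFactors, localFactor p :=
      Finset.prod_nonneg fun p hp => (localFactor_pos (Nat.prime_of_mem_primeFactors hp)).le
    push_cast at h3 ⊢
    calc _ = (a : ℝ) ^ 2 * (∏ p ∈ a.primeFactors, localFactor p) *
          ((b : ℝ) ^ 2 * ∏ p ∈ b.primeFactors, localFactor p) := by ring
      _ ≤ ternaryCount a n * ternaryCount b n :=
          mul_le_mul h1 h2 (by positivity) (by positivity)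
      _ ≤ _ := h3

open Nat in
/-- The singular series is at least a constant times `1 / log Q`. -/
theorem exists_le_ternaryCount_factorial :
    ∃ c : ℝ, 0 < c ∧ ∀ Q : ℕ, 2 ≤ Q → ∀ n : ℤ, ¬ (4 : ℤ) ∣ n → ¬ n ≡ 7 [ZMOD 8] →
      c / Real.log Q * ((Q ! : ℕ) : ℝ) ^ 2 ≤ ternaryCount Q ! n := by
  obtain ⟨c, hc, h⟩ := exists_le_prod_one_sub_inv_prime
  refine ⟨c / 64, by positivity, fun Q hQ n h4 h7 => ?_⟩
  have h1 := prod_localFactor_le_ternaryCount h4 h7 Q ! (Nat.factorial_pos Q)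
  have h2 : (1 / 64 : ℝ) * ∏ p ∈ Nat.primesLE Q, (1 - 1 / (p : ℝ)) ≤
      ∏ p ∈ (Q !).primeFactors, localFactor p := by
    have hpf : (Q !).primeFactors = Nat.primesLE Q := by
      ext p
      rw [Nat.mem_primesLE, Nat.mem_primeFactors]
      constructor
      · rintro ⟨hp, hd, -⟩
        exact ⟨(hp.dvd_factorial).1 hd, hp⟩
      · rintro ⟨hle, hp⟩
        exact ⟨hp, (hp.dvd_factorial).2 hle, Nat.factorial_ne_zero Q⟩
    have h2m : 2 ∈ Nat.primesLE Q := Nat.mem_primesLE.2 ⟨hQ, Nat.prime_two⟩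
    have hpos : ∀ p ∈ (Nat.primesLE Q).erase 2, 0 ≤ 1 - 1 / (p : ℝ) := by
      intro p hp
      have : (1 : ℝ) < p := by
        exact_mod_cast Nat.one_lt_of_mem_primesLE (Finset.mem_of_mem_erase hp)
      rw [sub_nonneg, div_le_one] <;> linarith
    rw [hpf, ← Finset.mul_prod_erase _ _ h2m, ← Finset.mul_prod_erase _ localFactor h2m]
    have h3 : ∏ p ∈ (Nat.primesLE Q).erase 2, localFactor p =
        ∏ p ∈ (Nat.primesLE Q).erase 2, (1 - 1 / (p : ℝ)) :=
      Finset.prod_congr rfl fun p hp => if_neg (Finset.ne_of_mem_erase hp)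
    rw [h3, show localFactor 2 = 1 / 64 from if_pos rfl]
    have := Finset.prod_nonneg hpos
    push_cast
    nlinarith
  have h3 := h Q hQ
  calc c / 64 / Real.log Q * ((Q ! : ℕ) : ℝ) ^ 2
      = ((Q ! : ℕ) : ℝ) ^ 2 * (1 / 64 * (c / Real.log Q)) := by ring
    _ ≤ ((Q ! : ℕ) : ℝ) ^ 2 * (1 / 64 * ∏ p ∈ Nat.primesLE Q, (1 - 1 / (p : ℝ))) := by gcongr
    _ ≤ _ := (mul_le_mul_of_nonneg_left h2 (by positivity)).trans h1

/-! ### Additive characters and quadratic Gauss sums. -/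

/-- `ex t = exp (2πit)`. -/
noncomputable def ex (t : ℝ) : ℂ := Complex.exp (2 * Real.pi * Complex.I * t)

lemma ex_add (s t : ℝ) : ex (s + t) = ex s * ex t := by
  unfold ex; rw [← Complex.exp_add]; push_cast; ring_nf

@[simp] lemma ex_zero : ex 0 = 1 := by simp [ex]

@[simp] lemma ex_intCast (n : ℤ) : ex n = 1 := by
  unfold ex
  rw [Complex.exp_eq_one_iff]
  exact ⟨n, by push_cast; ring⟩

@[simp] lemma ex_natCast (n : ℕ) : ex n = 1 := by exact_mod_cast ex_intCast n

@[simp] lemma norm_ex (t : ℝ) : ‖ex t‖ = 1 := by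
  unfold ex
  rw [show 2 * Real.pi * Complex.I * t = ((2 * Real.pi * t : ℝ) : ℂ) * Complex.I by push_cast; ring]
  exact Complex.norm_exp_ofReal_mul_I _

lemma ex_neg (t : ℝ) : ex (-t) = (starRingEnd ℂ) (ex t) := by
  unfold ex
  rw [← Complex.exp_conj]
  congr 1
  simp [Complex.conj_ofNat]

lemma ex_add_intCast (t : ℝ) (n : ℤ) : ex (t + n) = ex t := by rw [ex_add, ex_intCast, mul_one]

@[fun_prop] lemma continuous_ex : Continuous ex := by unfold ex; fun_prop

lemma ex_natCast_mul (n : ℕ) (t : ℝ) : ex (n * t) = ex t ^ n := by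
  unfold ex; rw [← Complex.exp_nat_mul]; push_cast; ring_nf

lemma ex_intCast_div (q : ℕ) [NeZero q] (a : ℤ) :
    ex ((a : ℝ) / q) = ZMod.stdAddChar (a : ZMod q) := by
  rw [ZMod.stdAddChar_coe, ex]; push_cast; ring_nf

lemma sum_range_natCast_zmod {β : Type*} [AddCommMonoid β] (q : ℕ) [NeZero q] (F : ZMod q → β) :
    ∑ r ∈ Finset.range q, F r = ∑ x, F x :=
  Finset.sum_bij' (fun r _ => (r : ZMod q)) (fun x _ => x.val) (fun _ _ => Finset.mem_univ _)
    (fun x _ => Finset.mem_range.2 x.val_lt)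
    (fun _ hr => ZMod.val_cast_of_lt (Finset.mem_range.1 hr))
    (fun x _ => ZMod.natCast_zmod_val x) (fun _ _ => rfl)

-- Squaring the sum and substituting x = y + h, the sum over y is orthogonality and leaves only the
-- h with 2ah = 0, of which there are at most two.
open Finset in
lemma norm_sum_quadratic_stdAddChar_sq_le (q : ℕ) [NeZero q] (a : ZMod q) (ha : IsUnit a)
    (j : ZMod q) :
    ‖∑ x : ZMod q, (ZMod.stdAddChar (a * x ^ 2 + j * x) : ℂ)‖ ^ 2 ≤ 2 * q := by
  set ψ : AddChar (ZMod q) ℂ := ZMod.stdAddChar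
  have hψ : ψ.IsPrimitive := ZMod.isPrimitive_stdAddChar q
  have h1 : ((‖∑ x : ZMod q, ψ (a * x ^ 2 + j * x)‖ ^ 2 : ℝ) : ℂ) =
      ∑ h : ZMod q, ψ (a * h ^ 2 + j * h) * if 2 * a * h = 0 then (q : ℂ) else 0 := by
    push_cast
    rw [← Complex.mul_conj', map_sum, sum_mul_sum, sum_comm]
    have : ∀ y : ZMod q, ∑ x : ZMod q, ψ (a * x ^ 2 + j * x) *
        (starRingEnd ℂ) (ψ (a * y ^ 2 + j * y)) =
        ∑ h : ZMod q, ψ (a * h ^ 2 + j * h) * ψ (y * (2 * a * h)) := by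
      intro y
      refine Fintype.sum_equiv (Equiv.subRight y) _ _ fun x => ?_
      rw [← AddChar.map_neg_eq_conj, ← AddChar.map_add_eq_mul, ← AddChar.map_add_eq_mul]
      congr 1
      simp only [Equiv.subRight_apply]
      ring
    rw [sum_congr rfl fun y _ => this y, sum_comm]
    refine sum_congr rfl fun h _ => ?_
    rw [← mul_sum, AddChar.sum_mulShift _ hψ, ZMod.card]
    simp
  have h2 : ‖((‖∑ x : ZMod q, ψ (a * x ^ 2 + j * x)‖ ^ 2 : ℝ) : ℂ)‖ ≤
      ∑ h : ZMod q, if 2 * a * h = 0 then (q : ℝ) else 0 := by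
    rw [h1]
    refine (norm_sum_le _ _).trans (sum_le_sum fun h _ => ?_)
    rw [norm_mul, AddChar.norm_apply, one_mul]
    split_ifs <;> simp
  rw [Complex.norm_real, Real.norm_of_nonneg (by positivity)] at h2
  refine h2.trans ?_
  rw [← sum_filter, sum_const, nsmul_eq_mul]
  refine mul_le_mul_of_nonneg_right ?_ (Nat.cast_nonneg q)
  -- For odd q the second listed element is superfluous, which does no harm to an upper bound.
  have hsub : univ.filter (fun h : ZMod q => 2 * a * h = 0) ⊆
      {(0 : ZMod q), ((q / 2 : ℕ) : ZMod q)} := by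
    intro h hh
    have h3 : 2 * h = 0 := by
      have := (mem_filter.1 hh).2
      rw [mul_right_comm] at this
      exact (ha.mul_left_eq_zero).1 this
    have h4 : ((2 * h.val : ℕ) : ZMod q) = 0 := by
      push_cast; rw [ZMod.natCast_zmod_val]; exact h3
    obtain ⟨k, hk⟩ := (ZMod.natCast_eq_zero_iff _ _).1 h4
    have hlt := h.val_lt
    have hk2 : k < 2 := by
      by_contra hcon
      have : q * 2 ≤ q * k := Nat.mul_le_mul_left q (not_lt.1 hcon)
      omega
    rw [mem_insert, mem_singleton]
    interval_cases k
    · left; exact (ZMod.val_eq_zero h).1 (by omega)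
    · right
      rw [← ZMod.natCast_zmod_val h]
      congr 1; omega
  exact_mod_cast (card_le_card hsub).trans card_le_two

/-- The quadratic Gauss sum with linear term attached to a rational number. -/
noncomputable def gaussQ (ρ : ℚ) (j : ℤ) : ℂ :=
  ∑ r ∈ Finset.range ρ.den, ex (ρ * (r : ℝ) ^ 2 + j * r / ρ.den)

lemma norm_gaussQ_sq_le (ρ : ℚ) (j : ℤ) : ‖gaussQ ρ j‖ ^ 2 ≤ 2 * ρ.den := by
  have : NeZero ρ.den := ⟨ρ.den_ne_zero⟩
  have h1 : gaussQ ρ j = ∑ x : ZMod ρ.den,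
      (ZMod.stdAddChar ((ρ.num : ZMod ρ.den) * x ^ 2 + (j : ZMod ρ.den) * x) : ℂ) := by
    rw [← sum_range_natCast_zmod]
    refine Finset.sum_congr rfl fun r _ => ?_
    have := ex_intCast_div ρ.den (ρ.num * (r : ℤ) ^ 2 + j * r)
    push_cast at this
    rw [← this]
    congr 1
    rw [Rat.cast_def]
    ring
  rw [h1]
  refine norm_sum_quadratic_stdAddChar_sq_le _ _ ?_ _
  obtain ⟨a, b, hab⟩ := Rat.isCoprime_num_den ρ
  refine IsUnit.of_mul_eq_one (a : ZMod ρ.den) ?_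
  have := congrArg (Int.cast : ℤ → ZMod ρ.den) hab
  push_cast at this
  rw [ZMod.natCast_self, mul_zero, add_zero] at this
  rw [mul_comm, this]

/-! ### The theta series near a rational point. -/

open Real Complex in
lemma summable_cexp_neg_mul_sq {w : ℂ} (hw : 0 < w.re) :
    Summable fun n : ℤ => cexp (-π * w * n ^ 2) := by
  have h := (summable_jacobiTheta₂_term_iff 0 (I * w)).2 (by simpa using hw)
  refine h.congr fun n => ?_
  rw [jacobiTheta₂_term]
  congr 1
  linear_combination (π * n ^ 2 * w : ℂ) * I_sq

open Real Complex in
/-- Poisson summation for a theta series near a rational point. -/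
lemma tsum_ex_mul_cexp (ρ : ℚ) {z : ℂ} (hz : 0 < z.re) :
    ∑' x : ℤ, ex (ρ * (x : ℝ) ^ 2) * cexp (-π * z * x ^ 2) =
      1 / (z * ρ.den ^ 2) ^ (1 / 2 : ℂ) *
        ∑' j : ℤ, gaussQ ρ j * cexp (-π * (1 / (z * ρ.den ^ 2)) * j ^ 2) := by
  have hq : NeZero ρ.den := ⟨ρ.den_ne_zero⟩
  set q := ρ.den with hqdef
  have hq0 : (q : ℝ) ≠ 0 := by exact_mod_cast hq.ne
  have hqc : (q : ℂ) ≠ 0 := by exact_mod_cast hq.ne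
  have hz0 : z ≠ 0 := fun h => by simp [h] at hz
  set a : ℂ := z * q ^ 2 with ha
  have ha0 : a ≠ 0 := mul_ne_zero hz0 (pow_ne_zero 2 hqc)
  have hare : 0 < a.re := by
    have : a = ((q ^ 2 : ℝ) : ℂ) * z := by rw [ha]; push_cast; ring
    rw [this, re_ofReal_mul]
    have : (0 : ℝ) < q ^ 2 := by positivity
    positivity
  have hinv : 0 < (1 / a).re := by
    rw [one_div, inv_re]
    exact div_pos hare (normSq_pos.2 ha0)
  let F : ℤ → ℂ := fun x => ex (ρ * (x : ℝ) ^ 2) * cexp (-π * z * x ^ 2)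
  have hF : Summable F := by
    refine Summable.of_norm ?_
    refine (summable_cexp_neg_mul_sq hz).norm.congr fun x => ?_
    rw [norm_mul, norm_ex, one_mul]
  have hper : ∀ (k : ℤ) (r : ℕ), ex (ρ * ((k * q + r : ℤ) : ℝ) ^ 2) = ex (ρ * (r : ℝ) ^ 2) := by
    intro k r
    rw [← ex_add_intCast (ρ * (r : ℝ) ^ 2) (ρ.num * (k ^ 2 * q + 2 * k * r))]
    congr 1
    have : (ρ : ℝ) = ρ.num / q := by rw [hqdef, ← Rat.cast_def]
    push_cast
    rw [this]
    field_simp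
    ring
  have hinner : ∀ r : ℕ, ∑' k : ℤ, F (k * q + r) =
      1 / a ^ (1 / 2 : ℂ) * ∑' j : ℤ,
        ex (ρ * (r : ℝ) ^ 2 + j * r / q) * cexp (-π * (1 / a) * j ^ 2) := by
    intro r
    have h1 := Complex.tsum_exp_neg_quadratic hare (-(z * q * r))
    have h2 : ∀ k : ℤ, F (k * q + r) = ex (ρ * (r : ℝ) ^ 2) * cexp (-π * z * r ^ 2) *
        cexp (-π * a * k ^ 2 + 2 * π * (-(z * q * r)) * k) := by
      intro k
      simp only [F]
      rw [hper, mul_assoc (ex _) (cexp _) (cexp _), ← Complex.exp_add]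
      congr 2
      push_cast
      rw [ha]; ring
    rw [tsum_congr h2, tsum_mul_left, h1, mul_left_comm, ← tsum_mul_left]
    congr 1
    refine tsum_congr fun j => ?_
    rw [ex_add, mul_assoc (ex _) (cexp _), mul_assoc (ex _) (ex _), ← Complex.exp_add]
    congr 1
    rw [ex, ← Complex.exp_add]
    congr 1
    push_cast
    have h3 : (π : ℂ) * z * r ^ 2 = π / a * (z * q * r) ^ 2 := by rw [ha]; field_simp
    have h4 : 2 * (π : ℂ) * I * (j * r / q) = 2 * π / a * I * (z * q * r) * j := by
      rw [ha]; field_simp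
    rw [h4]
    linear_combination -h3 - π / a * (z * q * r) ^ 2 * I_sq
  have hsumj : ∀ r : ℕ, Summable fun j : ℤ =>
      ex (ρ * (r : ℝ) ^ 2 + j * r / q) * cexp (-π * (1 / a) * j ^ 2) := by
    intro r
    refine Summable.of_norm ?_
    refine (summable_cexp_neg_mul_sq hinv).norm.congr fun x => ?_
    rw [norm_mul, norm_ex, one_mul]
  let e : Fin q × ℤ ≃ ℤ := (Equiv.prodComm _ _).trans (Int.divModEquiv q).symm
  have he : ∀ r k, e (r, k) = k * q + (r : ℕ) := fun r k => rfl
  calc ∑' x : ℤ, F x = ∑' p : Fin q × ℤ, F (e p) := (e.tsum_eq F).symm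
    _ = ∑' (r : Fin q) (k : ℤ), F (e (r, k)) := ((e.summable_iff).2 hF).tsum_prod
    _ = ∑ r : Fin q, 1 / a ^ (1 / 2 : ℂ) * ∑' j : ℤ,
        ex (ρ * ((r : ℕ) : ℝ) ^ 2 + j * (r : ℕ) / q) * cexp (-π * (1 / a) * j ^ 2) := by
        rw [tsum_fintype]
        refine Finset.sum_congr rfl fun r _ => ?_
        simp_rw [he]
        exact hinner r
    _ = 1 / a ^ (1 / 2 : ℂ) * ∑ r ∈ Finset.range q, ∑' j : ℤ,
        ex (ρ * (r : ℝ) ^ 2 + j * r / q) * cexp (-π * (1 / a) * j ^ 2) := by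
        rw [← Finset.mul_sum, Finset.sum_range]
    _ = _ := by
        rw [← Summable.tsum_finsetSum fun r _ => hsumj r]
        congr 1
        refine tsum_congr fun j => ?_
        rw [gaussQ, Finset.sum_mul]

-- On the dual side of Poisson summation the term j = 0 is the main term. The others are bounded by
-- the uniform Gauss sum estimate and exp(-u) ≤ 1/u, which is summable like 1/j². The error is
-- useful when q²‖z‖²/Re z is bounded.
open Real Complex in
lemma exists_tsum_ex_mul_cexp_approx :
    ∃ K : ℝ, 0 < K ∧ ∀ (ρ : ℚ) (z : ℂ), 0 < z.re → ∃ E : ℂ,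
      ∑' x : ℤ, ex (ρ * (x : ℝ) ^ 2) * cexp (-π * z * x ^ 2) =
        1 / (z * ρ.den ^ 2) ^ (1 / 2 : ℂ) * (gaussQ ρ 0 + E) ∧
      ‖E‖ ≤ √(2 * ρ.den) * (K * (ρ.den ^ 2 * ‖z‖ ^ 2 / z.re)) := by
  have hsum : Summable fun j : ℤ => 1 / (j : ℝ) ^ 2 := Real.summable_one_div_int_pow.2 one_lt_two
  -- The added 1 only ensures positivity; the summand at j = 0 is 1/0 = 0.
  refine ⟨(1 + ∑' j : ℤ, 1 / (j : ℝ) ^ 2) / π,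
    div_pos (add_pos_of_pos_of_nonneg one_pos (tsum_nonneg fun j => by positivity)) pi_pos,
    fun ρ z hz => ?_⟩
  have hq0 : (0 : ℝ) < ρ.den := by exact_mod_cast ρ.den_pos
  have hqc : (ρ.den : ℂ) ≠ 0 := by exact_mod_cast ρ.den_ne_zero
  have hz0 : z ≠ 0 := fun h => by simp [h] at hz
  have hzn : 0 < ‖z‖ := norm_pos_iff.2 hz0
  set a : ℂ := z * ρ.den ^ 2 with ha
  set c : ℝ := z.re / (ρ.den ^ 2 * ‖z‖ ^ 2) with hc
  have hc0 : 0 < c := by positivity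
  have hre : (1 / a).re = c := by
    have : 1 / a = ((1 / (ρ.den : ℝ) ^ 2 : ℝ) : ℂ) * z⁻¹ := by
      rw [ha]; push_cast; field_simp
    rw [this, re_ofReal_mul, inv_re, normSq_eq_norm_sq, hc]
    field_simp
  let t : ℤ → ℂ := fun j => gaussQ ρ j * cexp (-π * (1 / a) * j ^ 2)
  have hG : ∀ j, ‖gaussQ ρ j‖ ≤ √(2 * ρ.den) := fun j => Real.le_sqrt_of_sq_le (norm_gaussQ_sq_le ρ j)
  have hnorm : ∀ j : ℤ, ‖cexp (-π * (1 / a) * j ^ 2)‖ = rexp (-(π * c * j ^ 2)) := by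
    intro j
    rw [norm_exp]
    congr 1
    have : -(π : ℂ) * (1 / a) * j ^ 2 = ((-(π * j ^ 2) : ℝ) : ℂ) * (1 / a) := by push_cast; ring
    rw [this, re_ofReal_mul, hre]; ring
  have ht : Summable t := by
    refine Summable.of_norm_bounded
      (g := fun j : ℤ => √(2 * ρ.den) * ‖cexp (-π * (1 / a) * j ^ 2)‖)
      ((summable_cexp_neg_mul_sq (by rw [hre]; exact hc0)).norm.mul_left _) fun j => ?_
    rw [norm_mul]
    exact mul_le_mul_of_nonneg_right (hG j) (norm_nonneg _)
  have hδ : HasSum (fun j : ℤ => if j = 0 then gaussQ ρ 0 else 0) (gaussQ ρ 0) :=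
    hasSum_ite_eq 0 _
  refine ⟨∑' j, t j - gaussQ ρ 0, ?_, ?_⟩
  · rw [tsum_ex_mul_cexp ρ hz, add_sub_cancel]
  · have hE := ht.hasSum.sub hδ
    rw [← hE.tsum_eq]
    have hbound : ∀ j : ℤ, ‖t j - if j = 0 then gaussQ ρ 0 else 0‖ ≤
        √(2 * ρ.den) * (1 / (π * c)) * (1 / (j : ℝ) ^ 2) := by
      intro j
      split_ifs with hj
      · subst hj; simp [t]
      · rw [sub_zero, norm_mul, hnorm, mul_assoc (√(2 * ρ.den))]
        refine mul_le_mul (hG j) ?_ (exp_pos _).le (Real.sqrt_nonneg _)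
        have hj0 : (j : ℝ) ≠ 0 := by exact_mod_cast hj
        have hu : 0 < π * c * (j : ℝ) ^ 2 := by positivity
        rw [Real.exp_neg, ← one_div, one_div_mul_one_div]
        exact one_div_le_one_div_of_le hu (by linarith [Real.add_one_le_exp (π * c * (j : ℝ) ^ 2)])
    have h1 := tsum_of_norm_bounded ((hsum.mul_left (√(2 * ρ.den) * (1 / (π * c)))).hasSum) hbound
    refine h1.trans ?_
    rw [tsum_mul_left, mul_assoc]
    refine mul_le_mul_of_nonneg_left ?_ (Real.sqrt_nonneg _)
    have e1 : (1 + ∑' j : ℤ, 1 / (j : ℝ) ^ 2) / π * (ρ.den ^ 2 * ‖z‖ ^ 2 / z.re) =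
      1 / (π * c) * (1 + ∑' j : ℤ, 1 / (j : ℝ) ^ 2) := by
      rw [hc]; field_simp
    rw [e1]
    gcongr
    linarith

/-- The theta series `∑ exp (-x²/X) e(αx²)` over all integers `x`. -/
noncomputable def thetaF (X α : ℝ) : ℂ :=
  ∑' x : ℤ, (Real.exp (-(x : ℝ) ^ 2 / X) : ℂ) * ex (α * (x : ℝ) ^ 2)

/-- The normalised quadratic Gauss sum of a rational number. -/
noncomputable def gam (ρ : ℚ) : ℂ := gaussQ ρ 0 / ρ.den

lemma norm_gam_sq_le (ρ : ℚ) : ‖gam ρ‖ ^ 2 ≤ 2 / ρ.den := by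
  have hq0 : (0 : ℝ) < ρ.den := by exact_mod_cast ρ.den_pos
  rw [gam, norm_div, div_pow, Complex.norm_natCast, div_le_div_iff₀ (by positivity) hq0]
  nlinarith [norm_gaussQ_sq_le ρ 0]

-- With z = 1/(πX) - 2βi one has exp(-πzx²) = exp(-x²/X) e(βx²), so the Poisson approximation
-- applies. The fourth-power bound serves the minor arcs; the approximation of the square, with
-- error of order √X, serves the arcs around the poles of the model.
open Real Complex in
lemma exists_thetaF_bounds :
    ∃ K : ℝ, 0 < K ∧ ∀ (X : ℝ) (ρ : ℚ) (β : ℝ), 0 < X → (ρ.den : ℝ) ^ 2 ≤ X →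
      (ρ.den : ℝ) ^ 2 * β ^ 2 * X ≤ 1 →
      ‖thetaF X (ρ + β)‖ ^ 4 ≤ K / (ρ.den ^ 2 * ((1 / (2 * π * X)) ^ 2 + β ^ 2)) ∧
      ‖thetaF X (ρ + β) ^ 2 - gam ρ ^ 2 / ((1 / (π * X) : ℝ) - 2 * β * I)‖ ≤ K * √X := by
  obtain ⟨K, hK, h⟩ := exists_tsum_ex_mul_cexp_approx
  refine ⟨(2 * (1 + 13 * K) ^ 2) ^ 2 / 4 + 16 * K * (2 + 13 * K), by positivity,
    fun X ρ β hX hq hβ => ?_⟩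
  set z : ℂ := (1 / (π * X) : ℝ) - 2 * β * I with hz
  have hzre : z.re = 1 / (π * X) := by simp [hz]
  have hzim : z.im = -(2 * β) := by simp [hz]
  have hzpos : 0 < z.re := by rw [hzre]; positivity
  have hz0 : z ≠ 0 := fun h => by simp [h] at hzpos
  have hzn : 0 < ‖z‖ := norm_pos_iff.2 hz0
  have hzsq : ‖z‖ ^ 2 = 4 * ((1 / (2 * π * X)) ^ 2 + β ^ 2) := by
    rw [← normSq_eq_norm_sq, normSq_apply, hzre, hzim]; field_simp; ring
  obtain ⟨E, hE, hEn⟩ := h ρ z hzpos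
  have hθ : thetaF X (ρ + β) =
      1 / (z * ρ.den ^ 2) ^ (1 / 2 : ℂ) * (gaussQ ρ 0 + E) := by
    rw [← hE, thetaF]
    refine tsum_congr fun x => ?_
    rw [add_mul, ex_add, mul_left_comm]
    congr 1
    rw [ex, ofReal_exp, ← Complex.exp_add]
    congr 1
    have : (X : ℂ) ≠ 0 := by exact_mod_cast hX.ne'
    have : (π : ℂ) ≠ 0 := by exact_mod_cast pi_ne_zero
    rw [hz]
    push_cast
    field_simp
    ring
  have hqpos : (0 : ℝ) < ρ.den := by exact_mod_cast ρ.den_pos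
  set q : ℝ := (ρ.den : ℝ) with hqdef
  have hqc : (ρ.den : ℂ) = (q : ℂ) := by rw [hqdef]; push_cast; rfl
  have hqc0 : (q : ℂ) ≠ 0 := by exact_mod_cast hqpos.ne'
  have ha0 : z * (q : ℂ) ^ 2 ≠ 0 := mul_ne_zero hz0 (pow_ne_zero _ hqc0)
  -- The choice of complex square root disappears on squaring.
  have hsq : thetaF X (ρ + β) ^ 2 = (gaussQ ρ 0 + E) ^ 2 / (z * q ^ 2) := by
    rw [hθ, mul_pow, div_pow, one_pow, hqc]
    rw [← cpow_nat_mul]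
    norm_num
    field_simp
  set s := √(2 * q) with hs
  have hs2 : s ^ 2 = 2 * q := Real.sq_sqrt (by positivity)
  have hs0 : 0 ≤ s := Real.sqrt_nonneg _
  have hG : ‖gaussQ ρ 0‖ ≤ s := Real.le_sqrt_of_sq_le (norm_gaussQ_sq_le ρ 0)
  set κ := K * (q ^ 2 * ‖z‖ ^ 2 / z.re) with hκ
  have hκ0 : 0 ≤ κ := by positivity
  -- The two hypotheses bound q²‖z‖²/Re z by 1/3 + 4 · 3.15 < 13.
  have hκ13 : κ ≤ 13 * K := by
    have e1 : q ^ 2 * ‖z‖ ^ 2 / z.re = q ^ 2 / X * (1 / π) + 4 * π * (q ^ 2 * β ^ 2 * X) := by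
      rw [hzsq, hzre]; field_simp; ring
    have h1 : q ^ 2 / X ≤ 1 := (div_le_one hX).2 hq
    have h2 : 1 / π ≤ 1 / 3 := one_div_le_one_div_of_le (by norm_num) pi_gt_three.le
    have h3 : q ^ 2 / X * (1 / π) ≤ 1 * (1 / 3) := by gcongr
    have h4 : 4 * π * (q ^ 2 * β ^ 2 * X) ≤ 4 * 3.15 * 1 := by
      gcongr
      exact pi_lt_d2.le
    rw [hκ, e1, mul_comm (13 : ℝ)]
    refine mul_le_mul_of_nonneg_left ?_ hK.le
    linarith
  have hden : ‖z * (q : ℂ) ^ 2‖ = ‖z‖ * q ^ 2 := by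
    rw [norm_mul, norm_pow, norm_real, Real.norm_of_nonneg hqpos.le]
  refine ⟨?_, ?_⟩
  · have h1 : ‖thetaF X (ρ + β)‖ ^ 2 ≤ 2 * (1 + 13 * K) ^ 2 / (q * ‖z‖) := by
      rw [← norm_pow, hsq, norm_div, hden, norm_pow, div_le_div_iff₀ (by positivity) (by positivity)]
      have h2 : ‖gaussQ ρ 0 + E‖ ≤ s * (1 + 13 * K) := by
        calc _ ≤ ‖gaussQ ρ 0‖ + ‖E‖ := norm_add_le _ _
          _ ≤ s + s * (13 * K) :=
            add_le_add hG (hEn.trans (mul_le_mul_of_nonneg_left hκ13 hs0))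
          _ = _ := by ring
      have h3 : ‖gaussQ ρ 0 + E‖ ^ 2 ≤ 2 * q * (1 + 13 * K) ^ 2 := by
        rw [← hs2, ← mul_pow]; gcongr
      calc _ ≤ 2 * q * (1 + 13 * K) ^ 2 * (q * ‖z‖) := by gcongr
        _ = _ := by ring
    calc ‖thetaF X (ρ + β)‖ ^ 4 = (‖thetaF X (ρ + β)‖ ^ 2) ^ 2 := by ring
      _ ≤ (2 * (1 + 13 * K) ^ 2 / (q * ‖z‖)) ^ 2 := by gcongr
      _ = (2 * (1 + 13 * K) ^ 2) ^ 2 / 4 / (q ^ 2 * ((1 / (2 * π * X)) ^ 2 + β ^ 2)) := by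
        rw [div_pow, mul_pow q, hzsq]
        field_simp
      _ ≤ _ := by
        gcongr
        have : 0 ≤ 16 * K * (2 + 13 * K) := by positivity
        linarith
  · have e1 : thetaF X (ρ + β) ^ 2 - gam ρ ^ 2 / z =
        (2 * gaussQ ρ 0 + E) * E / (z * q ^ 2) := by
      rw [hsq, gam, hqc]
      field_simp
      ring
    rw [e1, norm_div, hden, norm_mul]
    have h2 : ‖2 * gaussQ ρ 0 + E‖ ≤ s * (2 + 13 * K) := by
      calc _ ≤ ‖2 * gaussQ ρ 0‖ + ‖E‖ := norm_add_le _ _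
        _ ≤ 2 * s + s * (13 * K) := by
          refine add_le_add ?_ (hEn.trans (mul_le_mul_of_nonneg_left hκ13 hs0))
          rw [norm_mul, Complex.norm_ofNat]
          exact mul_le_mul_of_nonneg_left hG zero_le_two
        _ = _ := by ring
    have h3 : ‖2 * gaussQ ρ 0 + E‖ * ‖E‖ ≤ s * (2 + 13 * K) * (s * κ) := by gcongr
    have h4 : s * (2 + 13 * K) * (s * κ) / (‖z‖ * q ^ 2) =
        2 * K * (2 + 13 * K) * (q * (π * X) * ‖z‖) := by
      have : s * (2 + 13 * K) * (s * κ) = s ^ 2 * (2 + 13 * K) * κ := by ring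
      rw [this, hs2, hκ, hzre]
      field_simp
    -- The square of the left side is q² + 4π²X(q²β²X) ≤ (1 + 4 · 3.15²)X < 64X.
    have h5 : q * (π * X) * ‖z‖ ≤ 8 * √X := by
      refine abs_le_of_sq_le_sq' ?_ (by positivity) |>.2
      rw [mul_pow, mul_pow q, hzsq, mul_pow 8, Real.sq_sqrt hX.le]
      have e2 : q ^ 2 * (π * X) ^ 2 * (4 * ((1 / (2 * π * X)) ^ 2 + β ^ 2)) =
          q ^ 2 + 4 * π ^ 2 * X * (q ^ 2 * β ^ 2 * X) := by
        field_simp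
        ring
      have h6 : π ^ 2 ≤ 3.15 ^ 2 := by gcongr; exact pi_lt_d2.le
      have h7 : 4 * π ^ 2 * X * (q ^ 2 * β ^ 2 * X) ≤ 4 * 3.15 ^ 2 * X * 1 := by gcongr
      rw [e2]
      nlinarith
    calc _ ≤ s * (2 + 13 * K) * (s * κ) / (‖z‖ * q ^ 2) := by gcongr
      _ = 2 * K * (2 + 13 * K) * (q * (π * X) * ‖z‖) := h4
      _ ≤ 2 * K * (2 + 13 * K) * (8 * √X) := by gcongr
      _ = 16 * K * (2 + 13 * K) * √X := by ring
      _ ≤ _ := by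
        gcongr
        have : 0 ≤ (2 * (1 + 13 * K) ^ 2) ^ 2 / 4 := by positivity
        linarith

/-! ### Kernels, the model, and its pointwise error. -/

/-- Distance to the nearest integer. -/
noncomputable def distInt (t : ℝ) : ℝ := |t - round t|

lemma distInt_nonneg (t : ℝ) : 0 ≤ distInt t := abs_nonneg _

lemma distInt_le_abs_sub (t : ℝ) (k : ℤ) : distInt t ≤ |t - k| := round_le t k

lemma distInt_add_intCast (t : ℝ) (k : ℤ) : distInt (t + k) = distInt t := by
  unfold distInt; rw [round_add_intCast]; push_cast; congr 1; ring

lemma distInt_le_add (s t : ℝ) : distInt s ≤ distInt (s - t) + distInt t := by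
  have h := distInt_le_abs_sub s (round (s - t) + round t)
  refine h.trans ?_
  have : s - ((round (s - t) + round t : ℤ) : ℝ) =
      (s - t - round (s - t)) + (t - round t) := by push_cast; ring
  rw [this]
  exact abs_add_le _ _

lemma distInt_sub_comm (s t : ℝ) : distInt (s - t) = distInt (t - s) := by
  apply le_antisymm
  · have := distInt_le_abs_sub (s - t) (-round (t - s))
    rwa [show s - t - ((-round (t - s) : ℤ) : ℝ) = -(t - s - round (t - s)) by push_cast; ring,
      abs_neg] at this
  · have := distInt_le_abs_sub (t - s) (-round (s - t))
    rwa [show t - s - ((-round (s - t) : ℤ) : ℝ) = -(s - t - round (s - t)) by push_cast; ring,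
      abs_neg] at this

/-- The periodised Lorentzian kernel. -/
noncomputable def lorentz (A t : ℝ) : ℝ := 1 / (A ^ 2 + distInt t ^ 2)

lemma lorentz_nonneg (A t : ℝ) : 0 ≤ lorentz A t := by unfold lorentz; positivity

lemma lorentz_add_intCast (A t : ℝ) (k : ℤ) : lorentz A (t + k) = lorentz A t := by
  unfold lorentz; rw [distInt_add_intCast]

/-- The geometric series `∑ exp (-m/X) e(mt)` over `m ≥ 0`. -/
noncomputable def geomKernel (X t : ℝ) : ℂ := 1 / (1 - Real.exp (-(1 / X)) * ex t)

lemma geomKernel_add_intCast (X t : ℝ) (k : ℤ) : geomKernel X (t + k) = geomKernel X t := by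
  unfold geomKernel; rw [ex_add_intCast]

open Real Complex in
lemma four_mul_distInt_le (t : ℝ) : 4 * distInt t ≤ ‖1 - ex t‖ := by
  have h1 : ex t = ex (t - round t) := by
    rw [← ex_add_intCast (t - round t) (round t), sub_add_cancel]
  have h2 : ex (t - round t) = cexp (I * (2 * π * (t - round t) : ℝ)) := by
    rw [ex]; congr 1; push_cast; ring
  have hd : |t - round t| ≤ 1 / 2 := abs_sub_round t
  rw [h1, norm_sub_rev, h2, norm_exp_I_mul_ofReal_sub_one, norm_mul, Real.norm_eq_abs, Real.norm_eq_abs,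
    show 2 * π * (t - round t) / 2 = π * (t - round t) by ring]
  have h3 := Real.mul_abs_le_abs_sin (x := π * (t - round t)) (by
    rw [abs_mul, abs_of_pos pi_pos]; nlinarith [pi_pos])
  rw [abs_mul, abs_of_pos pi_pos] at h3
  have h4 : 2 / π * (π * |t - round t|) = 2 * |t - round t| := by field_simp
  rw [h4] at h3
  rw [abs_of_pos (by norm_num : (0 : ℝ) < 2), distInt]
  linarith

/-- Passing from 1 - e(t) to 1 - r e(t) costs 1 - r, itself at most ‖1 - r e(t)‖; hence half of the
constant for r = 1. -/
lemma two_mul_distInt_le {r : ℝ} (h0 : 0 ≤ r) (h1 : r ≤ 1) (t : ℝ) :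
    2 * distInt t ≤ ‖1 - r * ex t‖ := by
  have h2 := four_mul_distInt_le t
  have h3 : ‖1 - ex t‖ ≤ ‖1 - r * ex t‖ + (1 - r) := by
    have : 1 - ex t = (1 - r * ex t) + ((r - 1 : ℝ) : ℂ) * ex t := by push_cast; ring
    rw [this]
    refine (norm_add_le _ _).trans (add_le_add le_rfl ?_)
    rw [norm_mul, norm_ex, mul_one, Complex.norm_real, Real.norm_eq_abs, abs_sub_comm,
      abs_of_nonneg (by linarith)]
  have h4 : 1 - r ≤ ‖1 - r * ex t‖ := by
    have := norm_sub_norm_le (1 : ℂ) (r * ex t)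
    rwa [norm_one, norm_mul, norm_ex, mul_one, Complex.norm_real, Real.norm_of_nonneg h0] at this
  linarith

lemma norm_geomKernel_le {X : ℝ} (hX : 0 < X) {t : ℝ} (ht : 0 < distInt t) :
    ‖geomKernel X t‖ ≤ 1 / (2 * distInt t) := by
  unfold geomKernel
  rw [norm_div, norm_one]
  refine one_div_le_one_div_of_le (by linarith) (two_mul_distInt_le (Real.exp_pos _).le ?_ t)
  exact Real.exp_le_one_iff.2 (by rw [neg_nonpos]; positivity)

-- Put w = π(1/(πX) - 2βi). Then 1/(1 - exp(-w)) and 1/w have the same pole at 0, and the difference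
-- is at most 2 because the numerator is at most ‖w‖² and ‖1 - exp(-w)‖ ≥ ‖w‖/2. This allows the
-- pole to be replaced by a periodic kernel with explicit Fourier coefficients.
open Real Complex in
lemma norm_geomKernel_sub_le {X β : ℝ} (hX : 4 ≤ X) (hβ : |β| ≤ 1 / 40) :
    ‖π * geomKernel X β - 1 / ((1 / (π * X) : ℝ) - 2 * β * I)‖ ≤ 2 * π := by
  have hX0 : 0 < X := by linarith
  set w : ℂ := (1 / X : ℝ) - 2 * π * β * I with hw
  have hπ : (π : ℂ) ≠ 0 := by exact_mod_cast pi_ne_zero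
  have hXc : (X : ℂ) ≠ 0 := by exact_mod_cast hX0.ne'
  have hz : ((1 / (π * X) : ℝ) : ℂ) - 2 * β * I = w / π := by
    rw [hw]; push_cast; field_simp
  have hwre : w.re = 1 / X := by simp [hw]
  have hw0 : w ≠ 0 := fun h => by
    rw [h] at hwre; simp at hwre; linarith
  have hwn : 0 < ‖w‖ := norm_pos_iff.2 hw0
  have hwle : ‖w‖ ≤ 1 / 2 := by
    have h1 : ‖((1 / X : ℝ) : ℂ)‖ ≤ 1 / 4 := by
      rw [norm_real, Real.norm_of_nonneg (by positivity)]
      exact one_div_le_one_div_of_le (by norm_num) hX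
    have h2 : ‖2 * π * β * I‖ ≤ 1 / 4 := by
      rw [norm_mul, norm_I, mul_one, norm_mul, norm_mul, Complex.norm_ofNat, norm_real, norm_real,
        Real.norm_of_nonneg pi_pos.le, Real.norm_eq_abs]
      have := pi_lt_d2
      nlinarith [abs_nonneg β]
    calc ‖w‖ ≤ _ := norm_sub_le _ _
      _ ≤ 1 / 4 + 1 / 4 := add_le_add h1 h2
      _ = 1 / 2 := by norm_num
  have hexp : (Real.exp (-(1 / X)) : ℂ) * ex β = cexp (-w) := by
    rw [ex, ofReal_exp, ← Complex.exp_add, hw]; congr 1; push_cast; ring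
  have h3 : ‖cexp (-w) - 1 - -w‖ ≤ ‖w‖ ^ 2 := by
    have := Complex.norm_exp_sub_one_sub_id_le (x := -w) (by rw [norm_neg]; linarith)
    rwa [norm_neg] at this
  have h4 : ‖w‖ / 2 ≤ ‖1 - cexp (-w)‖ := by
    have : w = (1 - cexp (-w)) + (cexp (-w) - 1 - -w) := by ring
    have h5 : ‖w‖ ≤ ‖1 - cexp (-w)‖ + ‖w‖ ^ 2 := by
      calc ‖w‖ = ‖(1 - cexp (-w)) + (cexp (-w) - 1 - -w)‖ := by rw [← this]
        _ ≤ _ := (norm_add_le _ _).trans (add_le_add le_rfl h3)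
    nlinarith
  have h6 : 1 - cexp (-w) ≠ 0 := fun h => by rw [h, norm_zero] at h4; linarith
  have h7 : π * geomKernel X β - 1 / (w / π) =
      π * ((cexp (-w) - 1 - -w) / (w * (1 - cexp (-w)))) := by
    rw [geomKernel, hexp]
    field_simp
    ring
  rw [hz, h7, norm_mul, norm_real, Real.norm_of_nonneg pi_pos.le, norm_div, norm_mul, mul_comm]
  refine mul_le_mul_of_nonneg_right ?_ pi_pos.le
  rw [div_le_iff₀ (by nlinarith)]
  nlinarith

/-- The numerators `b` modulo `W` for which `b / W` has reduced denominator at most `Q`. -/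
def majorSet (W Q : ℕ) : Finset ℕ :=
  (Finset.range W).filter fun b => ((b : ℚ) / W).den ≤ Q

/-- The model for `thetaF X ^ 2` built from the fractions with denominator at most `Q`. -/
noncomputable def modelF (X : ℝ) (W Q : ℕ) (α : ℝ) : ℂ :=
  ∑ b ∈ majorSet W Q, Real.pi * gam ((b : ℚ) / W) ^ 2 * geomKernel X (α - b / W)

lemma gam_add_intCast (ρ : ℚ) (k : ℤ) : gam (ρ + k) = gam ρ := by
  unfold gam gaussQ
  rw [Rat.add_intCast_den]
  congr 1
  refine Finset.sum_congr rfl fun r _ => ?_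
  rw [← ex_add_intCast (ρ * (r : ℝ) ^ 2 + _) (k * r ^ 2)]
  congr 1
  push_cast
  ring

lemma den_natCast_div_dvd (b W : ℕ) : ((b : ℚ) / W).den ∣ W := by
  have := Rat.den_dvd b W
  rw [Rat.divInt_eq_div, Int.cast_natCast, Int.cast_natCast] at this
  exact Int.natCast_dvd_natCast.1 this

lemma exists_eq_natCast_div_add {W : ℕ} (hW : 0 < W) {ρ : ℚ} (h : ρ.den ∣ W) :
    ∃ b < W, ∃ k : ℤ, ρ = (b : ℚ) / W + k := by
  obtain ⟨c, hc⟩ := h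
  have hW0 : (W : ℤ) ≠ 0 := by exact_mod_cast hW.ne'
  refine ⟨((ρ.num * c) % W).toNat, ?_, ρ.num * c / W, ?_⟩
  · have := Int.emod_lt_of_pos (ρ.num * c) (by exact_mod_cast hW : (0 : ℤ) < W)
    have := Int.emod_nonneg (ρ.num * c) hW0
    omega
  · have h1 : ((((ρ.num * c) % W).toNat : ℕ) : ℚ) = ((ρ.num * c % W : ℤ) : ℚ) := by
      exact_mod_cast Int.toNat_of_nonneg (Int.emod_nonneg (ρ.num * c) hW0)
    have h2 : ((ρ.num * c % W : ℤ) : ℚ) + W * ((ρ.num * c / W : ℤ) : ℚ) = ρ.num * c := by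
      exact_mod_cast Int.emod_add_mul_ediv (ρ.num * c) W
    have hWq : (W : ℚ) ≠ 0 := by exact_mod_cast hW.ne'
    have hd : (ρ.den : ℚ) ≠ 0 := by exact_mod_cast ρ.den_ne_zero
    rw [h1]
    have h3 : (W : ℚ) = ρ.den * c := by exact_mod_cast hc
    have h4 : ρ * ρ.den = ρ.num := Rat.mul_den_eq_num ρ
    rw [eq_sub_of_add_eq h2, ← h4]
    field_simp
    rw [h3]; ring

open Real in
lemma exists_norm_thetaF_sq_sub_le :
    ∃ K : ℝ, 0 < K ∧ ∀ (X : ℝ) (ρ : ℚ) (β : ℝ), 4 ≤ X → (ρ.den : ℝ) ^ 2 ≤ X →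
      (ρ.den : ℝ) ^ 2 * β ^ 2 * X ≤ 1 → |β| ≤ 1 / 40 →
      ‖thetaF X (ρ + β) ^ 2 - π * gam ρ ^ 2 * geomKernel X β‖ ^ 2 ≤ K * X := by
  obtain ⟨K, hK, h⟩ := exists_thetaF_bounds
  refine ⟨(K + 4 * π) ^ 2, by positivity, fun X ρ β hX hq hβ hβ' => ?_⟩
  have hX0 : 0 < X := by linarith
  obtain ⟨-, h1⟩ := h X ρ β hX0 hq hβ
  have h2 := norm_geomKernel_sub_le hX hβ'
  have hden : (1 : ℝ) ≤ ρ.den := by exact_mod_cast ρ.den_pos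
  have h3 : ‖gam ρ‖ ^ 2 ≤ 2 := (norm_gam_sq_le ρ).trans (div_le_self zero_le_two hden)
  have h4 : 1 ≤ √X := Real.one_le_sqrt.2 (by linarith)
  set z : ℂ := (1 / (π * X) : ℝ) - 2 * β * Complex.I
  have h5 : thetaF X (ρ + β) ^ 2 - π * gam ρ ^ 2 * geomKernel X β =
      (thetaF X (ρ + β) ^ 2 - gam ρ ^ 2 / z) - gam ρ ^ 2 * (π * geomKernel X β - 1 / z) := by
    ring
  have h6 : ‖thetaF X (ρ + β) ^ 2 - π * gam ρ ^ 2 * geomKernel X β‖ ≤ (K + 4 * π) * √X := by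
    rw [h5]
    calc _ ≤ _ := norm_sub_le _ _
      _ ≤ K * √X + 2 * (2 * π) := by
        rw [norm_mul, norm_pow]
        exact add_le_add h1 (mul_le_mul h3 h2 (norm_nonneg _) zero_le_two)
      _ ≤ _ := by nlinarith [pi_pos]
  calc _ ≤ ((K + 4 * π) * √X) ^ 2 := by gcongr
    _ = _ := by rw [mul_pow, Real.sq_sqrt hX0.le]

-- At distance d ≥ η from the pole the kernel is at most 1/(2d), and 1/d² ≤ 2/(η² + d²).
open Real in
lemma norm_model_term_sq_le {X : ℝ} (hX : 0 < X) (ρ : ℚ) {η t : ℝ} (hη : 0 < η)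
    (ht : η ≤ distInt t) :
    ‖π * gam ρ ^ 2 * geomKernel X t‖ ^ 2 ≤ 2 * π ^ 2 * lorentz η t := by
  have hden : (1 : ℝ) ≤ ρ.den := by exact_mod_cast ρ.den_pos
  have h3 : ‖gam ρ‖ ^ 2 ≤ 2 := (norm_gam_sq_le ρ).trans (div_le_self zero_le_two hden)
  have hd : 0 < distInt t := hη.trans_le ht
  have h4 := norm_geomKernel_le hX hd
  have h5 : ‖π * gam ρ ^ 2 * geomKernel X t‖ ≤ π / distInt t := by
    rw [norm_mul, norm_mul, norm_pow, Complex.norm_real, Real.norm_of_nonneg pi_pos.le]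
    calc _ ≤ π * 2 * (1 / (2 * distInt t)) := by gcongr
      _ = _ := by field_simp
  calc _ ≤ (π / distInt t) ^ 2 := by gcongr
    _ = π ^ 2 * (1 / distInt t ^ 2) := by rw [div_pow]; ring
    _ ≤ π ^ 2 * (2 * lorentz η t) := by
      refine mul_le_mul_of_nonneg_left ?_ (by positivity)
      unfold lorentz
      rw [mul_one_div, div_le_div_iff₀ (by positivity) (by positivity)]
      nlinarith
    _ = _ := by ring

/-- The width of the major arc around `b / W`. -/
noncomputable def arcWidth (W N b : ℕ) : ℝ := 1 / ((N + 1) * ((b : ℚ) / W).den)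

lemma arcWidth_pos (W N b : ℕ) : 0 < arcWidth W N b := by
  have : (0 : ℝ) < ((b : ℚ) / W).den := by exact_mod_cast Rat.den_pos _
  unfold arcWidth
  positivity

lemma arcWidth_le (W N b : ℕ) : arcWidth W N b ≤ 1 / (N + 1) := by
  have : (1 : ℝ) ≤ ((b : ℚ) / W).den := by exact_mod_cast Rat.den_pos _
  unfold arcWidth
  refine one_div_le_one_div_of_le (by positivity) ?_
  exact le_mul_of_one_le_right (by positivity) this

lemma inv_le_distInt_sub {W b c : ℕ} (hb : b < W) (hc : c < W) (hbc : b ≠ c) :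
    1 / (W : ℝ) ≤ distInt ((b : ℝ) / W - c / W) := by
  have hW : (0 : ℝ) < W := by exact_mod_cast (by omega : 0 < W)
  set k := round ((b : ℝ) / W - c / W)
  have h1 : (b : ℝ) / W - c / W - k = ((b - c - k * W : ℤ) : ℝ) / W := by
    push_cast; field_simp
  have h2 : (b - c - k * W : ℤ) ≠ 0 := by
    intro h
    have h3 : (b : ℤ) = c + W * k := by linarith
    have h5 := congrArg (· % (W : ℤ)) h3
    simp only [Int.add_mul_emod_self_left] at h5
    rw [Int.emod_eq_of_lt (by omega) (by omega), Int.emod_eq_of_lt (by omega) (by omega)] at h5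
    exact hbc (by exact_mod_cast h5)
  unfold distInt
  rw [h1, abs_div, abs_of_pos hW]
  refine div_le_div_of_nonneg_right ?_ hW.le
  exact_mod_cast Int.one_le_abs h2

open Real in
/-- Pointwise bound for the error of the model, in terms of Lorentzian kernels. -/
theorem exists_norm_thetaF_sq_sub_modelF_sq_le :
    ∃ K : ℝ, 0 < K ∧ ∀ (X : ℝ) (W Q : ℕ), 2000 ≤ X → 0 < W → (∀ q, 0 < q → q ≤ Q → q ∣ W) →
      2 * W ≤ ⌊√X⌋₊ → ∀ α : ℝ,
      ‖thetaF X α ^ 2 - modelF X W Q α‖ ^ 2 ≤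
        K * (W * ∑ b ∈ majorSet W Q, lorentz (arcWidth W ⌊√X⌋₊ b) (α - b / W) +
          ∑ q ∈ Finset.Ioc Q ⌊√X⌋₊, 1 / (q : ℝ) ^ 2 *
            ∑ a ∈ Finset.range q, lorentz (1 / (2 * π * X)) (α - a / q)) := by
  obtain ⟨K₁, hK₁, hnear⟩ := exists_norm_thetaF_sq_sub_le
  obtain ⟨K₂, hK₂, hθ⟩ := exists_thetaF_bounds
  refine ⟨2 * K₁ + 4 * π ^ 2 + 2 * K₂, by positivity, fun X W Q hX hW hQW hWN α => ?_⟩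
  set N := ⌊√X⌋₊ with hN
  have hX0 : 0 < X := by linarith
  have hNX : (N : ℝ) ≤ √X := Nat.floor_le (Real.sqrt_nonneg X)
  have hXN : √X < N + 1 := Nat.lt_floor_add_one _
  have hN2 : (N : ℝ) ^ 2 ≤ X := by
    rw [← Real.sq_sqrt hX0.le]; gcongr
  have hXN2 : X ≤ (N + 1 : ℝ) ^ 2 := by
    rw [← Real.sq_sqrt hX0.le]; gcongr
  -- X ≥ 2000 > 40² forces N + 1 ≥ 40, so every arc has half-width at most 1/40.
  have hN40 : (40 : ℝ) ≤ N + 1 := by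
    by_contra hcon
    nlinarith
  have hWN' : 2 * (W : ℝ) ≤ N := by exact_mod_cast hWN
  have hW0 : (0 : ℝ) < W := by exact_mod_cast hW
  have hN1 : (0 : ℝ) < N + 1 := by linarith
  set T := majorSet W Q with hT
  have hTmem : ∀ b, b ∈ T ↔ b < W ∧ ((b : ℚ) / W).den ≤ Q := fun b => by
    rw [hT, majorSet, Finset.mem_filter, Finset.mem_range]
  have hTcard : (T.card : ℝ) ≤ W := by
    have : T.card ≤ (Finset.range W).card := Finset.card_filter_le _ _
    rw [Finset.card_range] at this
    exact_mod_cast this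
  let P : ℕ → ℂ := fun b => π * gam ((b : ℚ) / W) ^ 2 * geomKernel X (α - b / W)
  let L : ℕ → ℝ := fun b => lorentz (arcWidth W N b) (α - b / W)
  have hL0 : ∀ b, 0 ≤ L b := fun b => lorentz_nonneg _ _
  set S₁ := ∑ b ∈ T, L b with hS₁
  set S₂ := ∑ q ∈ Finset.Ioc Q N, 1 / (q : ℝ) ^ 2 *
    ∑ a ∈ Finset.range q, lorentz (1 / (2 * π * X)) (α - a / q) with hS₂
  have hS₁0 : 0 ≤ S₁ := Finset.sum_nonneg fun b _ => hL0 b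
  have hS₂0 : 0 ≤ S₂ := Finset.sum_nonneg fun q _ =>
    mul_nonneg (by positivity) (Finset.sum_nonneg fun a _ => lorentz_nonneg _ _)
  have hmodel : modelF X W Q α = ∑ b ∈ T, P b := rfl
  -- Either α lies in the arc of some b₀, where that pole approximates the theta square, or α lies
  -- in no arc and the theta square and the model are bounded separately.
  by_cases hcase : ∃ b ∈ T, distInt (α - b / W) ≤ arcWidth W N b
  · obtain ⟨b₀, hb₀, hd₀⟩ := hcase
    have hb₀W := ((hTmem b₀).1 hb₀).1
    -- The whole theta square is charged to b₀, so the error is a sum of at most W pieces to which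
    -- Cauchy–Schwarz applies; this is the source of the factor W.
    have hx : ∀ b ∈ T, ‖(if b = b₀ then thetaF X α ^ 2 else 0) - P b‖ ^ 2 ≤
        (2 * K₁ + 2 * π ^ 2) * L b := by
      intro b hb
      have hbW := ((hTmem b).1 hb).1
      split_ifs with hbb
      · subst hbb
        set k := round (α - (b : ℝ) / W) with hk
        set β := α - (b : ℝ) / W - k with hβ
        have hβd : |β| = distInt (α - b / W) := rfl
        have hα : α = (((b : ℚ) / W + k : ℚ) : ℝ) + β := by rw [hβ]; push_cast; ring
        have hden : ((b : ℚ) / W + k).den = ((b : ℚ) / W).den := Rat.add_intCast_den _ _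
        have hdenW : ((((b : ℚ) / W).den : ℕ) : ℝ) ≤ W := by
          exact_mod_cast Nat.le_of_dvd hW (den_natCast_div_dvd b W)
        have hden0 : (0 : ℝ) < (((b : ℚ) / W).den : ℕ) := by exact_mod_cast Rat.den_pos _
        have hw : arcWidth W N b = 1 / ((N + 1) * (((b : ℚ) / W).den : ℕ)) := rfl
        have hwX : (((b : ℚ) / W).den : ℝ) ^ 2 * arcWidth W N b ^ 2 * X ≤ 1 := by
          rw [hw, div_pow, mul_pow, one_pow]
          rw [show (((b : ℚ) / W).den : ℝ) ^ 2 * (1 / ((N + 1 : ℝ) ^ 2 * (((b : ℚ) / W).den : ℝ) ^ 2)) * X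
            = X / (N + 1 : ℝ) ^ 2 by field_simp]
          exact (div_le_one (by positivity)).2 hXN2
        have hβ2 : β ^ 2 ≤ arcWidth W N b ^ 2 := by
          rw [← sq_abs β, hβd]
          exact pow_le_pow_left₀ (distInt_nonneg _) hd₀ 2
        have h1 := hnear X ((b : ℚ) / W + k) β (by linarith) (by
            rw [hden]
            refine le_trans ?_ hN2
            exact pow_le_pow_left₀ hden0.le (by linarith) 2) (by
            rw [hden]
            refine le_trans ?_ hwX
            gcongr) (by
            rw [hβd]
            refine hd₀.trans ((arcWidth_le W N b).trans ?_)
            exact one_div_le_one_div_of_le (by norm_num) hN40)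
        have hPb : P b = π * gam ((b : ℚ) / W + k) ^ 2 * geomKernel X β := by
          simp only [P]
          rw [gam_add_intCast, ← geomKernel_add_intCast X β k, hβ, sub_add_cancel]
        rw [← hα, ← hPb] at h1
        refine h1.trans ?_
        -- Inside the arc both squares in the denominator are at most 1/X, so the Lorentzian absorbs
        -- the error of order X.
        have hLb : X / 2 ≤ L b := by
          simp only [L, lorentz]
          have hw0 := arcWidth_pos W N b
          have h2 : distInt (α - b / W) ^ 2 ≤ arcWidth W N b ^ 2 :=
            pow_le_pow_left₀ (distInt_nonneg _) hd₀ 2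
          have h3 : arcWidth W N b ^ 2 * X ≤ 1 := by
            refine le_trans ?_ hwX
            have : (1 : ℝ) ≤ (((b : ℚ) / W).den : ℝ) ^ 2 := by
              have : (1 : ℝ) ≤ (((b : ℚ) / W).den : ℕ) := by exact_mod_cast Rat.den_pos _
              exact one_le_pow₀ this
            rw [mul_assoc]
            exact le_mul_of_one_le_left (by positivity) this
          rw [div_le_div_iff₀ two_pos (by positivity)]
          nlinarith
        have : 0 ≤ 2 * π ^ 2 * L b := mul_nonneg (by positivity) (hL0 b)
        nlinarith
      · rw [zero_sub, norm_neg]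
        -- Distinct fractions b/W are 1/W ≥ 2/(N + 1) apart, so α cannot be close to a second one.
        have h1 : arcWidth W N b ≤ distInt (α - b / W) := by
          have h2 := inv_le_distInt_sub hb₀W hbW (Ne.symm hbb)
          have h3 := distInt_le_add ((b₀ : ℝ) / W - b / W) (α - b / W)
          rw [show (b₀ : ℝ) / W - b / W - (α - b / W) = b₀ / W - α by ring,
            distInt_sub_comm _ α] at h3
          have h4 := arcWidth_le W N b₀
          have h5 := arcWidth_le W N b
          have h6 : 2 * (1 / (N + 1 : ℝ)) ≤ 1 / W := by
            rw [mul_one_div, div_le_div_iff₀ hN1 hW0]; linarith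
          linarith
        refine (norm_model_term_sq_le hX0 _ (arcWidth_pos W N b) h1).trans ?_
        have : 0 ≤ 2 * K₁ * L b := mul_nonneg (by positivity) (hL0 b)
        change 2 * π ^ 2 * L b ≤ _
        linarith
    have hF : thetaF X α ^ 2 - modelF X W Q α =
        ∑ b ∈ T, ((if b = b₀ then thetaF X α ^ 2 else 0) - P b) := by
      rw [Finset.sum_sub_distrib, Finset.sum_ite_eq' T b₀, if_pos hb₀, hmodel]
    rw [hF]
    calc ‖∑ b ∈ T, ((if b = b₀ then thetaF X α ^ 2 else 0) - P b)‖ ^ 2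
        ≤ (∑ b ∈ T, ‖(if b = b₀ then thetaF X α ^ 2 else 0) - P b‖) ^ 2 := by
          gcongr; exact norm_sum_le _ _
      _ ≤ T.card * ∑ b ∈ T, ‖(if b = b₀ then thetaF X α ^ 2 else 0) - P b‖ ^ 2 :=
          sq_sum_le_card_mul_sum_sq
      _ ≤ W * ∑ b ∈ T, (2 * K₁ + 2 * π ^ 2) * L b :=
          mul_le_mul hTcard (Finset.sum_le_sum hx) (Finset.sum_nonneg fun b _ => by positivity)
            hW0.le
      _ = (2 * K₁ + 2 * π ^ 2) * (W * S₁) := by rw [← Finset.mul_sum]; ring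
      _ ≤ (2 * K₁ + 4 * π ^ 2 + 2 * K₂) * (W * S₁ + S₂) := by
          have := sq_nonneg π
          exact mul_le_mul (by linarith) (by linarith) (by positivity) (by positivity)
  · push Not at hcase
    obtain ⟨ρ, hρ, hρN⟩ := Real.exists_rat_abs_sub_le_and_den_le α
      (n := N) (by exact_mod_cast (by linarith : (0 : ℝ) < N))
    -- The arcs have exactly the width of Dirichlet's theorem at level N: an approximation with
    -- denominator at most Q, hence dividing W, would place α in one of them.
    have hρQ : Q < ρ.den := by
      by_contra hcon
      obtain ⟨b, hbW, k, hk⟩ := exists_eq_natCast_div_add hW (hQW ρ.den ρ.den_pos (not_lt.1 hcon))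
      have hden : ρ.den = ((b : ℚ) / W).den := by rw [hk, Rat.add_intCast_den]
      refine absurd (hcase b ((hTmem b).2 ⟨hbW, by rw [← hden]; exact not_lt.1 hcon⟩)) (not_lt.2 ?_)
      refine (distInt_le_abs_sub _ k).trans ?_
      have : α - (b : ℝ) / W - k = α - ρ := by rw [hk]; push_cast; ring
      rw [this, arcWidth, ← hden]
      exact hρ
    set β := α - ρ with hβ
    have hα : α = ρ + β := by rw [hβ]; ring
    have hden0 : (0 : ℝ) < ρ.den := by exact_mod_cast ρ.den_pos
    have hdenN : (ρ.den : ℝ) ≤ N := by exact_mod_cast hρN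
    obtain ⟨h1, -⟩ := hθ X ρ β hX0 ((pow_le_pow_left₀ hden0.le hdenN 2).trans hN2) (by
      have h2 : β ^ 2 ≤ (1 / ((N + 1 : ℝ) * ρ.den)) ^ 2 := by
        rw [← sq_abs]; exact pow_le_pow_left₀ (abs_nonneg _) hρ 2
      calc _ ≤ (ρ.den : ℝ) ^ 2 * (1 / ((N + 1 : ℝ) * ρ.den)) ^ 2 * X := by gcongr
        _ = X / (N + 1 : ℝ) ^ 2 := by field_simp
        _ ≤ 1 := (div_le_one (by positivity)).2 hXN2)
    rw [← hα] at h1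
    obtain ⟨a, haq, k, hk⟩ := exists_eq_natCast_div_add ρ.den_pos (dvd_refl ρ.den)
    have h2 : ‖thetaF X α‖ ^ 4 ≤ K₂ * S₂ := by
      have h3 : 1 / (ρ.den : ℝ) ^ 2 * lorentz (1 / (2 * π * X)) (α - a / ρ.den) ≤ S₂ := by
        have hmem : ρ.den ∈ Finset.Ioc Q N := Finset.mem_Ioc.2 ⟨hρQ, hρN⟩
        have h5 := Finset.single_le_sum (f := fun q : ℕ => 1 / (q : ℝ) ^ 2 *
          ∑ a ∈ Finset.range q, lorentz (1 / (2 * π * X)) (α - a / q)) (fun q _ =>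
            mul_nonneg (by positivity) (Finset.sum_nonneg fun a _ => lorentz_nonneg _ _)) hmem
        refine le_trans ?_ h5
        refine mul_le_mul_of_nonneg_left ?_ (by positivity)
        exact Finset.single_le_sum
          (f := fun a : ℕ => lorentz (1 / (2 * π * X)) (α - a / ρ.den))
          (fun a _ => lorentz_nonneg _ _) (Finset.mem_range.2 haq)
      refine h1.trans ?_
      refine le_trans ?_ (mul_le_mul_of_nonneg_left h3 hK₂.le)
      have hd : distInt (α - a / ρ.den) ^ 2 ≤ β ^ 2 := by
        rw [← sq_abs β]
        refine pow_le_pow_left₀ (distInt_nonneg _) ((distInt_le_abs_sub _ k).trans (le_of_eq ?_)) 2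
        congr 1
        rw [hβ]
        nth_rewrite 2 [hk]
        push_cast
        ring
      unfold lorentz
      rw [one_div_mul_one_div, mul_one_div]
      gcongr
    have h3 : ‖∑ b ∈ T, P b‖ ^ 2 ≤ W * (2 * π ^ 2 * S₁) := by
      calc ‖∑ b ∈ T, P b‖ ^ 2 ≤ (∑ b ∈ T, ‖P b‖) ^ 2 := by gcongr; exact norm_sum_le _ _
        _ ≤ T.card * ∑ b ∈ T, ‖P b‖ ^ 2 := sq_sum_le_card_mul_sum_sq
        _ ≤ W * ∑ b ∈ T, 2 * π ^ 2 * L b :=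
          mul_le_mul hTcard (Finset.sum_le_sum fun b hb =>
            norm_model_term_sq_le hX0 _ (arcWidth_pos W N b) (hcase b hb).le)
            (Finset.sum_nonneg fun b _ => by positivity) hW0.le
        _ = _ := by rw [← Finset.mul_sum]
    rw [hmodel]
    have h4 : ‖thetaF X α ^ 2 - ∑ b ∈ T, P b‖ ^ 2 ≤
        2 * ‖thetaF X α‖ ^ 4 + 2 * ‖∑ b ∈ T, P b‖ ^ 2 := by
      have h5 := norm_sub_le (thetaF X α ^ 2) (∑ b ∈ T, P b)
      rw [norm_pow] at h5
      have h6 : ‖thetaF X α ^ 2 - ∑ b ∈ T, P b‖ ^ 2 ≤ (‖thetaF X α‖ ^ 2 + ‖∑ b ∈ T, P b‖) ^ 2 := by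
        gcongr
      nlinarith [sq_nonneg (‖thetaF X α‖ ^ 2 - ‖∑ b ∈ T, P b‖)]
    have h7 : 0 ≤ W * S₁ := by positivity
    have h8 := mul_nonneg hK₁.le h7
    have h9 := mul_nonneg hK₁.le hS₂0
    have h10 := mul_nonneg hK₂.le h7
    have h11 := mul_nonneg (sq_nonneg π) hS₂0
    linarith

/-! ### The mean square of the error against the short polynomial. -/

/-- The weighted quadratic exponential polynomial of length `M`. -/
noncomputable def gF (X : ℝ) (M : ℕ) (α : ℝ) : ℂ :=
  ∑ t ∈ Finset.Ioc 0 M, (Real.exp (-(t : ℝ) ^ 2 / X) : ℂ) * ex (α * (t : ℝ) ^ 2)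

/-- The number of pairs `1 ≤ s, t ≤ M` with `s² ≡ t²` modulo `q`. -/
def sqPairCount (q M : ℕ) : ℕ :=
  ((Finset.Ioc 0 M ×ˢ Finset.Ioc 0 M).filter fun p => (q : ℤ) ∣ (p.1 : ℤ) ^ 2 - (p.2 : ℤ) ^ 2).card

lemma exp_neg_sq_div_le_one {X : ℝ} (hX : 0 < X) (t : ℝ) : Real.exp (-t ^ 2 / X) ≤ 1 := by
  rw [Real.exp_le_one_iff, neg_div, neg_nonpos]; positivity

lemma norm_gF_le {X : ℝ} (hX : 0 < X) (M : ℕ) (α : ℝ) : ‖gF X M α‖ ≤ M := by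
  unfold gF
  refine (norm_sum_le _ _).trans ?_
  calc _ ≤ ∑ t ∈ Finset.Ioc 0 M, (1 : ℝ) := by
        refine Finset.sum_le_sum fun t _ => ?_
        rw [norm_mul, norm_ex, mul_one, Complex.norm_real, Real.norm_of_nonneg (Real.exp_pos _).le]
        exact exp_neg_sq_div_le_one hX _
    _ = M := by simp

lemma sum_range_ex_mul_div (q : ℕ) (hq : 0 < q) (m : ℤ) :
    ∑ a ∈ Finset.range q, ex ((a : ℝ) / q * m) = if (q : ℤ) ∣ m then (q : ℂ) else 0 := by
  have : NeZero q := ⟨hq.ne'⟩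
  have h := AddChar.sum_mulShift (m : ZMod q) (ZMod.isPrimitive_stdAddChar q)
  rw [← sum_range_natCast_zmod q (fun x => (ZMod.stdAddChar (x * (m : ZMod q)) : ℂ))] at h
  simp only [ZMod.intCast_zmod_eq_zero_iff_dvd, ZMod.card] at h
  rw [Nat.cast_ite, Nat.cast_zero] at h
  rw [← h]
  refine Finset.sum_congr rfl fun a _ => ?_
  have := ex_intCast_div q (a * m)
  push_cast at this
  rw [← this]
  congr 1
  ring

/-- Expanding the square, the sum over a detects q ∣ s² - t². The bound is uniform in β, so the
Lorentzian can be integrated separately afterwards. -/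
lemma sum_norm_gF_sq_le {X : ℝ} (hX : 0 < X) (M q : ℕ) (hq : 0 < q) (β : ℝ) :
    ∑ a ∈ Finset.range q, ‖gF X M (β + a / q)‖ ^ 2 ≤ q * sqPairCount q M := by
  set I := Finset.Ioc 0 M
  let w : ℕ → ℝ := fun t => Real.exp (-(t : ℝ) ^ 2 / X)
  have hw0 : ∀ t, 0 ≤ w t := fun t => (Real.exp_pos _).le
  have hw1 : ∀ t, w t ≤ 1 := fun t => exp_neg_sq_div_le_one hX _
  have h1 : ∀ α : ℝ, ((‖gF X M α‖ ^ 2 : ℝ) : ℂ) =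
      ∑ p ∈ I ×ˢ I, (w p.1 * w p.2 : ℂ) * ex (α * (((p.1 : ℤ) ^ 2 - (p.2 : ℤ) ^ 2 : ℤ) : ℝ)) := by
    intro α
    push_cast
    rw [← Complex.mul_conj', gF, map_sum, Finset.sum_mul_sum, Finset.sum_product]
    refine Finset.sum_congr rfl fun s _ => Finset.sum_congr rfl fun t _ => ?_
    rw [map_mul, Complex.conj_ofReal, ← ex_neg,
      show α * ((s : ℝ) ^ 2 - (t : ℝ) ^ 2) = α * (s : ℝ) ^ 2 + -(α * (t : ℝ) ^ 2) by ring, ex_add]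
    simp only [w]
    ring
  have h2 : ((∑ a ∈ Finset.range q, ‖gF X M (β + a / q)‖ ^ 2 : ℝ) : ℂ) =
      ∑ p ∈ I ×ˢ I, (w p.1 * w p.2 : ℂ) * ex (β * (((p.1 : ℤ) ^ 2 - (p.2 : ℤ) ^ 2 : ℤ) : ℝ)) *
        if (q : ℤ) ∣ (p.1 : ℤ) ^ 2 - (p.2 : ℤ) ^ 2 then (q : ℂ) else 0 := by
    rw [Complex.ofReal_sum]
    simp_rw [h1]
    rw [Finset.sum_comm]
    refine Finset.sum_congr rfl fun p _ => ?_
    rw [← sum_range_ex_mul_div q hq, Finset.mul_sum]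
    refine Finset.sum_congr rfl fun a _ => ?_
    rw [add_mul, ex_add]
    ring
  have h3 : ‖((∑ a ∈ Finset.range q, ‖gF X M (β + a / q)‖ ^ 2 : ℝ) : ℂ)‖ ≤
      ∑ p ∈ I ×ˢ I, if (q : ℤ) ∣ (p.1 : ℤ) ^ 2 - (p.2 : ℤ) ^ 2 then (q : ℝ) else 0 := by
    rw [h2]
    refine (norm_sum_le _ _).trans (Finset.sum_le_sum fun p _ => ?_)
    have hww : ‖(w p.1 * w p.2 : ℂ)‖ ≤ 1 := by
      rw [norm_mul, Complex.norm_real, Complex.norm_real, Real.norm_of_nonneg (hw0 _),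
        Real.norm_of_nonneg (hw0 _)]
      exact mul_le_one₀ (hw1 _) (hw0 _) (hw1 _)
    rw [norm_mul, norm_mul, norm_ex, mul_one]
    split_ifs
    · rw [Complex.norm_natCast]
      exact mul_le_of_le_one_left (Nat.cast_nonneg q) hww
    · simp
  rw [Complex.norm_real, Real.norm_of_nonneg (Finset.sum_nonneg fun a _ => by positivity)] at h3
  refine h3.trans (le_of_eq ?_)
  rw [← Finset.sum_filter, Finset.sum_const, nsmul_eq_mul, mul_comm, sqPairCount]

lemma continuous_distInt : Continuous distInt := by
  refine LipschitzWith.continuous (K := 1) (LipschitzWith.of_le_add fun s t => ?_)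
  have h1 := distInt_le_add s t
  have h2 := distInt_le_abs_sub (s - t) 0
  rw [Int.cast_zero, sub_zero] at h2
  rw [Real.dist_eq]
  linarith

lemma continuous_lorentz {A : ℝ} (hA : 0 < A) : Continuous (lorentz A) := by
  unfold lorentz
  refine Continuous.div continuous_const
    (continuous_const.add (continuous_distInt.pow 2)) fun t => ?_
  positivity

open Real in
lemma integral_one_div_sq_add_sq_le {A : ℝ} (hA : 0 < A) :
    ∫ t in (0 : ℝ)..1, 1 / (A ^ 2 + t ^ 2) ≤ 2 / A := by
  have h1 : ∀ t : ℝ, 1 / (A ^ 2 + t ^ 2) = (A ^ 2)⁻¹ * (1 + (t / A) ^ 2)⁻¹ := by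
    intro t
    field_simp
  simp_rw [h1]
  rw [intervalIntegral.integral_const_mul,
    intervalIntegral.integral_comp_div (fun t => (1 + t ^ 2)⁻¹) hA.ne', integral_inv_one_add_sq,
    zero_div, arctan_zero, sub_zero, smul_eq_mul]
  have h2 := (arctan_lt_pi_div_two (1 / A)).le
  have h3 : arctan (1 / A) ≤ 2 := by linarith [pi_le_four]
  calc (A ^ 2)⁻¹ * (A * arctan (1 / A)) = arctan (1 / A) / A := by field_simp
    _ ≤ 2 / A := by gcongr

lemma integral_lorentz_le {A : ℝ} (hA : 0 < A) : ∫ t in (0 : ℝ)..1, lorentz A t ≤ 4 / A := by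
  have hc1 : Continuous fun t : ℝ => 1 / (A ^ 2 + t ^ 2) :=
    Continuous.div continuous_const (by fun_prop) fun t => by positivity
  have hc2 : Continuous fun t : ℝ => 1 / (A ^ 2 + (1 - t) ^ 2) :=
    Continuous.div continuous_const (by fun_prop) fun t => by positivity
  have h1 : ∫ t in (0 : ℝ)..1, lorentz A t ≤
      ∫ t in (0 : ℝ)..1, (1 / (A ^ 2 + t ^ 2) + 1 / (A ^ 2 + (1 - t) ^ 2)) := by
    refine intervalIntegral.integral_mono_on zero_le_one
      ((continuous_lorentz hA).intervalIntegrable _ _) ((hc1.add hc2).intervalIntegrable _ _)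
      fun t ht => ?_
    have h2 := abs_le.1 (abs_sub_round t)
    have h3 : round t = 0 ∨ round t = 1 := by
      have h4 : (-1 : ℝ) < round t := by linarith [ht.1]
      have h5 : (round t : ℝ) < 2 := by linarith [ht.2]
      have h6 : -1 < round t := by exact_mod_cast h4
      have h7 : round t < 2 := by exact_mod_cast h5
      omega
    have p1 : 0 ≤ 1 / (A ^ 2 + t ^ 2) := by positivity
    have p2 : 0 ≤ 1 / (A ^ 2 + (1 - t) ^ 2) := by positivity
    unfold lorentz distInt
    rw [sq_abs]
    rcases h3 with h | h <;> rw [h]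
    · rw [Int.cast_zero, sub_zero]; linarith
    · rw [Int.cast_one, show (t - 1) ^ 2 = (1 - t) ^ 2 by ring]; linarith
  have h2 : ∫ t in (0 : ℝ)..1, 1 / (A ^ 2 + (1 - t) ^ 2) =
      ∫ t in (0 : ℝ)..1, 1 / (A ^ 2 + t ^ 2) := by
    rw [intervalIntegral.integral_comp_sub_left (fun t => 1 / (A ^ 2 + t ^ 2))]
    norm_num
  rw [intervalIntegral.integral_add (hc1.intervalIntegrable _ _) (hc2.intervalIntegrable _ _), h2]
    at h1
  have h3 := integral_one_div_sq_add_sq_le hA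
  calc _ ≤ _ := h1
    _ ≤ 2 / A + 2 / A := add_le_add h3 h3
    _ = 4 / A := by ring

lemma integral_mul_lorentz_sub {h : ℝ → ℝ} (hper : Function.Periodic h 1) (A c : ℝ) :
    ∫ α in (0 : ℝ)..1, h α * lorentz A (α - c) = ∫ α in (0 : ℝ)..1, h (α + c) * lorentz A α := by
  have hk : Function.Periodic (fun α => h (α + c) * lorentz A α) 1 := by
    intro α
    have h1 := hper (α + c)
    have h2 := lorentz_add_intCast A α 1
    rw [Int.cast_one] at h2
    simp only [h2, ← h1]
    ring_nf
  have h1 := hk.intervalIntegral_add_eq 0 (0 - c)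
  have h2 := intervalIntegral.integral_comp_sub_right (a := 0) (b := 1)
    (fun α => h (α + c) * lorentz A α) c
  simp only [sub_add_cancel] at h2
  rw [h2]
  rw [zero_add] at h1
  rw [h1]
  congr 1
  ring

lemma continuous_gF (X : ℝ) (M : ℕ) : Continuous (gF X M) := by
  unfold gF; fun_prop

lemma periodic_gF (X : ℝ) (M : ℕ) : Function.Periodic (gF X M) 1 := by
  intro α
  unfold gF
  refine Finset.sum_congr rfl fun t _ => ?_
  rw [← ex_add_intCast (α * (t : ℝ) ^ 2) (t ^ 2)]
  congr 2
  push_cast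
  ring

lemma summable_exp_neg_sq_div {X : ℝ} (hX : 0 < X) :
    Summable fun x : ℤ => Real.exp (-(x : ℝ) ^ 2 / X) := by
  have h := (summable_cexp_neg_mul_sq (w := ((1 / (Real.pi * X) : ℝ) : ℂ)) (by
    rw [Complex.ofReal_re]; have := Real.pi_pos; positivity)).norm
  refine h.congr fun x => ?_
  rw [Complex.norm_exp]
  congr 1
  have : -(Real.pi : ℂ) * ((1 / (Real.pi * X) : ℝ) : ℂ) * (x : ℂ) ^ 2 =
      ((-(x : ℝ) ^ 2 / X : ℝ) : ℂ) := by
    have h1 : (Real.pi : ℂ) ≠ 0 := by exact_mod_cast Real.pi_ne_zero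
    have h2 : (X : ℂ) ≠ 0 := by exact_mod_cast hX.ne'
    push_cast
    field_simp
  rw [this, Complex.ofReal_re]

lemma continuous_thetaF {X : ℝ} (hX : 0 < X) : Continuous (thetaF X) := by
  have hs := summable_exp_neg_sq_div hX
  unfold thetaF
  refine continuous_tsum (fun x => by fun_prop) hs fun x α => ?_
  rw [norm_mul, norm_ex, mul_one, Complex.norm_real, Real.norm_of_nonneg (Real.exp_pos _).le]

lemma one_sub_exp_mul_ex_ne_zero {X : ℝ} (hX : 0 < X) (t : ℝ) :
    (1 : ℂ) - Real.exp (-(1 / X)) * ex t ≠ 0 := by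
  intro h
  have h1 := congrArg norm (sub_eq_zero.1 h)
  rw [norm_one, norm_mul, norm_ex, mul_one, Complex.norm_real,
    Real.norm_of_nonneg (Real.exp_pos _).le] at h1
  have h2 : Real.exp (-(1 / X)) < 1 := by
    rw [← Real.exp_zero, Real.exp_lt_exp, neg_lt_zero]; positivity
  linarith

lemma continuous_geomKernel {X : ℝ} (hX : 0 < X) : Continuous (geomKernel X) := by
  unfold geomKernel
  exact Continuous.div continuous_const (by fun_prop) fun t => one_sub_exp_mul_ex_ne_zero hX t

lemma continuous_modelF {X : ℝ} (hX : 0 < X) (W Q : ℕ) : Continuous (modelF X W Q) := by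
  unfold modelF
  have := continuous_geomKernel hX
  fun_prop

open Real in
/-- The mean square of the error of the model against the short quadratic polynomial. -/
theorem exists_integral_norm_sq_le :
    ∃ K : ℝ, 0 < K ∧ ∀ (X : ℝ) (W Q M : ℕ), 2000 ≤ X → 0 < W →
      (∀ q, 0 < q → q ≤ Q → q ∣ W) → 2 * W ≤ ⌊√X⌋₊ →
      ∫ α in (0 : ℝ)..1, ‖(thetaF X α ^ 2 - modelF X W Q α) * gF X M α‖ ^ 2 ≤
        K * ((W : ℝ) ^ 3 * M ^ 2 * √X +
          X * ∑ q ∈ Finset.Ioc Q ⌊√X⌋₊, (sqPairCount q M : ℝ) / q) := by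
  obtain ⟨K, hK, hpt⟩ := exists_norm_thetaF_sq_sub_modelF_sq_le
  refine ⟨K * 32, by positivity, fun X W Q M hX hW hQW hWN => ?_⟩
  have hX0 : 0 < X := by linarith
  set N := ⌊√X⌋₊ with hN
  have hNX : (N : ℝ) ≤ √X := Nat.floor_le (Real.sqrt_nonneg X)
  have hX1 : 1 ≤ √X := Real.one_le_sqrt.2 (by linarith)
  have hg := continuous_gF X M
  let G : ℝ → ℝ := fun α => ‖gF X M α‖ ^ 2
  have hGc : Continuous G := by fun_prop
  have hGper : Function.Periodic G 1 := fun α => by simp only [G, periodic_gF X M α]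
  have hA : 0 < 1 / (2 * π * X) := by positivity
  have hint : ∀ (c : ℝ) {A : ℝ}, 0 < A → Continuous fun α => G α * lorentz A (α - c) := by
    intro c A hA
    exact hGc.mul ((continuous_lorentz hA).comp (continuous_id.sub continuous_const))
  have h1 : ∫ α in (0 : ℝ)..1, ‖(thetaF X α ^ 2 - modelF X W Q α) * gF X M α‖ ^ 2 ≤
      ∫ α in (0 : ℝ)..1, K * (W * ∑ b ∈ majorSet W Q, G α * lorentz (arcWidth W N b) (α - b / W) +
          ∑ q ∈ Finset.Ioc Q N, 1 / (q : ℝ) ^ 2 *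
            ∑ a ∈ Finset.range q, G α * lorentz (1 / (2 * π * X)) (α - a / q)) := by
    refine intervalIntegral.integral_mono_on zero_le_one ?_ ?_ fun α _ => ?_
    · have := continuous_thetaF hX0
      have := continuous_modelF hX0 W Q
      exact Continuous.intervalIntegrable (by fun_prop) _ _
    · refine Continuous.intervalIntegrable (continuous_const.mul ((continuous_const.mul
        (continuous_finsetSum _ fun b _ => hint _ (arcWidth_pos W N b))).add
        (continuous_finsetSum _ fun q _ => continuous_const.mul
          (continuous_finsetSum _ fun a _ => hint _ hA)))) _ _
    · rw [norm_mul, mul_pow]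
      have h2 := mul_le_mul_of_nonneg_right (hpt X W Q hX hW hQW hWN α) (sq_nonneg ‖gF X M α‖)
      refine h2.trans (le_of_eq ?_)
      simp only [G]
      simp_rw [← Finset.mul_sum]
      simp_rw [mul_left_comm _ (‖gF X M α‖ ^ 2)]
      rw [← Finset.mul_sum]
      ring
  refine h1.trans ?_
  rw [intervalIntegral.integral_const_mul, intervalIntegral.integral_add,
    intervalIntegral.integral_const_mul, intervalIntegral.integral_finsetSum,
    intervalIntegral.integral_finsetSum]
  rotate_left
  · intro q _
    exact Continuous.intervalIntegrable (continuous_const.mul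
      (continuous_finsetSum _ fun a _ => hint _ hA)) _ _
  · intro b _
    exact (hint _ (arcWidth_pos W N b)).intervalIntegrable _ _
  · exact Continuous.intervalIntegrable (continuous_const.mul
      (continuous_finsetSum _ fun b _ => hint _ (arcWidth_pos W N b))) _ _
  · exact Continuous.intervalIntegrable (continuous_finsetSum _ fun q _ => continuous_const.mul
      (continuous_finsetSum _ fun a _ => hint _ hA)) _ _
  have hW0 : (0 : ℝ) < W := by exact_mod_cast hW
  -- Here the trivial bound |gF| ≤ M is enough, and 4/`arcWidth` ≤ 8√X · W.
  have hmajor : ∀ b ∈ majorSet W Q,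
      ∫ α in (0 : ℝ)..1, G α * lorentz (arcWidth W N b) (α - b / W) ≤
        (M : ℝ) ^ 2 * (8 * √X * W) := by
    intro b _
    have hw := arcWidth_pos W N b
    rw [integral_mul_lorentz_sub hGper]
    calc _ ≤ ∫ α in (0 : ℝ)..1, (M : ℝ) ^ 2 * lorentz (arcWidth W N b) α := by
          refine intervalIntegral.integral_mono_on zero_le_one ?_ ?_ fun α _ => ?_
          · exact ((hGc.comp (continuous_id.add continuous_const)).mul
              (continuous_lorentz hw)).intervalIntegrable _ _
          · exact (continuous_const.mul (continuous_lorentz hw)).intervalIntegrable _ _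
          · refine mul_le_mul_of_nonneg_right ?_ (lorentz_nonneg _ _)
            exact pow_le_pow_left₀ (norm_nonneg _) (norm_gF_le hX0 M _) 2
      _ = (M : ℝ) ^ 2 * ∫ α in (0 : ℝ)..1, lorentz (arcWidth W N b) α :=
          intervalIntegral.integral_const_mul _ _
      _ ≤ (M : ℝ) ^ 2 * (4 / arcWidth W N b) := by
          gcongr; exact integral_lorentz_le hw
      _ ≤ _ := by
          have hd : ((((b : ℚ) / W).den : ℕ) : ℝ) ≤ W := by
            exact_mod_cast Nat.le_of_dvd hW (den_natCast_div_dvd b W)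
          rw [arcWidth, div_div_eq_mul_div, div_one]
          refine mul_le_mul_of_nonneg_left ?_ (by positivity)
          calc 4 * (((N : ℝ) + 1) * (((b : ℚ) / W).den : ℕ)) ≤ 4 * ((√X + √X) * W) := by gcongr
            _ = _ := by ring
  -- Translating every a/q to the origin by periodicity leaves one Lorentzian, of integral at most
  -- 8πX ≤ 32X, against the average over a.
  have hminor : ∀ q ∈ Finset.Ioc Q N,
      ∫ α in (0 : ℝ)..1, 1 / (q : ℝ) ^ 2 *
        ∑ a ∈ Finset.range q, G α * lorentz (1 / (2 * π * X)) (α - a / q) ≤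
        32 * X * ((sqPairCount q M : ℝ) / q) := by
    intro q hq
    have hq0 : 0 < q := by have := (Finset.mem_Ioc.1 hq).1; omega
    have hq0' : (0 : ℝ) < q := by exact_mod_cast hq0
    rw [intervalIntegral.integral_const_mul, intervalIntegral.integral_finsetSum
      fun a _ => (hint _ hA).intervalIntegrable _ _]
    simp_rw [integral_mul_lorentz_sub hGper]
    have hc : ∀ a : ℕ, Continuous fun α => G (α + a / q) * lorentz (1 / (2 * π * X)) α :=
      fun a => (hGc.comp (continuous_id.add continuous_const)).mul (continuous_lorentz hA)
    rw [← intervalIntegral.integral_finsetSum fun a _ => (hc a).intervalIntegrable _ _]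
    have h2 : ∫ α in (0 : ℝ)..1, ∑ a ∈ Finset.range q,
        G (α + a / q) * lorentz (1 / (2 * π * X)) α ≤
        (q * sqPairCount q M) * (32 * X) := by
      calc _ ≤ ∫ α in (0 : ℝ)..1, (q * sqPairCount q M : ℝ) * lorentz (1 / (2 * π * X)) α := by
            refine intervalIntegral.integral_mono_on zero_le_one ?_ ?_ fun α _ => ?_
            · exact (continuous_finsetSum _ fun a _ => hc a).intervalIntegrable _ _
            · exact (continuous_const.mul (continuous_lorentz hA)).intervalIntegrable _ _
            · rw [← Finset.sum_mul]
              exact mul_le_mul_of_nonneg_right (sum_norm_gF_sq_le hX0 M q hq0 α)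
                (lorentz_nonneg _ _)
        _ = (q * sqPairCount q M : ℝ) * ∫ α in (0 : ℝ)..1, lorentz (1 / (2 * π * X)) α :=
            intervalIntegral.integral_const_mul _ _
        _ ≤ _ := by
            gcongr
            refine (integral_lorentz_le hA).trans ?_
            rw [div_div_eq_mul_div, div_one]
            nlinarith [pi_le_four]
    calc _ ≤ 1 / (q : ℝ) ^ 2 * ((q * sqPairCount q M) * (32 * X)) := by gcongr
      _ = _ := by field_simp
  have hcard : ((majorSet W Q).card : ℝ) ≤ W := by
    have : (majorSet W Q).card ≤ (Finset.range W).card := Finset.card_filter_le _ _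
    rw [Finset.card_range] at this
    exact_mod_cast this
  have e1 : ∑ b ∈ majorSet W Q, ∫ α in (0 : ℝ)..1, G α * lorentz (arcWidth W N b) (α - b / W) ≤
      W * ((M : ℝ) ^ 2 * (8 * √X * W)) := by
    refine (Finset.sum_le_sum hmajor).trans ?_
    rw [Finset.sum_const, nsmul_eq_mul]
    gcongr
  have e2 := Finset.sum_le_sum hminor
  rw [← Finset.mul_sum] at e2
  have e3 : 0 ≤ (W : ℝ) ^ 3 * M ^ 2 * √X := by positivity
  have e4 := mul_le_mul_of_nonneg_left e1 hW0.le
  rw [mul_assoc K]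
  refine mul_le_mul_of_nonneg_left ?_ hK.le
  have e5 : (W : ℝ) * (W * ((M : ℝ) ^ 2 * (8 * √X * W))) = 8 * ((W : ℝ) ^ 3 * M ^ 2 * √X) := by ring
  linarith

/-! ### Divisor sums and pairs of congruent squares. -/

open Finset in
lemma sum_card_divisors_le (n : ℕ) (hn : 0 < n) :
    ∑ u ∈ Ioc 0 n, (u.divisors.card : ℝ) ≤ n * (1 + Real.log n) := by
  calc ∑ u ∈ Ioc 0 n, (u.divisors.card : ℝ)
      = ∑ u ∈ Ioc 0 n, ∑ d ∈ Ioc 0 n, if d ∣ u then (1 : ℝ) else 0 := by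
        refine sum_congr rfl fun u hu => ?_
        rw [mem_Ioc] at hu
        rw [← sum_filter, sum_const, nsmul_eq_mul, mul_one]
        congr 2
        ext d
        rw [Nat.mem_divisors, mem_filter, mem_Ioc]
        constructor
        · rintro ⟨hd, -⟩
          have h1 := Nat.le_of_dvd hu.1 hd
          have h2 := Nat.pos_of_dvd_of_pos hd hu.1
          exact ⟨⟨h2, by omega⟩, hd⟩
        · rintro ⟨-, hd⟩
          exact ⟨hd, by omega⟩
    _ = ∑ d ∈ Ioc 0 n, ∑ u ∈ Ioc 0 n, if d ∣ u then (1 : ℝ) else 0 := sum_comm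
    _ ≤ ∑ d ∈ Ioc 0 n, (n : ℝ) * (d : ℝ)⁻¹ := by
        refine sum_le_sum fun d _ => ?_
        rw [← sum_filter, sum_const, Nat.Ioc_filter_dvd_card_eq_div, nsmul_eq_mul, mul_one,
          ← div_eq_mul_inv]
        exact Nat.cast_div_le
    _ = n * (harmonic n : ℝ) := by
        rw [← mul_sum, harmonic_eq_sum_Icc]
        push_cast
        rfl
    _ ≤ _ := by
        gcongr
        exact harmonic_le_one_add_log n

-- The map (s, t) ↦ (s - t, s + t) is injective into pairs from 1 to 2M, and d(uv) ≤ d(u)d(v), so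
-- the sum is at most the square of a one-variable divisor sum.
open Finset in
lemma sum_card_divisors_sq_sub_sq_le (M : ℕ) (hM : 0 < M) :
    ∑ s ∈ Ioc 0 M, ∑ t ∈ Ioc 0 M,
      (if t < s then ((s ^ 2 - t ^ 2).divisors.card : ℝ) else 0) ≤
        (2 * M * (1 + Real.log (2 * M))) ^ 2 := by
  set I := Ioc 0 (2 * M)
  have h1 := sum_card_divisors_le (2 * M) (by omega)
  push_cast at h1
  have h2 : (∑ u ∈ I, (u.divisors.card : ℝ)) ^ 2 =
      ∑ p ∈ I ×ˢ I, (p.1.divisors.card : ℝ) * p.2.divisors.card := by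
    rw [sq, sum_mul_sum, sum_product]
  set A := (Ioc 0 M ×ˢ Ioc 0 M).filter fun p => p.2 < p.1
  have h3 : ∑ p ∈ A, ((p.1 - p.2).divisors.card : ℝ) * (p.1 + p.2).divisors.card =
      ∑ p ∈ A.image (fun p => (p.1 - p.2, p.1 + p.2)),
        (p.1.divisors.card : ℝ) * p.2.divisors.card := by
    rw [sum_image]
    rintro ⟨s, t⟩ hp ⟨s', t'⟩ hp' h
    have h4 := (mem_filter.1 hp).2
    have h5 := (mem_filter.1 hp').2
    simp only [Prod.mk.injEq] at h h4 h5 ⊢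
    omega
  calc _ = ∑ p ∈ A, ((p.1 ^ 2 - p.2 ^ 2).divisors.card : ℝ) := by
        rw [sum_filter, sum_product]
    _ ≤ ∑ p ∈ A, ((p.1 - p.2).divisors.card : ℝ) * (p.1 + p.2).divisors.card := by
        refine sum_le_sum fun p _ => ?_
        rw [Nat.sq_sub_sq, mul_comm (p.1 + p.2), Nat.divisors_mul]
        exact_mod_cast card_mul_le
    _ = _ := h3
    _ ≤ ∑ p ∈ I ×ˢ I, (p.1.divisors.card : ℝ) * p.2.divisors.card := by
        refine sum_le_sum_of_subset_of_nonneg ?_ fun p _ _ => by positivity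
        intro p hp
        obtain ⟨⟨s, t⟩, hst, rfl⟩ := mem_image.1 hp
        simp only [A, I, mem_filter, mem_product, mem_Ioc] at hst ⊢
        omega
    _ = (∑ u ∈ I, (u.divisors.card : ℝ)) ^ 2 := h2.symm
    _ ≤ _ := pow_le_pow_left₀ (sum_nonneg fun u _ => Nat.cast_nonneg _) h1 2

-- The diagonal s = t gives a harmonic sum. For s ≠ t each modulus contributes less than 1/Q, and
-- the admissible moduli are divisors of |s² - t²|.
open Finset in
lemma sum_sqPairCount_div_le (Q N M : ℕ) (hQ : 0 < Q) (hM : 0 < M) :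
    ∑ q ∈ Ioc Q N, (sqPairCount q M : ℝ) / q ≤
      M * (1 + Real.log N) + 2 * (2 * M * (1 + Real.log (2 * M))) ^ 2 / Q := by
  have hQ0 : (0 : ℝ) < Q := by exact_mod_cast hQ
  let D : ℕ → ℕ → ℝ := fun s t => if t < s then ((s ^ 2 - t ^ 2).divisors.card : ℝ) / Q else 0
  have hoff : ∀ s t : ℕ, t < s → ∑ q ∈ Ioc Q N,
      (if (q : ℤ) ∣ (s : ℤ) ^ 2 - (t : ℤ) ^ 2 then 1 / (q : ℝ) else 0) ≤ D s t := by
    intro s t hts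
    have hlt : t ^ 2 < s ^ 2 := Nat.pow_lt_pow_left hts two_ne_zero
    simp only [D, if_pos hts]
    rw [← sum_filter]
    calc _ ≤ ∑ q ∈ (Ioc Q N).filter (fun q : ℕ => (q : ℤ) ∣ (s : ℤ) ^ 2 - (t : ℤ) ^ 2), 1 / (Q : ℝ) := by
          refine sum_le_sum fun q hq => ?_
          have := (mem_Ioc.1 (mem_filter.1 hq).1).1
          exact one_div_le_one_div_of_le hQ0 (by exact_mod_cast this.le)
      _ ≤ _ := by
          rw [sum_const, nsmul_eq_mul, mul_one_div]
          gcongr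
          intro q hq
          rw [Nat.mem_divisors]
          have h1 := (mem_filter.1 hq).2
          have h2 : (s : ℤ) ^ 2 - (t : ℤ) ^ 2 = ((s ^ 2 - t ^ 2 : ℕ) : ℤ) := by
            push_cast [Nat.cast_sub hlt.le]; rfl
          rw [h2] at h1
          exact ⟨by exact_mod_cast h1, by omega⟩
  have hcomm : ∀ s t : ℕ, ∀ q : ℕ, ((q : ℤ) ∣ (s : ℤ) ^ 2 - (t : ℤ) ^ 2) ↔
      ((q : ℤ) ∣ (t : ℤ) ^ 2 - (s : ℤ) ^ 2) := fun s t q => by rw [dvd_sub_comm]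
  have hdiag : ∑ q ∈ Ioc Q N, 1 / (q : ℝ) ≤ 1 + Real.log N := by
    refine le_trans ?_ (harmonic_le_one_add_log N)
    rw [harmonic_eq_sum_Icc]
    push_cast
    simp_rw [one_div]
    refine sum_le_sum_of_subset_of_nonneg ?_ fun q _ _ => by positivity
    intro q hq
    rw [mem_Ioc] at hq
    rw [mem_Icc]
    omega
  have hall : ∀ s t : ℕ, ∑ q ∈ Ioc Q N,
      (if (q : ℤ) ∣ (s : ℤ) ^ 2 - (t : ℤ) ^ 2 then 1 / (q : ℝ) else 0) ≤
      (if s = t then 1 + Real.log N else 0) + D s t + D t s := by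
    intro s t
    have hD : ∀ s t, 0 ≤ D s t := fun s t => by simp only [D]; split_ifs <;> positivity
    have hl : 0 ≤ Real.log N := Real.log_natCast_nonneg N
    rcases lt_trichotomy s t with h | h | h
    · have := hoff t s h
      simp_rw [hcomm s t]
      have h2 := hD s t
      rw [if_neg h.ne]
      linarith
    · subst h
      rw [if_pos rfl]
      have h2 := hD s s
      simp only [sub_self, dvd_zero, if_true]
      linarith
    · have := hoff s t h
      have h2 := hD t s
      rw [if_neg h.ne']
      linarith
  have hS : ∑ s ∈ Ioc 0 M, ∑ t ∈ Ioc 0 M, D s t ≤ (2 * M * (1 + Real.log (2 * M))) ^ 2 / Q := by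
    have h1 := sum_card_divisors_sq_sub_sq_le M hM
    refine le_trans (le_of_eq ?_) (div_le_div_of_nonneg_right h1 hQ0.le)
    simp_rw [sum_div]
    refine sum_congr rfl fun s _ => sum_congr rfl fun t _ => ?_
    simp only [D]
    split_ifs <;> simp
  calc ∑ q ∈ Ioc Q N, (sqPairCount q M : ℝ) / q
      = ∑ q ∈ Ioc Q N, ∑ s ∈ Ioc 0 M, ∑ t ∈ Ioc 0 M,
        (if (q : ℤ) ∣ (s : ℤ) ^ 2 - (t : ℤ) ^ 2 then 1 / (q : ℝ) else 0) := by
        refine sum_congr rfl fun q _ => ?_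
        rw [← sum_product' (f := fun s t : ℕ =>
          if (q : ℤ) ∣ (s : ℤ) ^ 2 - (t : ℤ) ^ 2 then 1 / (q : ℝ) else 0),
          ← sum_filter, sum_const, nsmul_eq_mul, mul_one_div, sqPairCount]
    _ = ∑ s ∈ Ioc 0 M, ∑ t ∈ Ioc 0 M, ∑ q ∈ Ioc Q N,
        (if (q : ℤ) ∣ (s : ℤ) ^ 2 - (t : ℤ) ^ 2 then 1 / (q : ℝ) else 0) := by
        rw [sum_comm]
        exact sum_congr rfl fun s _ => sum_comm
    _ ≤ ∑ s ∈ Ioc 0 M, ∑ t ∈ Ioc 0 M,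
        ((if s = t then 1 + Real.log N else 0) + D s t + D t s) :=
        sum_le_sum fun s _ => sum_le_sum fun t _ => hall s t
    _ = M * (1 + Real.log N) + ∑ s ∈ Ioc 0 M, ∑ t ∈ Ioc 0 M, D s t +
        ∑ s ∈ Ioc 0 M, ∑ t ∈ Ioc 0 M, D t s := by
        simp_rw [sum_add_distrib]
        congr 2
        rw [sum_congr rfl fun s hs => by rw [sum_ite_eq, if_pos hs]]
        simp
        ring
    _ ≤ _ := by
        rw [sum_comm (f := fun s t => D t s)]
        have : 2 * (2 * M * (1 + Real.log (2 * M))) ^ 2 / Q =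
          (2 * M * (1 + Real.log (2 * M))) ^ 2 / Q + (2 * M * (1 + Real.log (2 * M))) ^ 2 / Q := by
          ring
        rw [this]
        linarith

/-! ### Bessel's inequality and the Fourier coefficients of the error. -/

lemma integral_ex_intCast_mul (k : ℤ) :
    ∫ α in (0 : ℝ)..1, ex (k * α) = if k = 0 then 1 else 0 := by
  split_ifs with hk
  · simp [hk]
  · have hc : (2 * Real.pi * Complex.I * k : ℂ) ≠ 0 := by
      have : (k : ℂ) ≠ 0 := by exact_mod_cast hk
      simp [Real.pi_ne_zero, this]
    have h1 : ∀ α : ℝ, ex (k * α) = Complex.exp ((2 * Real.pi * Complex.I * k) * α) := by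
      intro α; rw [ex]; congr 1; push_cast; ring
    simp_rw [h1]
    rw [integral_exp_mul_complex hc]
    have h2 : Complex.exp ((2 * Real.pi * Complex.I * k) * ((1 : ℝ) : ℂ)) = 1 := by
      rw [← h1 1, mul_one, ex_intCast]
    rw [h2]
    simp

/-- Bessel's inequality for the Fourier coefficients of a continuous function. -/
lemma sum_norm_sq_integral_mul_ex_le {H : ℝ → ℂ} (hH : Continuous H) (S : Finset ℤ) :
    ∑ n ∈ S, ‖∫ α in (0 : ℝ)..1, H α * ex (-(n * α))‖ ^ 2 ≤ ∫ α in (0 : ℝ)..1, ‖H α‖ ^ 2 := by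
  set c : ℤ → ℂ := fun n => ∫ α in (0 : ℝ)..1, H α * ex (-(n * α)) with hc
  let T : ℝ → ℂ := fun α => ∑ n ∈ S, c n * ex (n * α)
  have hT : Continuous T := by simp only [T]; fun_prop
  have hpair : ∀ F : ℝ → ℂ, Continuous F →
      ∫ α in (0 : ℝ)..1, F α * (starRingEnd ℂ) (T α) =
        ∑ n ∈ S, (starRingEnd ℂ) (c n) * ∫ α in (0 : ℝ)..1, F α * ex (-(n * α)) := by
    intro F hF
    have h1 : ∀ α, F α * (starRingEnd ℂ) (T α) =
        ∑ n ∈ S, (starRingEnd ℂ) (c n) * (F α * ex (-(n * α))) := by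
      intro α
      simp only [T]
      rw [map_sum, Finset.mul_sum]
      refine Finset.sum_congr rfl fun n _ => ?_
      rw [map_mul, ex_neg]; ring
    simp_rw [h1]
    rw [intervalIntegral.integral_finsetSum fun n _ =>
      Continuous.intervalIntegrable (by fun_prop) _ _]
    exact Finset.sum_congr rfl fun n _ => intervalIntegral.integral_const_mul _ _
  have hcT : ∀ n ∈ S, ∫ α in (0 : ℝ)..1, T α * ex (-(n * α)) = c n := by
    intro n hn
    have h1 : ∀ α, T α * ex (-(n * α)) = ∑ m ∈ S, c m * ex ((m - n : ℤ) * α) := by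
      intro α
      simp only [T]
      rw [Finset.sum_mul]
      refine Finset.sum_congr rfl fun m _ => ?_
      rw [mul_assoc, ← ex_add]
      congr 2
      push_cast; ring
    simp_rw [h1]
    rw [intervalIntegral.integral_finsetSum fun n _ =>
      Continuous.intervalIntegrable (by fun_prop) _ _]
    simp_rw [intervalIntegral.integral_const_mul, integral_ex_intCast_mul, sub_eq_zero]
    simp [hn]
  have hsum : ∑ n ∈ S, (starRingEnd ℂ) (c n) * c n = ((∑ n ∈ S, ‖c n‖ ^ 2 : ℝ) : ℂ) := by
    push_cast
    exact Finset.sum_congr rfl fun n _ => Complex.conj_mul' _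
  have h1 : ∫ α in (0 : ℝ)..1, H α * (starRingEnd ℂ) (T α) = ((∑ n ∈ S, ‖c n‖ ^ 2 : ℝ) : ℂ) := by
    rw [hpair H hH, ← hsum]
  have h2 : ∫ α in (0 : ℝ)..1, T α * (starRingEnd ℂ) (T α) = ((∑ n ∈ S, ‖c n‖ ^ 2 : ℝ) : ℂ) := by
    rw [hpair T hT, ← hsum]
    exact Finset.sum_congr rfl fun n hn => by rw [hcT n hn]
  -- This expands ‖H - T‖² for the partial Fourier sum T. The cross terms and ‖T‖² all integrate to
  -- ∑ ‖c n‖², so nonnegativity of ∫ ‖H - T‖² is the inequality.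
  have h3 : ∀ α, ((‖H α‖ ^ 2 - ‖H α - T α‖ ^ 2 : ℝ) : ℂ) = H α * (starRingEnd ℂ) (T α) +
      (starRingEnd ℂ) (H α * (starRingEnd ℂ) (T α)) - T α * (starRingEnd ℂ) (T α) := by
    intro α
    push_cast
    rw [← Complex.mul_conj', ← Complex.mul_conj', map_sub, map_mul, Complex.conj_conj]
    ring
  have hHT : Continuous fun α => H α * (starRingEnd ℂ) (T α) :=
    hH.mul (Complex.continuous_conj.comp hT)
  have hTT : Continuous fun α => T α * (starRingEnd ℂ) (T α) :=
    hT.mul (Complex.continuous_conj.comp hT)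
  have h4 : ((∫ α in (0 : ℝ)..1, (‖H α‖ ^ 2 - ‖H α - T α‖ ^ 2) : ℝ) : ℂ) =
      ((∑ n ∈ S, ‖c n‖ ^ 2 : ℝ) : ℂ) := by
    rw [← intervalIntegral.integral_ofReal]
    simp_rw [h3]
    rw [intervalIntegral.integral_sub, intervalIntegral.integral_add, h1, h2]
    · have h5 : ∫ α in (0 : ℝ)..1, (starRingEnd ℂ) (H α * (starRingEnd ℂ) (T α)) =
          (starRingEnd ℂ) (∫ α in (0 : ℝ)..1, H α * (starRingEnd ℂ) (T α)) := by
        rw [intervalIntegral.integral_of_le zero_le_one, intervalIntegral.integral_of_le zero_le_one]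
        exact integral_conj
      rw [h5, h1, Complex.conj_ofReal]
      ring
    · exact hHT.intervalIntegrable _ _
    · exact (Complex.continuous_conj.comp hHT).intervalIntegrable _ _
    · exact (hHT.add (Complex.continuous_conj.comp hHT)).intervalIntegrable _ _
    · exact hTT.intervalIntegrable _ _
  have h5 := Complex.ofReal_injective h4
  rw [intervalIntegral.integral_sub (Continuous.intervalIntegrable (by fun_prop) _ _)
    (Continuous.intervalIntegrable (by fun_prop) _ _)] at h5
  have h6 : 0 ≤ ∫ α in (0 : ℝ)..1, ‖H α - T α‖ ^ 2 :=
    intervalIntegral.integral_nonneg zero_le_one fun α _ => by positivity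
  change ∑ n ∈ S, ‖c n‖ ^ 2 ≤ _
  linarith

lemma hasSum_intervalIntegral_of_norm_le {ι : Type*} [Countable ι] {F : ι → ℝ → ℂ} {u : ι → ℝ}
    (hF : ∀ i, Continuous (F i)) (hu : Summable u) (hFu : ∀ i α, ‖F i α‖ ≤ u i) :
    HasSum (fun i => ∫ α in (0 : ℝ)..1, F i α) (∫ α in (0 : ℝ)..1, ∑' i, F i α) := by
  refine intervalIntegral.hasSum_integral_of_dominated_convergence (fun i _ => u i)
    (fun i => (hF i).aestronglyMeasurable) ?_ ?_ ?_ ?_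
  · exact fun i => Filter.Eventually.of_forall fun α _ => hFu i α
  · exact Filter.Eventually.of_forall fun α _ => hu
  · exact intervalIntegrable_const
  · exact Filter.Eventually.of_forall fun α _ =>
      (Summable.of_norm_bounded hu fun i => hFu i α).hasSum

/-- The integral is the sum of exp(-(x² + y²)/X) over integer solutions of x² + y² = k. Zero values
of x and y are included, which is why the hypothesis ranges over all integers. -/
lemma integral_thetaF_sq_mul_ex_eq_zero {X : ℝ} (hX : 0 < X) {k : ℤ}
    (hk : ∀ x y : ℤ, x ^ 2 + y ^ 2 ≠ k) :
    ∫ α in (0 : ℝ)..1, thetaF X α ^ 2 * ex (-(k * α)) = 0 := by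
  have hs := summable_exp_neg_sq_div hX
  let w : ℤ → ℝ := fun x => Real.exp (-(x : ℝ) ^ 2 / X)
  have hw0 : ∀ x, 0 ≤ w x := fun x => (Real.exp_pos _).le
  have hnorm : ∀ α : ℝ, ∀ x : ℤ, ‖(w x : ℂ) * ex (α * (x : ℝ) ^ 2)‖ = w x := by
    intro α x
    rw [norm_mul, norm_ex, mul_one, Complex.norm_real, Real.norm_of_nonneg (hw0 x)]
  have h1 : ∀ α : ℝ, thetaF X α ^ 2 * ex (-(k * α)) = ∑' p : ℤ × ℤ,
      (w p.1 * w p.2 : ℂ) * ex ((p.1 ^ 2 + p.2 ^ 2 - k : ℤ) * α) := by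
    intro α
    have hsn : Summable fun x : ℤ => ‖(w x : ℂ) * ex (α * (x : ℝ) ^ 2)‖ := by
      simp_rw [hnorm]; exact hs
    rw [sq, thetaF, tsum_mul_tsum_of_summable_norm hsn hsn, ← tsum_mul_right]
    refine tsum_congr fun p => ?_
    have : ((p.1 ^ 2 + p.2 ^ 2 - k : ℤ) : ℝ) * α =
        α * (p.1 : ℝ) ^ 2 + α * (p.2 : ℝ) ^ 2 + -(k * α) := by push_cast; ring
    rw [this, ex_add, ex_add]
    ring
  simp_rw [h1]
  have h2 := hasSum_intervalIntegral_of_norm_le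
    (F := fun (p : ℤ × ℤ) α => (w p.1 * w p.2 : ℂ) * ex ((p.1 ^ 2 + p.2 ^ 2 - k : ℤ) * α))
    (u := fun p => w p.1 * w p.2) (fun p => by fun_prop)
    (hs.mul_of_nonneg hs hw0 hw0) (fun p α => by
      rw [norm_mul, norm_ex, mul_one, norm_mul, Complex.norm_real, Complex.norm_real,
        Real.norm_of_nonneg (hw0 _), Real.norm_of_nonneg (hw0 _)])
  rw [← h2.tsum_eq]
  refine (tsum_congr fun p => ?_).trans tsum_zero
  rw [intervalIntegral.integral_const_mul, integral_ex_intCast_mul,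
    if_neg (sub_ne_zero.2 (hk p.1 p.2)), mul_zero]

lemma integral_geomKernel_mul_ex {X : ℝ} (hX : 0 < X) (c : ℝ) {k : ℤ} (hk : 0 ≤ k) :
    ∫ α in (0 : ℝ)..1, geomKernel X (α - c) * ex (-(k * α)) =
      Real.exp (-k / X) * ex (-(k * c)) := by
  lift k to ℕ using hk
  set r := Real.exp (-(1 / X)) with hr
  have hr0 : 0 ≤ r := (Real.exp_pos _).le
  have hr1 : r < 1 := by
    rw [hr, ← Real.exp_zero, Real.exp_lt_exp, neg_lt_zero]; positivity
  have h1 : ∀ α : ℝ, geomKernel X (α - c) * ex (-(((k : ℕ) : ℤ) * α)) =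
      ∑' m : ℕ, ((r ^ m : ℝ) : ℂ) * ex (-(m * c)) * ex ((m - k : ℤ) * α) := by
    intro α
    have hn : ‖(r : ℂ) * ex (α - c)‖ < 1 := by
      rw [norm_mul, norm_ex, mul_one, Complex.norm_real, Real.norm_of_nonneg hr0]; exact hr1
    rw [geomKernel, one_div, ← tsum_geometric_of_norm_lt_one hn, ← tsum_mul_right]
    refine tsum_congr fun m => ?_
    rw [mul_pow, ← ex_natCast_mul]
    push_cast
    rw [mul_assoc, mul_assoc, ← ex_add, ← ex_add]
    congr 2
    ring
  simp_rw [h1]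
  have h2 := hasSum_intervalIntegral_of_norm_le
    (F := fun (m : ℕ) α => ((r ^ m : ℝ) : ℂ) * ex (-(m * c)) * ex ((m - k : ℤ) * α))
    (u := fun m => r ^ m) (fun p => by fun_prop)
    (summable_geometric_of_lt_one hr0 hr1) (fun m α => by
      rw [norm_mul, norm_mul, norm_ex, norm_ex, mul_one, mul_one, Complex.norm_real,
        Real.norm_of_nonneg (pow_nonneg hr0 m)])
  rw [← h2.tsum_eq, tsum_eq_single k]
  · rw [intervalIntegral.integral_const_mul, integral_ex_intCast_mul, if_pos (sub_self _), mul_one,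
      hr, ← Real.exp_nat_mul]
    congr 3
    push_cast; ring_nf
  · intro m hm
    rw [intervalIntegral.integral_const_mul, integral_ex_intCast_mul, if_neg, mul_zero]
    intro h
    exact hm (by omega)

/-- The Fourier coefficients of the error of the model at integers without a representation. -/
lemma integral_error_mul_ex {X : ℝ} (hX : 0 < X) (W Q M : ℕ) {n : ℤ} (hM : (M : ℤ) ^ 2 ≤ n)
    (hn : ∀ x y : ℤ, ∀ t ∈ Finset.Ioc 0 M, x ^ 2 + y ^ 2 ≠ n - (t : ℤ) ^ 2) :
    ∫ α in (0 : ℝ)..1, (thetaF X α ^ 2 - modelF X W Q α) * gF X M α * ex (-(n * α)) =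
      -(Real.pi * Real.exp (-n / X) * ∑ b ∈ majorSet W Q, gam ((b : ℚ) / W) ^ 2 *
        ex (-(n * (b / W))) * ∑ t ∈ Finset.Ioc 0 M, ex (b / W * (t : ℝ) ^ 2)) := by
  let w : ℕ → ℝ := fun t => Real.exp (-(t : ℝ) ^ 2 / X)
  have h1 : ∀ α : ℝ, (thetaF X α ^ 2 - modelF X W Q α) * gF X M α * ex (-(n * α)) =
      ∑ t ∈ Finset.Ioc 0 M, ((w t : ℂ) * (thetaF X α ^ 2 * ex (-((n - (t : ℤ) ^ 2 : ℤ) * α))) -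
        ∑ b ∈ majorSet W Q, (w t : ℂ) * (Real.pi * gam ((b : ℚ) / W) ^ 2) *
          (geomKernel X (α - b / W) * ex (-((n - (t : ℤ) ^ 2 : ℤ) * α)))) := by
    intro α
    rw [gF, Finset.mul_sum, Finset.sum_mul]
    refine Finset.sum_congr rfl fun t _ => ?_
    have : -(((n - (t : ℤ) ^ 2 : ℤ) : ℝ) * α) = α * (t : ℝ) ^ 2 + -(n * α) := by push_cast; ring
    rw [this, ex_add, modelF]
    simp only [w]
    rw [sub_mul, sub_mul, Finset.sum_mul, Finset.sum_mul]
    congr 1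
    · ring
    · refine Finset.sum_congr rfl fun b _ => ?_
      ring
  have hθ := continuous_thetaF hX
  have hk := continuous_geomKernel hX
  simp_rw [h1]
  rw [intervalIntegral.integral_finsetSum fun t _ => Continuous.intervalIntegrable (by fun_prop) _ _]
  have h2 : ∀ t ∈ Finset.Ioc 0 M, ∫ α in (0 : ℝ)..1,
      ((w t : ℂ) * (thetaF X α ^ 2 * ex (-((n - (t : ℤ) ^ 2 : ℤ) * α))) -
        ∑ b ∈ majorSet W Q, (w t : ℂ) * (Real.pi * gam ((b : ℚ) / W) ^ 2) *
          (geomKernel X (α - b / W) * ex (-((n - (t : ℤ) ^ 2 : ℤ) * α)))) =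
      -∑ b ∈ majorSet W Q, Real.pi * Real.exp (-n / X) * (gam ((b : ℚ) / W) ^ 2 *
        ex (-(n * (b / W))) * ex (b / W * (t : ℝ) ^ 2)) := by
    intro t ht
    have htM : (t : ℤ) ^ 2 ≤ n := by
      have : (t : ℤ) ≤ M := by exact_mod_cast (Finset.mem_Ioc.1 ht).2
      exact (pow_le_pow_left₀ (by positivity) this 2).trans hM
    rw [intervalIntegral.integral_sub (Continuous.intervalIntegrable (by fun_prop) _ _)
      (Continuous.intervalIntegrable (by fun_prop) _ _), intervalIntegral.integral_const_mul,
      integral_thetaF_sq_mul_ex_eq_zero hX (fun x y => hn x y t ht), mul_zero, zero_sub,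
      intervalIntegral.integral_finsetSum fun b _ =>
        Continuous.intervalIntegrable (by fun_prop) _ _]
    congr 1
    refine Finset.sum_congr rfl fun b _ => ?_
    rw [intervalIntegral.integral_const_mul, integral_geomKernel_mul_ex hX _ (by linarith)]
    -- The weight of t in `gF` and the coefficient of the kernel at n - t² multiply to exp(-n/X),
    -- independent of t; hence an unweighted sum over t remains.
    have e1 : Real.exp (-n / X) = w t * Real.exp (-((n - (t : ℤ) ^ 2 : ℤ) : ℝ) / X) := by
      simp only [w]
      rw [← Real.exp_add]; congr 1; push_cast; ring
    have e2 : -(((n - (t : ℤ) ^ 2 : ℤ) : ℝ) * ((b : ℝ) / W)) =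
        -(n * (b / W)) + b / W * (t : ℝ) ^ 2 := by push_cast; ring
    rw [e1, e2, ex_add]
    push_cast
    ring
  rw [Finset.sum_congr rfl h2, Finset.sum_neg_distrib, Finset.sum_comm, Finset.mul_sum]
  congr 1
  refine Finset.sum_congr rfl fun b _ => ?_
  simp_rw [Finset.mul_sum]

/-! ### The singular series, complete and truncated. -/

lemma sum_range_mul_of_periodic {β : Type*} [AddCommMonoid β] {h : ℕ → β} {q : ℕ}
    (hh : Function.Periodic h q) (m : ℕ) :
    ∑ r ∈ Finset.range (q * m), h r = m • ∑ r ∈ Finset.range q, h r := by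
  induction m with
  | zero => simp
  | succ m ih =>
    rw [Nat.mul_succ, Finset.sum_range_add, ih, succ_nsmul]
    congr 1
    refine Finset.sum_congr rfl fun r _ => ?_
    rw [add_comm, mul_comm]
    exact hh.nat_mul m r

lemma periodic_ex_mul_sq (ρ : ℚ) (c : ℕ) :
    Function.Periodic (fun r : ℕ => ex (ρ * ((r + c : ℕ) : ℝ) ^ 2)) ρ.den := by
  intro r
  have h : (ρ : ℝ) * ρ.den = ρ.num := by exact_mod_cast Rat.mul_den_eq_num ρ
  have e : (ρ : ℝ) * ((r + ρ.den + c : ℕ) : ℝ) ^ 2 = ρ * ((r + c : ℕ) : ℝ) ^ 2 +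
      (ρ.num * (2 * (r + c) + ρ.den) : ℤ) := by
    push_cast
    linear_combination (2 * ((r : ℝ) + c) + ρ.den) * h
  simp only [e, ex_add_intCast]

lemma sum_range_ex_eq_mul_gam (ρ : ℚ) (m : ℕ) :
    ∑ r ∈ Finset.range (ρ.den * m), ex (ρ * (r : ℝ) ^ 2) = (ρ.den * m : ℕ) * gam ρ := by
  have h1 := sum_range_mul_of_periodic (periodic_ex_mul_sq ρ 0) m
  simp only [add_zero] at h1
  have hd : (ρ.den : ℂ) ≠ 0 := by exact_mod_cast ρ.den_ne_zero
  rw [h1, gam, gaussQ]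
  simp only [Int.cast_zero, zero_mul, zero_div, add_zero, nsmul_eq_mul]
  push_cast
  field_simp

lemma norm_gam_le_one (ρ : ℚ) : ‖gam ρ‖ ≤ 1 := by
  have hd : (0 : ℝ) < ρ.den := by exact_mod_cast ρ.den_pos
  rw [gam, norm_div, Complex.norm_natCast, div_le_one hd, gaussQ]
  refine (norm_sum_le _ _).trans ?_
  simp

/-- Full periods contribute exactly their length times `gam ρ`; the incomplete one has fewer than q
terms, each bounded by 1, as is `gam ρ`. -/
lemma norm_sum_ex_sub_mul_gam_le (ρ : ℚ) (M : ℕ) :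
    ‖∑ t ∈ Finset.Ioc 0 M, ex (ρ * (t : ℝ) ^ 2) - M * gam ρ‖ ≤ 2 * ρ.den := by
  set q := ρ.den with hq
  let h : ℕ → ℂ := fun r => ex (ρ * ((r + 1 : ℕ) : ℝ) ^ 2)
  have hper : Function.Periodic h q := periodic_ex_mul_sq ρ 1
  have h1 : ∑ t ∈ Finset.Ioc 0 M, ex (ρ * (t : ℝ) ^ 2) = ∑ r ∈ Finset.range M, h r := by
    rw [Finset.range_eq_Ico, Finset.sum_Ico_add' (fun t : ℕ => ex (ρ * (t : ℝ) ^ 2))]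
    refine Finset.sum_congr ?_ fun _ _ => rfl
    ext t
    rw [Finset.mem_Ioc, Finset.mem_Ico]
    omega
  have h2 : ∑ r ∈ Finset.range q, h r = q * gam ρ := by
    have h3 := sum_range_ex_eq_mul_gam ρ 1
    rw [mul_one] at h3
    rw [← h3]
    have h4 := Finset.sum_range_succ' (fun r : ℕ => ex (ρ * (r : ℝ) ^ 2)) q
    rw [Finset.sum_range_succ] at h4
    have h5 := periodic_ex_mul_sq ρ 0 0
    simp only [add_zero, zero_add] at h5
    rw [← hq] at h5
    rw [h5] at h4
    exact (add_right_cancel h4).symm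
  obtain ⟨k, r, hr, hM⟩ : ∃ k r, r < q ∧ M = q * k + r :=
    ⟨M / q, M % q, Nat.mod_lt _ ρ.den_pos, (Nat.div_add_mod M q).symm⟩
  have h3 : ∑ i ∈ Finset.range M, h i - M * gam ρ =
      ∑ i ∈ Finset.range r, h (q * k + i) - r * gam ρ := by
    rw [hM, Finset.sum_range_add, sum_range_mul_of_periodic hper, h2]
    push_cast
    rw [nsmul_eq_mul]
    ring
  rw [h1, h3]
  have hrq : (r : ℝ) ≤ q := by exact_mod_cast hr.le
  calc _ ≤ ‖∑ i ∈ Finset.range r, h (q * k + i)‖ + ‖(r : ℂ) * gam ρ‖ := norm_sub_le _ _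
    _ ≤ r + r * 1 := by
      refine add_le_add ?_ ?_
      · refine (norm_sum_le _ _).trans ?_
        simp [h]
      · rw [norm_mul, Complex.norm_natCast]
        exact mul_le_mul_of_nonneg_left (norm_gam_le_one ρ) (Nat.cast_nonneg r)
    _ ≤ _ := by linarith

/-- The normalised Gauss sum may be computed modulo any multiple of the reduced denominator, so all
fractions b/W can be treated with the common modulus W. -/
lemma gam_natCast_div {W : ℕ} [NeZero W] (b : ℕ) :
    gam ((b : ℚ) / W) = (∑ x : ZMod W, (ZMod.stdAddChar ((b : ZMod W) * x ^ 2) : ℂ)) / W := by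
  have hW : (W : ℂ) ≠ 0 := by exact_mod_cast NeZero.ne W
  obtain ⟨m, hm⟩ := den_natCast_div_dvd b W
  have h1 := sum_range_ex_eq_mul_gam ((b : ℚ) / W) m
  rw [← hm] at h1
  rw [eq_div_iff hW, mul_comm, ← h1, ← sum_range_natCast_zmod]
  refine Finset.sum_congr rfl fun r _ => ?_
  have h2 := ex_intCast_div W (b * (r : ℤ) ^ 2)
  push_cast at h2 ⊢
  rw [← h2]
  congr 1
  ring

/-- The complete singular series is the density of solutions modulo `W`. -/
lemma sum_gam_cube_mul_ex (W : ℕ) [NeZero W] (n : ℤ) :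
    ∑ b ∈ Finset.range W, gam ((b : ℚ) / W) ^ 3 * ex (-(n * (b / W))) =
      (ternaryCount W n : ℂ) / W ^ 2 := by
  classical
  have hW : (W : ℂ) ≠ 0 := by exact_mod_cast NeZero.ne W
  let ψ : AddChar (ZMod W) ℂ := ZMod.stdAddChar
  have hψ : ψ.IsPrimitive := ZMod.isPrimitive_stdAddChar W
  have h1 : ∀ b : ℕ, gam ((b : ℚ) / W) ^ 3 * ex (-(n * (b / W))) =
      (1 / W ^ 3) * ∑ v : Fin 3 → ZMod W, ψ ((b : ZMod W) * (∑ i, v i ^ 2 - n)) := by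
    intro b
    rw [gam_natCast_div, div_pow, Fintype.sum_pow]
    have h2 : ex (-(n * (b / W))) = ψ (-((b : ZMod W) * n)) := by
      have := ex_intCast_div W (-(b * n))
      push_cast at this
      rw [← this]
      congr 1
      ring
    rw [h2, div_mul_eq_mul_div, Finset.sum_mul, one_div_mul_eq_div]
    congr 1
    refine Finset.sum_congr rfl fun v _ => ?_
    change (∏ i, ψ ((b : ZMod W) * v i ^ 2)) * _ = _
    rw [Fin.prod_univ_three, Fin.sum_univ_three, ← AddChar.map_add_eq_mul,
      ← AddChar.map_add_eq_mul, ← AddChar.map_add_eq_mul]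
    congr 1
    ring
  simp_rw [h1]
  rw [← Finset.mul_sum, Finset.sum_comm]
  have h3 : ∀ v : Fin 3 → ZMod W, ∑ b ∈ Finset.range W, ψ ((b : ZMod W) * (∑ i, v i ^ 2 - n)) =
      if ∑ i, v i ^ 2 = (n : ZMod W) then (W : ℂ) else 0 := by
    intro v
    rw [sum_range_natCast_zmod W (fun b => ψ (b * (∑ i, v i ^ 2 - n))), AddChar.sum_mulShift _ hψ,
      ZMod.card, Nat.cast_ite, Nat.cast_zero]
    simp only [sub_eq_zero]
  simp_rw [h3]
  rw [← Finset.sum_filter, Finset.sum_const, nsmul_eq_mul, ternaryCount, Nat.card_eq_fintype_card,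
    Fintype.card_subtype]
  field_simp

lemma card_filter_den_le (W q : ℕ) :
    ((Finset.range W).filter fun b : ℕ => ((b : ℚ) / W).den = q).card ≤ q := by
  rcases Nat.eq_zero_or_pos W with rfl | hW
  · simp
  have hWq : (0 : ℚ) < W := by exact_mod_cast hW
  have hnum : ∀ b : ℕ, 0 ≤ ((b : ℚ) / W).num := fun b => Rat.num_nonneg.2 (by positivity)
  conv_rhs => rw [← Finset.card_range q]
  refine Finset.card_le_card_of_injOn (fun b : ℕ => ((b : ℚ) / W).num.toNat) ?_ ?_
  · intro b hb
    obtain ⟨hbW, hden⟩ := Finset.mem_filter.1 hb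
    rw [Finset.mem_range] at hbW
    have h1 : (b : ℚ) / W < 1 := by
      rw [div_lt_one hWq]; exact_mod_cast hbW
    have h2 : ((b : ℚ) / W).num < ((b : ℚ) / W).den := by
      have h4 : (0 : ℚ) < (((b : ℚ) / W).den : ℕ) := by exact_mod_cast Rat.den_pos _
      have h5 := mul_lt_mul_of_pos_right h1 h4
      rw [Rat.mul_den_eq_num, one_mul] at h5
      exact_mod_cast h5
    have h3 := hnum b
    simp only [Finset.coe_range, Set.mem_Iio]
    omega
  · intro b hb c hc h
    have hb' := (Finset.mem_filter.1 hb).2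
    have hc' := (Finset.mem_filter.1 hc).2
    simp only at h
    have h1 : ((b : ℚ) / W).num = ((c : ℚ) / W).num := by
      have := hnum b
      have := hnum c
      omega
    have h2 : (b : ℚ) / W = c / W := Rat.ext h1 (hb'.trans hc'.symm)
    rw [div_left_inj' hWq.ne'] at h2
    exact_mod_cast h2

lemma card_majorSet_le (W Q : ℕ) : (majorSet W Q).card ≤ Q ^ 2 := by
  have h := Finset.card_eq_sum_card_fiberwise (s := majorSet W Q) (t := Finset.Ioc 0 Q)
    (f := fun b : ℕ => ((b : ℚ) / W).den) (fun b hb => by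
      have := (Finset.mem_filter.1 hb).2
      simp only [Finset.coe_Ioc, Set.mem_Ioc]
      exact ⟨Rat.den_pos _, this⟩)
  rw [h]
  calc _ ≤ ∑ q ∈ Finset.Ioc 0 Q, Q := by
        refine Finset.sum_le_sum fun q hq => ?_
        refine le_trans ?_ ((card_filter_den_le W q).trans (Finset.mem_Ioc.1 hq).2)
        exact Finset.card_le_card (Finset.filter_subset_filter _ (Finset.filter_subset _ _))
    _ = Q ^ 2 := by simp [sq]

/-- The part of the singular series modulo `W` with denominators exceeding `Q`. -/
noncomputable def singularTail (W Q : ℕ) (n : ℤ) : ℂ :=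
  ∑ b ∈ (Finset.range W).filter fun b : ℕ => ¬ ((b : ℚ) / W).den ≤ Q,
    gam ((b : ℚ) / W) ^ 3 * ex (-(n * (b / W)))

lemma sum_majorSet_gam_cube (W Q : ℕ) [NeZero W] (n : ℤ) :
    ∑ b ∈ majorSet W Q, gam ((b : ℚ) / W) ^ 3 * ex (-(n * (b / W))) =
      (ternaryCount W n : ℂ) / W ^ 2 - singularTail W Q n := by
  rw [← sum_gam_cube_mul_ex, singularTail, majorSet, eq_sub_iff_add_eq,
    Finset.sum_filter_add_sum_filter_not]

/-- Parseval modulo W reduces this to ∑ |gam|⁶ over denominators q > Q. Each term is at most 8/q³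
and at most q fractions have denominator q, leaving 8 ∑ 1/q² ≤ 8/Q. -/
lemma sum_norm_singularTail_sq_le {W Q : ℕ} (hW : 0 < W) (hQ : 0 < Q) (hQW : Q ≤ W) :
    ∑ n ∈ Finset.range W, ‖singularTail W Q n‖ ^ 2 ≤ W * (8 / Q) := by
  set B := (Finset.range W).filter fun b : ℕ => ¬ ((b : ℚ) / W).den ≤ Q with hB
  have hW0 : (W : ℝ) ≠ 0 := by exact_mod_cast hW.ne'
  let γ : ℕ → ℂ := fun b => gam ((b : ℚ) / W) ^ 3
  have h1 : ∀ n : ℕ, ((‖singularTail W Q n‖ ^ 2 : ℝ) : ℂ) =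
      ∑ b ∈ B, ∑ c ∈ B, γ b * (starRingEnd ℂ) (γ c) * ex ((n : ℝ) / W * (c - b : ℤ)) := by
    intro n
    push_cast
    rw [← Complex.mul_conj', singularTail, map_sum, Finset.sum_mul_sum]
    refine Finset.sum_congr rfl fun b _ => Finset.sum_congr rfl fun c _ => ?_
    rw [map_mul, ex_neg ((((n : ℕ) : ℤ) : ℝ) * (c / W)), Complex.conj_conj]
    have : (n : ℝ) / W * ((c : ℝ) - b) =
        -((((n : ℕ) : ℤ) : ℝ) * (b / W)) + (((n : ℕ) : ℤ) : ℝ) * (c / W) := by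
      push_cast; ring
    rw [this, ex_add]
    simp only [γ]
    ring
  have h2 : ((∑ n ∈ Finset.range W, ‖singularTail W Q n‖ ^ 2 : ℝ) : ℂ) =
      ((∑ b ∈ B, ‖γ b‖ ^ 2 * W : ℝ) : ℂ) := by
    rw [Complex.ofReal_sum]
    simp_rw [h1]
    rw [Finset.sum_comm, Complex.ofReal_sum]
    refine Finset.sum_congr rfl fun b hb => ?_
    rw [Finset.sum_comm]
    simp_rw [← Finset.mul_sum, sum_range_ex_mul_div W hW]
    rw [Finset.sum_eq_single_of_mem b hb]
    · simp [Complex.mul_conj']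
    · intro c hc hcb
      rw [if_neg, mul_zero]
      intro hd
      have hb' := Finset.mem_range.1 (Finset.mem_filter.1 hb).1
      have hc' := Finset.mem_range.1 (Finset.mem_filter.1 hc).1
      have h3 : (c : ℤ) - b = 0 := Int.eq_zero_of_abs_lt_dvd hd (by rw [abs_lt]; omega)
      exact hcb (by omega)
  rw [Complex.ofReal_injective h2, ← Finset.sum_mul, mul_comm]
  refine mul_le_mul_of_nonneg_left ?_ (Nat.cast_nonneg W)
  have h3 : ∀ b : ℕ, ‖γ b‖ ^ 2 ≤ 8 / ((((b : ℚ) / W).den : ℕ) : ℝ) ^ 3 := by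
    intro b
    have h4 := norm_gam_sq_le ((b : ℚ) / W)
    calc ‖γ b‖ ^ 2 = (‖gam ((b : ℚ) / W)‖ ^ 2) ^ 3 := by simp only [γ]; rw [norm_pow]; ring
      _ ≤ (2 / ((((b : ℚ) / W).den : ℕ) : ℝ)) ^ 3 := by gcongr
      _ = _ := by rw [div_pow]; norm_num
  calc ∑ b ∈ B, ‖γ b‖ ^ 2 ≤ ∑ b ∈ B, 8 / ((((b : ℚ) / W).den : ℕ) : ℝ) ^ 3 :=
        Finset.sum_le_sum fun b _ => h3 b
    _ = ∑ q ∈ Finset.Ioc Q W, ∑ b ∈ B.filter fun b : ℕ => ((b : ℚ) / W).den = q,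
        8 / ((((b : ℚ) / W).den : ℕ) : ℝ) ^ 3 := by
        refine (Finset.sum_fiberwise_of_maps_to (fun b hb => ?_) _).symm
        have := (Finset.mem_filter.1 hb).2
        rw [Finset.mem_Ioc]
        exact ⟨not_le.1 this, Nat.le_of_dvd hW (den_natCast_div_dvd b W)⟩
    _ ≤ ∑ q ∈ Finset.Ioc Q W, 8 * ((q : ℝ) ^ 2)⁻¹ := by
        refine Finset.sum_le_sum fun q hq => ?_
        have hq0 : (0 : ℝ) < q := by
          exact_mod_cast (by have := (Finset.mem_Ioc.1 hq).1; omega : 0 < q)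
        rw [Finset.sum_congr rfl fun b hb => by rw [(Finset.mem_filter.1 hb).2], Finset.sum_const,
          nsmul_eq_mul]
        have hcard : ((B.filter fun b : ℕ => ((b : ℚ) / W).den = q).card : ℝ) ≤ q := by
          exact_mod_cast (Finset.card_le_card (Finset.filter_subset_filter _
            (Finset.filter_subset _ _))).trans (card_filter_den_le W q)
        calc _ ≤ (q : ℝ) * (8 / (q : ℝ) ^ 3) := by gcongr
          _ = _ := by field_simp
    _ = 8 * ∑ q ∈ Finset.Ioc Q W, ((q : ℝ) ^ 2)⁻¹ := by rw [Finset.mul_sum]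
    _ ≤ 8 * ((Q : ℝ)⁻¹ - (W : ℝ)⁻¹) := by
        gcongr
        exact sum_Ioc_inv_sq_le_sub hQ.ne' hQW
    _ ≤ 8 / Q := by
        rw [div_eq_mul_inv]
        gcongr
        rw [sub_le_self_iff]
        positivity

/-- Lower bound for the expected number of representations. -/
lemma le_norm_sum_majorSet (W Q M : ℕ) [NeZero W] (n : ℤ) :
    M * ((ternaryCount W n : ℝ) / W ^ 2 - ‖singularTail W Q n‖) - 4 * Q ^ 2 ≤
      ‖∑ b ∈ majorSet W Q, gam ((b : ℚ) / W) ^ 2 * ex (-(n * (b / W))) *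
        ∑ t ∈ Finset.Ioc 0 M, ex (b / W * (t : ℝ) ^ 2)‖ := by
  have h1 : ∑ b ∈ majorSet W Q, gam ((b : ℚ) / W) ^ 2 * ex (-(n * (b / W))) *
        ∑ t ∈ Finset.Ioc 0 M, ex (b / W * (t : ℝ) ^ 2) =
      M * ((ternaryCount W n : ℂ) / W ^ 2 - singularTail W Q n) +
      ∑ b ∈ majorSet W Q, gam ((b : ℚ) / W) ^ 2 * ex (-(n * (b / W))) *
        (∑ t ∈ Finset.Ioc 0 M, ex (b / W * (t : ℝ) ^ 2) - M * gam ((b : ℚ) / W)) := by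
    rw [← sum_majorSet_gam_cube, Finset.mul_sum, ← Finset.sum_add_distrib]
    exact Finset.sum_congr rfl fun b _ => by ring
  have h2 : ‖∑ b ∈ majorSet W Q, gam ((b : ℚ) / W) ^ 2 * ex (-(n * (b / W))) *
      (∑ t ∈ Finset.Ioc 0 M, ex (b / W * (t : ℝ) ^ 2) - M * gam ((b : ℚ) / W))‖ ≤ 4 * Q ^ 2 := by
    calc _ ≤ ∑ b ∈ majorSet W Q, (4 : ℝ) := by
          refine (norm_sum_le _ _).trans (Finset.sum_le_sum fun b _ => ?_)
          have h3 := norm_sum_ex_sub_mul_gam_le ((b : ℚ) / W) M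
          push_cast at h3
          rw [norm_mul, norm_mul, norm_ex, mul_one, norm_pow]
          have hd : (0 : ℝ) < (((b : ℚ) / W).den : ℕ) := by exact_mod_cast Rat.den_pos _
          -- The Gauss sum bound 2/q compensates the incomplete period 2q, so each of the at most Q²
          -- fractions costs only 4.
          calc _ ≤ 2 / ((((b : ℚ) / W).den : ℕ) : ℝ) * (2 * (((b : ℚ) / W).den : ℕ)) :=
                mul_le_mul (norm_gam_sq_le _) h3 (norm_nonneg _) (by positivity)
            _ = 4 := by field_simp; norm_num
      _ = 4 * ((majorSet W Q).card : ℝ) := by rw [Finset.sum_const, nsmul_eq_mul, mul_comm]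
      _ ≤ _ := by
          gcongr
          exact_mod_cast card_majorSet_le W Q
  rw [h1]
  have h4 : (M : ℝ) * ((ternaryCount W n : ℝ) / W ^ 2 - ‖singularTail W Q n‖) ≤
      ‖(M : ℂ) * ((ternaryCount W n : ℂ) / W ^ 2 - singularTail W Q n)‖ := by
    rw [norm_mul, Complex.norm_natCast]
    refine mul_le_mul_of_nonneg_left ?_ (Nat.cast_nonneg M)
    have h5 := norm_sub_norm_le ((ternaryCount W n : ℂ) / W ^ 2) (singularTail W Q n)
    rwa [norm_div, Complex.norm_natCast, norm_pow, Complex.norm_natCast] at h5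
  have h6 := norm_sub_le_norm_add ((M : ℂ) * ((ternaryCount W n : ℂ) / W ^ 2 - singularTail W Q n))
    (∑ b ∈ majorSet W Q, gam ((b : ℚ) / W) ^ 2 * ex (-(n * (b / W))) *
      (∑ t ∈ Finset.Ioc 0 M, ex (b / W * (t : ℝ) ^ 2) - M * gam ((b : ℚ) / W)))
  linarith

lemma singularTail_add_natCast (W Q : ℕ) (hW : 0 < W) (n : ℤ) :
    singularTail W Q (n + W) = singularTail W Q n := by
  unfold singularTail
  refine Finset.sum_congr rfl fun b _ => ?_
  rw [← ex_add_intCast (-(n * ((b : ℝ) / W))) (-b)]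
  congr 2
  have : (W : ℝ) ≠ 0 := by exact_mod_cast hW.ne'
  push_cast
  field_simp
  ring

/-! ### Counting exceptional integers. -/

/-- Integers with a large tail of the singular series are rare. -/
lemma card_mul_sq_le_of_lt_norm_singularTail {W Q : ℕ} (hW : 0 < W) (hQ : 0 < Q) (hQW : Q ≤ W)
    {X κ : ℝ} (hX : (W : ℝ) ≤ X) (hκ : 0 ≤ κ) (B : Finset ℤ)
    (hB : ∀ n ∈ B, 0 < n ∧ (n : ℝ) ≤ X ∧ κ < ‖singularTail W Q n‖) :
    B.card * κ ^ 2 ≤ 16 * X / Q := by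
  -- With this many periods of length W the integers up to X are covered, and kW ≤ 2X because W ≤ X.
  set k := ⌊X⌋₊ / W + 1
  have hX0 : 0 ≤ X := (Nat.cast_nonneg W).trans hX
  have hQ0 : (0 : ℝ) < Q := by exact_mod_cast hQ
  let F : ℕ → ℝ := fun n => ‖singularTail W Q n‖ ^ 2
  have hper : Function.Periodic F W := by
    intro n
    have := singularTail_add_natCast W Q hW n
    simp only [F]
    push_cast
    rw [this]
  have h1 : (B.card : ℝ) * κ ^ 2 ≤ ∑ n ∈ B, ‖singularTail W Q n‖ ^ 2 := by
    rw [← nsmul_eq_mul, ← Finset.sum_const]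
    exact Finset.sum_le_sum fun n hn => pow_le_pow_left₀ hκ (hB n hn).2.2.le 2
  have h2 : ∑ n ∈ B, ‖singularTail W Q n‖ ^ 2 = ∑ n ∈ B.image Int.toNat, F n := by
    rw [Finset.sum_image]
    · refine Finset.sum_congr rfl fun n hn => ?_
      simp only [F]
      rw [Int.toNat_of_nonneg (hB n hn).1.le]
    · intro n hn m hm h
      have := (hB n hn).1
      have := (hB m hm).1
      omega
  have h3 : ∑ n ∈ B.image Int.toNat, F n ≤ ∑ n ∈ Finset.range (W * k), F n := by
    refine Finset.sum_le_sum_of_subset_of_nonneg ?_ fun n _ _ => sq_nonneg _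
    intro m hm
    obtain ⟨n, hn, rfl⟩ := Finset.mem_image.1 hm
    rw [Finset.mem_range]
    obtain ⟨h4, h5, -⟩ := hB n hn
    have h6 : n.toNat ≤ ⌊X⌋₊ := by
      refine Nat.le_floor ?_
      have : ((n.toNat : ℕ) : ℝ) = n := by exact_mod_cast Int.toNat_of_nonneg h4.le
      rw [this]; exact h5
    exact h6.trans_lt (Nat.lt_mul_div_succ _ hW)
  rw [sum_range_mul_of_periodic hper, nsmul_eq_mul] at h3
  have h4 := sum_norm_singularTail_sq_le hW hQ hQW
  have h5 : (k : ℝ) * W ≤ 2 * X := by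
    have h6 : ((⌊X⌋₊ / W * W : ℕ) : ℝ) ≤ X :=
      (Nat.cast_le.2 (Nat.div_mul_le_self _ _)).trans (Nat.floor_le hX0)
    simp only [k]
    push_cast at h6 ⊢
    linarith
  calc (B.card : ℝ) * κ ^ 2 ≤ k * ∑ n ∈ Finset.range W, F n := by
        rw [h2] at h1; exact h1.trans h3
    _ ≤ k * (W * (8 / Q)) := mul_le_mul_of_nonneg_left h4 (Nat.cast_nonneg k)
    _ = k * W * (8 / Q) := by ring
    _ ≤ 2 * X * (8 / Q) := by gcongr
    _ = _ := by ring

/-- Integers that are a square plus the square of some `t ≤ M` are rare. -/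
lemma card_le_of_exists_sq_add_sq {X : ℝ} (M : ℕ) (B : Finset ℤ)
    (hB : ∀ n ∈ B, (n : ℝ) ≤ X ∧ ∃ x : ℤ, ∃ t ∈ Finset.Ioc 0 M, x ^ 2 + (t : ℤ) ^ 2 = n) :
    (B.card : ℝ) ≤ M * (√X + 1) := by
  have hsub : B ⊆ (Finset.Ioc 0 M ×ˢ Finset.range (⌊√X⌋₊ + 1)).image
      fun p => (p.2 : ℤ) ^ 2 + (p.1 : ℤ) ^ 2 := by
    intro n hn
    obtain ⟨h1, x, t, ht, h2⟩ := hB n hn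
    refine Finset.mem_image.2 ⟨(t, x.natAbs), Finset.mem_product.2 ⟨ht, ?_⟩, ?_⟩
    · rw [Finset.mem_range, Nat.lt_succ_iff]
      refine Nat.le_floor (Real.le_sqrt_of_sq_le ?_)
      rw [Nat.cast_natAbs]
      push_cast
      rw [sq_abs]
      refine le_trans ?_ h1
      have : x ^ 2 ≤ n := by nlinarith [sq_nonneg (t : ℤ)]
      exact_mod_cast this
    · simp only [Int.natCast_natAbs, sq_abs]
      exact h2
  have h1 := (Finset.card_le_card hsub).trans Finset.card_image_le
  rw [Finset.card_product, Nat.card_Ioc, Finset.card_range, Nat.sub_zero] at h1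
  calc (B.card : ℝ) ≤ (M * (⌊√X⌋₊ + 1) : ℕ) := by exact_mod_cast h1
    _ ≤ _ := by
      push_cast
      gcongr
      exact Nat.floor_le (Real.sqrt_nonneg X)

open Real in
/-- The main variance argument: integers for which the model predicts many representations but
which have none are rare. -/
lemma exists_card_mul_sq_le :
    ∃ K : ℝ, 0 < K ∧ ∀ (X μ : ℝ) (W Q M : ℕ) (S : Finset ℤ), 2000 ≤ X → 0 < W → 0 < Q → 0 < M →
      (∀ q, 0 < q → q ≤ Q → q ∣ W) → 2 * W ≤ ⌊√X⌋₊ → 0 ≤ μ →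
      (∀ n ∈ S, (M : ℤ) ^ 2 ≤ n ∧ (n : ℝ) ≤ X ∧
        (∀ x y : ℤ, ∀ t ∈ Finset.Ioc 0 M, x ^ 2 + y ^ 2 ≠ n - (t : ℤ) ^ 2) ∧
        μ ≤ M * ((ternaryCount W n : ℝ) / W ^ 2 - ‖singularTail W Q n‖) - 4 * Q ^ 2) →
      S.card * μ ^ 2 ≤ K * ((W : ℝ) ^ 3 * M ^ 2 * √X +
        X * (M * log X + (M * (1 + log (2 * M))) ^ 2 / Q)) := by
  obtain ⟨K, hK, hint⟩ := exists_integral_norm_sq_le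
  refine ⟨K * 8, by positivity, fun X μ W Q M S hX hW hQ hM hQW hWN hμ hS => ?_⟩
  have : NeZero W := ⟨hW.ne'⟩
  have hX0 : 0 < X := by linarith
  have hQ0 : (0 : ℝ) < Q := by exact_mod_cast hQ
  have hH : Continuous fun α => (thetaF X α ^ 2 - modelF X W Q α) * gF X M α := by
    have := continuous_thetaF hX0
    have := continuous_modelF hX0 W Q
    have := continuous_gF X M
    fun_prop
  have h1 := sum_norm_sq_integral_mul_ex_le hH S
  have h2 : S.card * μ ^ 2 ≤ ∑ n ∈ S,
      ‖∫ α in (0 : ℝ)..1, (thetaF X α ^ 2 - modelF X W Q α) * gF X M α * ex (-(n * α))‖ ^ 2 := by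
    rw [← nsmul_eq_mul, ← Finset.sum_const]
    refine Finset.sum_le_sum fun n hn => pow_le_pow_left₀ hμ ?_ 2
    obtain ⟨h3, h4, h5, h6⟩ := hS n hn
    rw [integral_error_mul_ex hX0 W Q M h3 h5, norm_neg, norm_mul, norm_mul, Complex.norm_real,
      Complex.norm_real, Real.norm_of_nonneg pi_pos.le, Real.norm_of_nonneg (exp_pos _).le]
    have h7 := h6.trans (le_norm_sum_majorSet W Q M n)
    -- Since n ≤ X, the weight is at least 1/e, and π > e.
    have h8 : 1 ≤ π * rexp (-n / X) := by
      have h9 : -1 ≤ -(n : ℝ) / X := by rw [le_div_iff₀ hX0]; linarith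
      have h10 := Real.exp_le_exp.2 h9
      have h11 : rexp 1 ≤ π := by linarith [Real.exp_one_lt_d9, pi_gt_three]
      calc (1 : ℝ) = rexp 1 * rexp (-1) := by rw [← Real.exp_add]; simp
        _ ≤ _ := mul_le_mul h11 h10 (exp_pos _).le pi_pos.le
    exact h7.trans (le_mul_of_one_le_left (norm_nonneg _) h8)
  have h3 := hint X W Q M hX hW hQW hWN
  refine h2.trans (h1.trans (h3.trans ?_))
  rw [mul_assoc K]
  refine mul_le_mul_of_nonneg_left ?_ hK.le
  have h4 := sum_sqPairCount_div_le Q ⌊√X⌋₊ M hQ hM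
  have hN0 : (0 : ℝ) < ⌊√X⌋₊ := by exact_mod_cast (by omega : 0 < ⌊√X⌋₊)
  have hlogX : 2 ≤ log X := by
    rw [le_log_iff_exp_le hX0]
    have : rexp 2 = rexp 1 ^ 2 := by rw [← Real.exp_nat_mul]; norm_num
    rw [this]
    have h5 := Real.exp_one_lt_d9
    have h6 : rexp 1 ^ 2 ≤ 3 ^ 2 := by gcongr; linarith
    linarith
  have h5 : 1 + log (⌊√X⌋₊ : ℝ) ≤ log X := by
    have h6 : log (⌊√X⌋₊ : ℝ) ≤ log (√X) := log_le_log hN0 (Nat.floor_le (Real.sqrt_nonneg X))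
    rw [log_sqrt hX0.le] at h6
    linarith
  have h6 : ∑ q ∈ Finset.Ioc Q ⌊√X⌋₊, (sqPairCount q M : ℝ) / q ≤
      8 * (M * log X + (M * (1 + log (2 * M))) ^ 2 / Q) := by
    refine h4.trans ?_
    have e1 : 2 * (2 * M * (1 + log (2 * M))) ^ 2 / (Q : ℝ) =
      8 * ((M * (1 + log (2 * M))) ^ 2 / Q) := by ring
    have e2 : (M : ℝ) * (1 + log (⌊√X⌋₊ : ℝ)) ≤ M * log X := by gcongr
    have e3 : 0 ≤ (M : ℝ) * log X := by positivity
    rw [e1]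
    linarith
  have h7 := mul_le_mul_of_nonneg_left h6 hX0.le
  have h8 : 0 ≤ (W : ℝ) ^ 3 * M ^ 2 * √X := by positivity
  linarith

/-! ### Choice of parameters and conclusion. -/

open Real in
/-- The size conditions on `X` and `Y` under which the parameters of the circle method are
admissible; here `y` is the cube root of `Y`. -/
lemma exists_parameter_bounds {c δ : ℝ} (hc : 0 < c) (hδ : δ < 1 / 6) :
    ∃ X₀ : ℝ, ∀ X Y : ℝ, X₀ ≤ X → log X * log (log X) ^ 2 ≤ Y → Y ≤ log X ^ (1 + δ) →
      ∃ y : ℝ, y ^ 3 = Y ∧ 2 ≤ y ∧ 2000 ≤ X ∧ 1 ≤ log X ∧ 1 ≤ log (log X) ∧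
        log y ≤ log (log X) ∧ y ^ 2 * (1 + log (2 * Y)) ^ 2 ≤ log X ∧
        32 * y ^ 2 * log (log X) ≤ c * Y ∧ y ^ (3 * y) * Y ≤ √X ∧ 2 * Y ^ 2 ≤ √X := by
  -- Here u stands for log X. As δ < 1/6, Y ≤ u^(7/6) and y ≤ u^(7/18). Since 7/18 + 1/9 = 1/2,
  -- bounding logarithms by u^(1/9) gives both y² log² ≤ u and y log y at most of order √u.
  have e1 : ∀ᶠ u : ℝ in Filter.atTop, 3 * log u ≤ u ^ (1 / 9 : ℝ) := by
    filter_upwards [(isLittleO_log_rpow_atTop (by norm_num : (0 : ℝ) < 1 / 9)).bound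
      (by norm_num : (0 : ℝ) < 1 / 3), Filter.eventually_ge_atTop 1] with u h1 h2
    rw [norm_of_nonneg (log_nonneg h2), norm_of_nonneg (by positivity)] at h1
    linarith
  have e2 : ∀ᶠ u : ℝ in Filter.atTop, 32 * log u ≤ c * u ^ (1 / 3 : ℝ) := by
    filter_upwards [(isLittleO_log_rpow_atTop (by norm_num : (0 : ℝ) < 1 / 3)).bound
      (by positivity : (0 : ℝ) < c / 32), Filter.eventually_ge_atTop 1] with u h1 h2
    rw [norm_of_nonneg (log_nonneg h2), norm_of_nonneg (by positivity)] at h1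
    linarith
  obtain ⟨u₀, hu₀⟩ := Filter.eventually_atTop.1 (e1.and (e2.and (Filter.eventually_ge_atTop 100)))
  refine ⟨rexp u₀, fun X Y hX hY1 hY2 => ?_⟩
  have hXpos : 0 < X := (exp_pos _).trans_le hX
  obtain ⟨h1, h2, h3⟩ := hu₀ (log X) ((le_log_iff_exp_le hXpos).2 hX)
  have hXe : rexp (log X) = X := exp_log hXpos
  set u := log X
  have hu0 : 0 < u := by linarith
  have hl : 1 ≤ log u := by
    rw [le_log_iff_exp_le hu0]
    linarith [exp_one_lt_d9]
  have hY3 : u ≤ Y := by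
    refine le_trans ?_ hY1
    exact le_mul_of_one_le_right hu0.le (one_le_pow₀ hl)
  have hY0 : 0 < Y := by linarith
  have hY4 : Y ≤ u ^ (7 / 6 : ℝ) :=
    hY2.trans (rpow_le_rpow_of_exponent_le (by linarith) (by linarith))
  have hlogY : log Y ≤ 7 / 6 * log u := by
    rw [← log_rpow hu0]
    exact log_le_log hY0 hY4
  have hsq : u ^ (1 / 9 : ℝ) ≤ √u := by
    rw [sqrt_eq_rpow]
    exact rpow_le_rpow_of_exponent_le (by linarith) (by norm_num)
  have hsq4 : 4 ≤ √u := by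
    refine le_sqrt_of_sq_le ?_
    linarith
  have hsqu : √u * √u = u := mul_self_sqrt hu0.le
  have hsX : √X = rexp (u / 2) := by rw [exp_half, hXe]
  have hlu : u / 2 ≥ 2 * √u := by nlinarith
  set y := Y ^ (1 / 3 : ℝ)
  have hy3 : y ^ 3 = Y := by
    simp only [y]
    rw [← rpow_natCast, ← rpow_mul hY0.le]
    norm_num
  have hy0 : 0 < y := rpow_pos_of_pos hY0 _
  have hyl : u ^ (1 / 3 : ℝ) ≤ y := rpow_le_rpow hu0.le hY3 (by norm_num)
  have hy2 : 2 ≤ y := by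
    by_contra! h
    have : y ^ 3 ≤ 2 ^ 3 := pow_le_pow_left₀ hy0.le h.le 3
    linarith
  have hyu : y ≤ u ^ (7 / 18 : ℝ) := by
    have := rpow_le_rpow hY0.le hY4 (by norm_num : (0 : ℝ) ≤ 1 / 3)
    rwa [← rpow_mul hu0.le, show (7 / 6 * (1 / 3) : ℝ) = 7 / 18 by norm_num] at this
  have hlogy : log y ≤ log u := by
    simp only [y]
    rw [log_rpow hY0]
    linarith
  have hlogy0 : 0 ≤ log y := log_nonneg (by linarith)
  refine ⟨y, hy3, hy2, ?_, by linarith, hl, hlogy, ?_, ?_, ?_, ?_⟩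
  · have := quadratic_le_exp_of_nonneg hu0.le
    rw [hXe] at this
    nlinarith
  · have h4 : 1 + log (2 * Y) ≤ u ^ (1 / 9 : ℝ) := by
      rw [log_mul two_ne_zero hY0.ne']
      linarith [log_two_lt_d9]
    have h5 : 0 ≤ 1 + log (2 * Y) := by
      have := log_nonneg (by linarith : (1 : ℝ) ≤ 2 * Y)
      linarith
    calc y ^ 2 * (1 + log (2 * Y)) ^ 2 ≤ (u ^ (7 / 18 : ℝ)) ^ 2 * (u ^ (1 / 9 : ℝ)) ^ 2 := by
          gcongr
      _ = u := by
          rw [← mul_pow, ← rpow_add hu0, ← rpow_natCast, ← rpow_mul hu0.le]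
          norm_num
  · rw [← hy3]
    have : 32 * log u ≤ c * y := h2.trans (by gcongr)
    calc 32 * y ^ 2 * log u = y ^ 2 * (32 * log u) := by ring
      _ ≤ y ^ 2 * (c * y) := by gcongr
      _ = _ := by ring
  · have h4 : 3 * (y * log y) ≤ √u := by
      calc 3 * (y * log y) = y * (3 * log y) := by ring
        _ ≤ u ^ (7 / 18 : ℝ) * u ^ (1 / 9 : ℝ) := by
          have : 3 * log y ≤ u ^ (1 / 9 : ℝ) := by linarith
          gcongr
        _ = √u := by rw [← rpow_add hu0, sqrt_eq_rpow]; norm_num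
    rw [hsX, rpow_def_of_pos hy0]
    have h5 : rexp (log y * (3 * y)) * Y = rexp (log y * (3 * y) + log Y) := by
      rw [exp_add, exp_log hY0]
    rw [h5]
    exact exp_le_exp.2 (by linarith)
  · rw [hsX]
    have h4 : 2 * Y ^ 2 = rexp (log 2 + 2 * log Y) := by
      rw [exp_add, exp_log two_pos, two_mul (log Y), exp_add, exp_log hY0]
      ring
    rw [h4]
    exact exp_le_exp.2 (by linarith [log_two_lt_d9])

lemma isRep_of_sq_add_sq_eq {n : ℤ} {x y : ℤ} {t : ℕ} {Y : ℝ} (hx : x ≠ 0) (hy : y ≠ 0)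
    (ht : 0 < t) (htY : (t : ℝ) ≤ Y) (h : x ^ 2 + y ^ 2 = n - (t : ℤ) ^ 2) : IsRep n Y := by
  refine ⟨x.natAbs, y.natAbs, t, Int.natAbs_pos.2 hx, Int.natAbs_pos.2 hy, ht, ?_, htY⟩
  simp only [Int.natCast_natAbs, sq_abs]
  linarith

-- The parameters are M = ⌊Y⌋, Q = ⌊y⌋ and W = Q!. Exceptional integers are split into sums of an
-- integer square and some t² with t ≤ M, those with a large singular tail, and the rest, to which
-- the variance bound applies.
open Real in
lemma exists_E_le_of_parameter_bounds :
    ∃ c C : ℝ, 0 < c ∧ ∀ X Y y : ℝ, y ^ 3 = Y → 2 ≤ y → 2000 ≤ X → 1 ≤ log X →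
      1 ≤ log (log X) → log y ≤ log (log X) → y ^ 2 * (1 + log (2 * Y)) ^ 2 ≤ log X →
      32 * y ^ 2 * log (log X) ≤ c * Y → y ^ (3 * y) * Y ≤ √X → 2 * Y ^ 2 ≤ √X →
      (E X Y : ℝ) ≤ C * (X * Y⁻¹ * log X * log (log X) ^ 2) := by
  classical
  obtain ⟨c, hc, hcount⟩ := exists_le_ternaryCount_factorial
  obtain ⟨K, hK, hvar⟩ := exists_card_mul_sq_le
  refine ⟨c, 1 + 128 / c ^ 2 + 80 * K / c ^ 2, hc, ?_⟩
  intro X Y y hyY hy2 hX hL hl hlogy hlogsq hcY hW3 hYX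
  set L := log X
  set l := log L
  have hl0 : 0 < l := by linarith
  have hL0 : 0 < L := by linarith
  have hX0 : 0 < X := by linarith
  have hy0 : 0 < y := by linarith
  have hY8 : 8 ≤ Y := by
    rw [← hyY]
    calc (8 : ℝ) = 2 ^ 3 := by norm_num
      _ ≤ _ := by gcongr
  have hY0 : 0 < Y := by linarith
  have hsX : √X * √X = X := mul_self_sqrt hX0.le
  have hsX1 : 1 ≤ √X := one_le_sqrt.2 (by linarith)
  set M := ⌊Y⌋₊
  set Q := ⌊y⌋₊
  set W := Q.factorial
  have hMY : (M : ℝ) ≤ Y := Nat.floor_le hY0.le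
  have hYM : Y / 2 ≤ M := by
    have := Nat.lt_floor_add_one Y
    linarith
  have hQy : (Q : ℝ) ≤ y := Nat.floor_le hy0.le
  have hyQ : y / 2 ≤ Q := by
    have := Nat.lt_floor_add_one y
    linarith
  have hQ2 : 2 ≤ Q := Nat.le_floor (by exact_mod_cast hy2)
  have hQ0 : (0 : ℝ) < Q := by linarith
  have hM0' : (0 : ℝ) < M := by linarith
  have hM0 : 0 < M := by exact_mod_cast hM0'
  have hWpos : 0 < W := Nat.factorial_pos Q
  have hW1 : (1 : ℝ) ≤ W := by exact_mod_cast hWpos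
  have hWY : (W : ℝ) ^ 3 * Y ≤ √X := by
    refine le_trans ?_ hW3
    refine mul_le_mul_of_nonneg_right ?_ hY0.le
    have h1 : (W : ℝ) ≤ y ^ y := by
      calc (W : ℝ) ≤ (Q : ℝ) ^ Q := by exact_mod_cast Nat.factorial_le_pow Q
        _ ≤ y ^ Q := by gcongr
        _ = y ^ (Q : ℝ) := (rpow_natCast _ _).symm
        _ ≤ y ^ y := rpow_le_rpow_of_exponent_le (by linarith) hQy
    rw [mul_comm, rpow_mul hy0.le]
    calc (W : ℝ) ^ 3 ≤ (y ^ y) ^ 3 := by gcongr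
      _ = _ := by rw [← rpow_natCast]; norm_num
  have hW8 : 8 * (W : ℝ) ≤ √X := by
    have h1 : (W : ℝ) ≤ (W : ℝ) ^ 3 := le_self_pow₀ hW1 (by norm_num)
    calc 8 * (W : ℝ) ≤ Y * (W : ℝ) ^ 3 := by gcongr
      _ ≤ _ := by rwa [mul_comm]
  have hWX : (W : ℝ) ≤ X := by nlinarith
  have hWN : 2 * W ≤ ⌊√X⌋₊ := by
    refine Nat.le_floor ?_
    push_cast
    linarith
  -- Half of the lower bound c/l for the local density, so that a tail of size at most κ leaves κ.
  set κ := c / (2 * l) with hκ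
  have hκ0 : 0 < κ := by positivity
  have hY2 : 2 * Y ^ 2 ≤ X := hYX.trans (by nlinarith)
  set S := (exceptionalSet_finite X Y).toFinset
  have hSE : E X Y = S.card := Set.ncard_eq_toFinset_card _ _
  have hmem : ∀ n ∈ S, X / 2 < (n : ℝ) ∧ (n : ℝ) ≤ X ∧ ¬ (4 : ℤ) ∣ n ∧ ¬ n ≡ 7 [ZMOD 8] ∧
      ¬ IsRep n Y := fun n hn =>
    (exceptionalSet_finite X Y).mem_toFinset.1 hn
  -- These n must be set aside because theta coefficients also count solutions with a vanishing
  -- coordinate, whereas `IsRep` asks for positive ones.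
  let P : ℤ → Prop := fun n => ∃ x : ℤ, ∃ t ∈ Finset.Ioc 0 M, x ^ 2 + (t : ℤ) ^ 2 = n
  let R : ℤ → Prop := fun n => κ < ‖singularTail W Q n‖
  set B₁ := S.filter P
  set B₂ := S.filter R
  set S' := S.filter fun n => ¬ P n ∧ ¬ R n
  have hcard : S.card ≤ B₁.card + B₂.card + S'.card := by
    have : S ⊆ (B₁ ∪ B₂) ∪ S' := by
      intro n hn
      simp only [B₁, B₂, S', Finset.mem_union, Finset.mem_filter]
      by_cases h1 : P n
      · exact Or.inl (Or.inl ⟨hn, h1⟩)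
      by_cases h2 : R n
      · exact Or.inl (Or.inr ⟨hn, h2⟩)
      exact Or.inr ⟨hn, h1, h2⟩
    refine (Finset.card_le_card this).trans ((Finset.card_union_le _ _).trans ?_)
    gcongr
    exact Finset.card_union_le _ _
  set T := X * Y⁻¹ * L * l ^ 2 with hT
  have hXY : X * Y⁻¹ ≤ T := by
    have : 1 ≤ L * l ^ 2 := one_le_mul_of_one_le_of_one_le hL (one_le_pow₀ hl)
    rw [hT, mul_assoc]
    exact le_mul_of_one_le_right (by positivity) this
  have b1 : (B₁.card : ℝ) ≤ T := by
    refine le_trans ?_ hXY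
    have h1 := card_le_of_exists_sq_add_sq (X := X) M B₁ fun n hn => by
      obtain ⟨h1, h2⟩ := Finset.mem_filter.1 hn
      exact ⟨(hmem n h1).2.1, h2⟩
    refine h1.trans ?_
    rw [← div_eq_mul_inv, le_div_iff₀ hY0]
    calc (M : ℝ) * (√X + 1) * Y ≤ Y * (√X + √X) * Y := by gcongr
      _ = 2 * Y ^ 2 * √X := by ring
      _ ≤ √X * √X := by gcongr
      _ = X := hsX
  -- Since Y = y³, 1/Q ≤ 2/y is 1/Y at the cost of 2y², which log X absorbs even with a squared
  -- logarithm of Y.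
  have hQinv : (Q : ℝ)⁻¹ ≤ 2 * y ^ 2 / Y := by
    rw [← hyY, show 2 * y ^ 2 / y ^ 3 = (y / 2)⁻¹ by field_simp]
    gcongr
  have hyL : y ^ 2 ≤ L := by
    refine le_trans (le_mul_of_one_le_right (by positivity) ?_) hlogsq
    refine one_le_pow₀ ?_
    have := log_nonneg (by linarith : (1 : ℝ) ≤ 2 * Y)
    linarith
  have b2 : (B₂.card : ℝ) ≤ 128 / c ^ 2 * T := by
    have h1 := card_mul_sq_le_of_lt_norm_singularTail hWpos (by omega) (Nat.self_le_factorial Q)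
      hWX hκ0.le B₂ fun n hn => by
        obtain ⟨h1, h2⟩ := Finset.mem_filter.1 hn
        obtain ⟨h3, h4, -⟩ := hmem n h1
        refine ⟨?_, h4, h2⟩
        have : (0 : ℝ) < n := by linarith
        exact_mod_cast this
    rw [← le_div_iff₀ (by positivity)] at h1
    refine h1.trans ?_
    calc 16 * X / Q / κ ^ 2 = 64 * X * l ^ 2 / c ^ 2 * (Q : ℝ)⁻¹ := by
          rw [hκ]; field_simp; norm_num
      _ ≤ 64 * X * l ^ 2 / c ^ 2 * (2 * y ^ 2 / Y) := by gcongr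
      _ ≤ 64 * X * l ^ 2 / c ^ 2 * (2 * L / Y) := by gcongr
      _ = _ := by rw [hT]; field_simp; norm_num
  have b3 : (S'.card : ℝ) ≤ 80 * K / c ^ 2 * T := by
    -- Density at least 2κ, tail at most κ and 4Q² ≤ Mκ/2 leave a main term of at least Mκ/2.
    have h1 := hvar X (M * κ / 2) W Q M S' hX hWpos (by omega) hM0
      (fun q h h' => Nat.dvd_factorial h h') hWN (by positivity) fun n hn => by
        obtain ⟨hnS, hnP, hnR⟩ := Finset.mem_filter.1 hn
        obtain ⟨h3, h4, h5, h6, h7⟩ := hmem n hnS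
        refine ⟨?_, h4, ?_, ?_⟩
        · have : (M : ℝ) ^ 2 ≤ (n : ℝ) := by
            calc (M : ℝ) ^ 2 ≤ Y ^ 2 := by gcongr
              _ ≤ (n : ℝ) := by linarith
          exact_mod_cast this
        · intro a b t ht hab
          have ht' := Finset.mem_Ioc.1 ht
          have htY : (t : ℝ) ≤ Y := (Nat.cast_le.2 ht'.2).trans hMY
          refine h7 (isRep_of_sq_add_sq_eq ?_ ?_ ht'.1 htY hab)
          · rintro rfl
            exact hnP ⟨b, t, ht, by linarith⟩
          · rintro rfl
            exact hnP ⟨a, t, ht, by linarith⟩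
        · have h8 : 2 * κ ≤ (ternaryCount W n : ℝ) / W ^ 2 := by
            rw [le_div_iff₀ (by positivity)]
            refine le_trans ?_ (hcount Q hQ2 n h5 h6)
            refine mul_le_mul_of_nonneg_right ?_ (by positivity)
            rw [hκ, show 2 * (c / (2 * l)) = c / l by field_simp]
            have hQ1 : (1 : ℝ) < Q := by exact_mod_cast hQ2
            have : 0 < log (Q : ℝ) := log_pos hQ1
            gcongr
            exact (log_le_log hQ0 hQy).trans hlogy
          have h9 : ‖singularTail W Q n‖ ≤ κ := not_lt.1 hnR
          have h10 : 4 * (Q : ℝ) ^ 2 ≤ M * κ / 2 := by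
            rw [hκ, show (M : ℝ) * (c / (2 * l)) / 2 = c * M / (4 * l) by field_simp; norm_num,
              le_div_iff₀ (by positivity)]
            calc 4 * (Q : ℝ) ^ 2 * (4 * l) ≤ 4 * y ^ 2 * (4 * l) := by gcongr
              _ = (32 * y ^ 2 * l) / 2 := by ring
              _ ≤ c * (Y / 2) := by linarith
              _ ≤ c * M := by gcongr
          have h11 : (M : ℝ) * κ ≤ M * ((ternaryCount W n : ℝ) / W ^ 2 - ‖singularTail W Q n‖) := by
            gcongr
            linarith
          linarith
    rw [← le_div_iff₀ (by positivity)] at h1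
    have e0 : 0 ≤ 1 + log (2 * (M : ℝ)) := by
      have := log_nonneg (by linarith : (1 : ℝ) ≤ 2 * M)
      linarith
    have e1 : (W : ℝ) ^ 3 * √X ≤ X * (L / Y) := by
      rw [mul_div_assoc', le_div_iff₀ hY0]
      calc (W : ℝ) ^ 3 * √X * Y = (W : ℝ) ^ 3 * Y * √X := by ring
        _ ≤ √X * √X := by gcongr
        _ = X := hsX
        _ ≤ X * L := le_mul_of_one_le_right hX0.le hL
    have e2 : L / M ≤ 2 * (L / Y) := by
      calc L / M ≤ L / (Y / 2) := by gcongr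
        _ = _ := by field_simp
    have e3 : (1 + log (2 * (M : ℝ))) ^ 2 / Q ≤ 2 * (L / Y) := by
      calc (1 + log (2 * (M : ℝ))) ^ 2 / Q = (1 + log (2 * (M : ℝ))) ^ 2 * (Q : ℝ)⁻¹ :=
            div_eq_mul_inv _ _
        _ ≤ (1 + log (2 * Y)) ^ 2 * (2 * y ^ 2 / Y) := by gcongr
        _ = 2 * (y ^ 2 * (1 + log (2 * Y)) ^ 2 / Y) := by ring
        _ ≤ _ := by gcongr
    have e4 : K * ((W : ℝ) ^ 3 * M ^ 2 * √X +
        X * (M * L + (M * (1 + log (2 * M))) ^ 2 / Q)) / (M * κ / 2) ^ 2 =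
        16 * l ^ 2 * K / c ^ 2 * ((W : ℝ) ^ 3 * √X +
          X * (L / M + (1 + log (2 * M)) ^ 2 / Q)) := by
      rw [hκ]
      field_simp
      norm_num
    refine h1.trans (e4.le.trans ?_)
    calc 16 * l ^ 2 * K / c ^ 2 * ((W : ℝ) ^ 3 * √X + X * (L / M + (1 + log (2 * M)) ^ 2 / Q))
        ≤ 16 * l ^ 2 * K / c ^ 2 * (X * (L / Y) + X * (2 * (L / Y) + 2 * (L / Y))) := by gcongr
      _ = _ := by rw [hT]; field_simp; norm_num
  rw [hSE]
  have hcard' : (S.card : ℝ) ≤ B₁.card + B₂.card + S'.card := by exact_mod_cast hcard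
  linarith

end Microsquares

theorem theorem1p2 (δ : ℝ) (hδ0 : 0 < δ) (hδ : δ < 1 / 6) :
    ∃ C X₀ : ℝ, ∀ X Y : ℝ, X₀ ≤ X →
      Real.log X * Real.log (Real.log X) ^ 2 ≤ Y →
      Y ≤ Real.log X ^ (1 + δ) →
      (Microsquares.E X Y : ℝ) ≤
        C * (X * Y⁻¹ * Real.log X * Real.log (Real.log X) ^ 2) := by
  -- Both c and C are absolute; δ affects only X₀.
  obtain ⟨c, C, hc, hE⟩ := Microsquares.exists_E_le_of_parameter_bounds
  obtain ⟨X₀, hX₀⟩ := Microsquares.exists_parameter_bounds hc hδ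
  refine ⟨C, X₀, fun X Y hX hY1 hY2 => ?_⟩
  obtain ⟨y, h1, h2, h3, h4, h5, h6, h7, h8, h9, h10⟩ := hX₀ X Y hX hY1 hY2
  exact hE X Y y h1 h2 h3 h4 h5 h6 h7 h8 h9 h10
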